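/- Let $\mathbb B$ be the infinite tree in which every vertex has three neighbours, let $O\in\mathbb B$, and let $\mathbb B_O$ be the rooted binary tree with root $O$ (of degree $2$) obtained from $\mathbb B$ by deleting one edge at $O$ together with the part of the tree stemming from it. Let $H_0$ denote the adjacency operator, $(H_0u)(x)=\sum_{y\sim x}u(y)$. Let $V$ be a bounded real function on $\mathbb B_O$ and let $H_{|\mathbb B_O}=H_0+V$ on $\ell^2(\mathbb B_O)$. Let $\sigma_O$ be the spectral measure of $H_{|\mathbb B_O}$ at $\delta_O$, let $\sigma_O'$ be the density of its absolutely continuous part, let $dw(\lambda)=(4\pi)^{-1}\sqrt{8-\lambda^2}\,d\lambda$ on $[-2\sqrt2,2\sqrt2]$ (the spectral measure at $\delta_O$ for $V=0$), and put $$\rho_O(\lambda)=\frac{\sigma_O'(\lambda)}{(4\pi)^{-1}\sqrt{8-\lambda^2}},\qquad s_O=\int_{-2\sqrt2}^{2\sqrt2}\ln\rho_O\,dw\in[-\infty,\infty)\qquad(\ln 0=-\infty,\ \exp(-\infty)=0).$$ Consider random paths $x_1=O,x_2,x_3,\dots$ in $\mathbb B_O$ from $O$ to infinity without self-intersections, where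 at each vertex one of the two neighbours further from $O$ is chosen by an independent fair coin toss. Coding paths by binary digits, let $\phi(t)=\sum_{n=1}^\infty V^2(x_n)\in[0,\infty]$ for $t\in[0,1]$, where $x_1=O,x_2,\dots$ are all vertices of the path given by the binary expansion of $t$. Then $$\exp s_O\ \ge\ \mathbb E\Big\{\exp\Big[-\tfrac14\sum_{n=1}^\infty V^2(x_n)\Big]\Big\}=\int_0^1\exp\Big(-\tfrac14\phi(t)\Big)\,dt .$$ In particular, if the right-hand side is positive, then $[-2\sqrt2,2\sqrt2]\subseteq\sigma_{ac}(H_{|\mathbb B_O})$, and also $[-2\sqrt2,2\sqrt2]\subseteq\sigma_{ac}(H)$ for $H=H_0+W$ on $\ell^2(\mathbb B)$ with any bounded real $W$ on $\mathbb B$ that agrees with $V$ on $\mathbb B_O$. Here $\sigma_{ac}$ denotes the spectrum of the restriction to the absolutely continuous subspace. -/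

import Mathlib

open MeasureTheory
open scoped ENNReal InnerProductSpace CompactlySupported

namespace BetheLattice

noncomputable section

/-! ### Spectral measures and the absolutely continuous spectrum of a bounded operator -/

section Spectral

variable {E : Type*} [NormedAddCommGroup E] [InnerProductSpace ℂ E] [CompleteSpace E]

/-- The linear functional `f ↦ ⟨ψ, f(H) ψ⟩` on compactly supported continuous functions, with
`f(H)` given by the continuous functional calculus of the self-adjoint operator `H`. -/
def spectralLinear (H : E →L[ℂ] E) (ψ : E) : C_c(ℝ, ℝ) →ₗ[ℝ] ℝ where
  toFun f := (⟪ψ, cfc (fun t => f t) H ψ⟫_ℂ).re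
  map_add' f g := by
    have h : cfc (fun t => (f + g) t) H = cfc (fun t => f t) H + cfc (fun t => g t) H :=
      cfc_add H (fun t => f t) (fun t => g t) f.continuous.continuousOn g.continuous.continuousOn
    simp only [h, add_apply, inner_add_right, Complex.add_re]
  map_smul' c f := by
    have h : cfc (fun t => (c • f) t) H = c • cfc (fun t => f t) H :=
      cfc_smul c (fun t => f t) H f.continuous.continuousOn
    simp only [h, RingHom.id_apply, smul_eq_mul, smul_apply]
    rw [← Complex.coe_smul, inner_smul_right, Complex.re_ofReal_mul]

theorem spectralLinear_nonneg (H : E →L[ℂ] E) (ψ : E) (f : C_c(ℝ, ℝ)) (hf : 0 ≤ f) :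
    0 ≤ spectralLinear H ψ f := by
  have h : (0 : E →L[ℂ] E) ≤ cfc (fun t => f t) H := cfc_nonneg fun x _ => hf x
  rw [ContinuousLinearMap.nonneg_iff_isPositive] at h
  exact h.re_inner_nonneg_right ψ

/-- The spectral measure of the self-adjoint operator `H` at the vector `ψ`: the Borel measure `μ`
on `ℝ` with `∫ f dμ = ⟨ψ, f(H) ψ⟩`. -/
def spectralMeasure (H : E →L[ℂ] E) (ψ : E) : Measure ℝ :=
  RealRMK.rieszMeasure (PositiveLinearMap.mk₀ (spectralLinear H ψ) (spectralLinear_nonneg H ψ))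

theorem integral_spectralMeasure (H : E →L[ℂ] E) (ψ : E) (f : C_c(ℝ, ℝ)) :
    ∫ x, f x ∂(spectralMeasure H ψ) = (⟪ψ, cfc (fun t => f t) H ψ⟫_ℂ).re :=
  RealRMK.integral_rieszMeasure _ f

instance (H : E →L[ℂ] E) (ψ : E) : (spectralMeasure H ψ).Regular :=
  RealRMK.regular_rieszMeasure _

theorem regular_add (μ ν : Measure ℝ) [μ.Regular] [ν.Regular] : (μ + ν).Regular := by
  have : IsFiniteMeasureOnCompacts (μ + ν) := ⟨fun K hK => by
    rw [Measure.add_apply]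
    exact ENNReal.add_lt_top.2 ⟨hK.measure_lt_top, hK.measure_lt_top⟩⟩
  have : IsLocallyFiniteMeasure (μ + ν) :=
    isLocallyFiniteMeasure_of_isFiniteMeasureOnCompacts
  infer_instance

theorem spectralMeasure_zero (H : E →L[ℂ] E) : spectralMeasure H 0 = 0 := by
  apply Measure.ext_of_integral_eq_on_compactlySupported
  intro f
  simp [integral_spectralMeasure]

theorem spectralMeasure_smul (H : E →L[ℂ] E) (c : ℂ) (ψ : E) :
    spectralMeasure H (c • ψ) = (‖c‖₊ ^ 2) • spectralMeasure H ψ := by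
  apply Measure.ext_of_integral_eq_on_compactlySupported
  intro f
  rw [integral_smul_nnreal_measure, integral_spectralMeasure, integral_spectralMeasure, map_smul,
    inner_smul_right, inner_smul_left, ← mul_assoc, Complex.mul_conj, Complex.re_ofReal_mul,
    Complex.normSq_eq_norm_sq]
  rfl

theorem spectralMeasure_add_add_sub (H : E →L[ℂ] E) (φ ψ : E) :
    spectralMeasure H (φ + ψ) + spectralMeasure H (φ - ψ) =
      (2 : NNReal) • (spectralMeasure H φ + spectralMeasure H ψ) := by
  have := regular_add (spectralMeasure H φ) (spectralMeasure H ψ)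
  have := regular_add (spectralMeasure H (φ + ψ)) (spectralMeasure H (φ - ψ))
  apply Measure.ext_of_integral_eq_on_compactlySupported
  intro f
  rw [integral_smul_nnreal_measure, integral_add_measure f.integrable f.integrable,
    integral_add_measure f.integrable f.integrable]
  simp only [integral_spectralMeasure, map_add, map_sub, inner_add_left, inner_add_right,
    inner_sub_left, inner_sub_right, Complex.add_re, Complex.sub_re, NNReal.smul_def]
  push_cast
  simp only [smul_eq_mul]
  ring

theorem spectralMeasure_le_of_le (H : E →L[ℂ] E) (φ ψ : E) (C : NNReal)
    (h : ∀ f : C_c(ℝ, ℝ), 0 ≤ f → spectralLinear H φ f ≤ C * spectralLinear H ψ f) :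
    spectralMeasure H φ ≤ C • spectralMeasure H ψ := by
  set ν : Measure ℝ := RealRMK.rieszMeasure
    (PositiveLinearMap.mk₀ ((C : ℝ) • spectralLinear H ψ - spectralLinear H φ)
      (fun f hf => by simpa using h f hf)) with hν
  have : ν.Regular := RealRMK.regular_rieszMeasure _
  have := regular_add (spectralMeasure H φ) ν
  have key : C • spectralMeasure H ψ = spectralMeasure H φ + ν := by
    apply Measure.ext_of_integral_eq_on_compactlySupported
    intro f
    have h1 : ∫ x, f x ∂ν = C * spectralLinear H ψ f - spectralLinear H φ f :=
      RealRMK.integral_rieszMeasure _ f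
    rw [integral_smul_nnreal_measure, integral_add_measure f.integrable f.integrable, h1,
      integral_spectralMeasure, integral_spectralMeasure]
    simp [NNReal.smul_def, spectralLinear]
  rw [key]
  exact Measure.le_add_right le_rfl

theorem spectralMeasure_map_le (H : E →L[ℂ] E) (hH : IsSelfAdjoint H) (ψ : E) :
    spectralMeasure H (H ψ) ≤ (‖H‖₊ ^ 2) • spectralMeasure H ψ := by
  apply spectralMeasure_le_of_le
  intro f hf
  have hsa : ∀ x y, ⟪H x, y⟫_ℂ = ⟪x, H y⟫_ℂ := fun x y => by
    rw [← ContinuousLinearMap.adjoint_inner_right, hH.adjoint_eq]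
  have e1 : H * (cfc (fun t => f t) H * H) = cfc (fun t : ℝ => t * (f t * t)) H := by
    have hc : Continuous fun t => f t := f.continuous
    rw [cfc_mul (fun t : ℝ => t) (fun t => f t * t) H continuous_id.continuousOn
      (hc.mul continuous_id).continuousOn,
      cfc_mul (fun t => f t) (fun t : ℝ => t) H hc.continuousOn continuous_id.continuousOn,
      cfc_id' ℝ H]
  have e2 : cfc (fun t : ℝ => ‖H‖ ^ 2 * f t) H = (‖H‖ ^ 2) • cfc (fun t => f t) H :=
    cfc_const_mul _ (fun t => f t) H f.continuous.continuousOn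
  have hle : cfc (fun t : ℝ => t * (f t * t)) H ≤ cfc (fun t : ℝ => ‖H‖ ^ 2 * f t) H := by
    have hc : Continuous fun t => f t := f.continuous
    apply cfc_mono
    · intro x hx
      have hx' : |x| ≤ ‖H‖ := by
        have h1 := spectrum.norm_le_norm_mul_of_mem hx
        have h0 : ‖(1 : E →L[ℂ] E)‖ ≤ 1 := ContinuousLinearMap.norm_id_le
        exact h1.trans (mul_le_of_le_one_right (norm_nonneg _) h0)
      have h2 : x ^ 2 ≤ ‖H‖ ^ 2 := sq_le_sq' (by linarith [abs_le.1 hx']) (abs_le.1 hx').2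
      have h3 : 0 ≤ f x := hf x
      nlinarith
    · exact (continuous_id.mul (hc.mul continuous_id)).continuousOn
    · exact (continuous_const.mul hc).continuousOn
  rw [ContinuousLinearMap.le_def] at hle
  have h4 := hle.re_inner_nonneg_right ψ
  rw [e2, ← e1] at h4
  simp only [sub_apply, inner_sub_right, smul_apply,
    mul_apply_eq_comp] at h4
  rw [← Complex.coe_smul, inner_smul_right, map_sub, ← hsa] at h4
  have h5 : (⟪H ψ, cfc (fun t => f t) H (H ψ)⟫_ℂ).re ≤
      ‖H‖ ^ 2 * (⟪ψ, cfc (fun t => f t) H ψ⟫_ℂ).re := by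
    have h6 := sub_nonneg.1 h4
    have h7 : RCLike.re (((‖H‖ ^ 2 : ℝ) : ℂ) * ⟪ψ, cfc (fun t => f t) H ψ⟫_ℂ) =
      ‖H‖ ^ 2 * (⟪ψ, cfc (fun t => f t) H ψ⟫_ℂ).re := Complex.re_ofReal_mul _ _
    rw [h7] at h6
    exact h6
  simpa [spectralLinear] using h5

/-- The absolutely continuous subspace of `H`: all vectors whose spectral measure is absolutely
continuous with respect to Lebesgue measure. -/
def acSubspace (H : E →L[ℂ] E) : Submodule ℂ E where
  carrier := {ψ | spectralMeasure H ψ ≪ volume}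
  zero_mem' := by
    simp only [Set.mem_ofPred_eq, spectralMeasure_zero]
    exact Measure.AbsolutelyContinuous.zero _
  add_mem' := by
    intro φ ψ hφ hψ
    refine Measure.AbsolutelyContinuous.trans (Measure.absolutelyContinuous_of_le
      (Measure.le_add_right le_rfl)) (?_ : spectralMeasure H (φ + ψ) +
        spectralMeasure H (φ - ψ) ≪ volume)
    rw [spectralMeasure_add_add_sub]
    exact (hφ.add_left hψ).smul_left _
  smul_mem' := by
    intro c ψ hψ
    simp only [Set.mem_ofPred_eq, spectralMeasure_smul]
    exact Measure.AbsolutelyContinuous.smul_left hψ _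

theorem map_mem_acSubspace (H : E →L[ℂ] E) (hH : IsSelfAdjoint H) :
    ∀ ψ ∈ acSubspace H, H ψ ∈ acSubspace H := fun ψ hψ =>
  (Measure.absolutelyContinuous_of_le (spectralMeasure_map_le H hH ψ)).trans
    (Measure.AbsolutelyContinuous.smul_left hψ _)

/-- The absolutely continuous spectrum of a bounded self-adjoint operator `H`: the spectrum of the
restriction of `H` to its absolutely continuous subspace. -/
def acSpectrum (H : E →L[ℂ] E) (hH : IsSelfAdjoint H) : Set ℝ :=
  {t : ℝ | (t : ℂ) ∈ spectrum ℂ (H.restrict (map_mem_acSubspace H hH))}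

end Spectral

/-! ### Schrödinger operators on graphs of bounded degree -/

section Schrodinger

variable {T : Type*}

/-- `(H u)(x) = ∑_{y ∼ x} u(y) + V(x) u(x)`. -/
def schrodingerFun (G : SimpleGraph T) [G.LocallyFinite] (V : T → ℝ) (u : T → ℂ) (x : T) : ℂ :=
  ∑ y ∈ G.neighborFinset x, u y + (V x : ℂ) * u x

theorem tsum_enorm_adj_le (G : SimpleGraph T) [G.LocallyFinite] (d : ℕ)
    (hd : ∀ x, G.degree x ≤ d) (u : T → ℂ) :
    ∑' x, ‖∑ y ∈ G.neighborFinset x, u y‖ₑ ^ 2 ≤ (d : ℝ≥0∞) ^ 2 * ∑' y, ‖u y‖ₑ ^ 2 := by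
  classical
  have h1 : ∀ x, ‖∑ y ∈ G.neighborFinset x, u y‖ₑ ^ 2 ≤
      d * ∑ y ∈ G.neighborFinset x, ‖u y‖ₑ ^ 2 := by
    intro x
    have hr : ‖∑ y ∈ G.neighborFinset x, u y‖₊ ^ 2 ≤
        d * ∑ y ∈ G.neighborFinset x, ‖u y‖₊ ^ 2 := by
      calc ‖∑ y ∈ G.neighborFinset x, u y‖₊ ^ 2
          ≤ (∑ y ∈ G.neighborFinset x, ‖u y‖₊) ^ 2 := by
            gcongr
            exact nnnorm_sum_le _ _
        _ ≤ (G.neighborFinset x).card * ∑ y ∈ G.neighborFinset x, ‖u y‖₊ ^ 2 :=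
            sq_sum_le_card_mul_sum_sq
        _ ≤ d * ∑ y ∈ G.neighborFinset x, ‖u y‖₊ ^ 2 := by
            gcongr
            exact hd x
    simp only [enorm_eq_nnnorm]
    exact_mod_cast hr
  have h2 : ∀ x, ∑ y ∈ G.neighborFinset x, ‖u y‖ₑ ^ 2 =
      ∑' y, if G.Adj x y then ‖u y‖ₑ ^ 2 else 0 := by
    intro x
    rw [tsum_eq_sum (s := G.neighborFinset x)]
    · exact Finset.sum_congr rfl fun y hy => by
        rw [if_pos ((G.mem_neighborFinset x y).1 hy)]
    · intro y hy
      rw [if_neg fun h => hy ((G.mem_neighborFinset x y).2 h)]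
  have h3 : ∀ y, (∑' x, if G.Adj x y then ‖u y‖ₑ ^ 2 else 0) ≤ d * ‖u y‖ₑ ^ 2 := by
    intro y
    rw [tsum_eq_sum (s := G.neighborFinset y)]
    · calc (∑ x ∈ G.neighborFinset y, if G.Adj x y then ‖u y‖ₑ ^ 2 else 0)
          ≤ ∑ x ∈ G.neighborFinset y, ‖u y‖ₑ ^ 2 :=
            Finset.sum_le_sum fun x _ => by split_ifs <;> simp
        _ = (G.neighborFinset y).card * ‖u y‖ₑ ^ 2 := by simp
        _ ≤ d * ‖u y‖ₑ ^ 2 := by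
            gcongr
            exact hd y
    · intro x hx
      rw [if_neg fun h => hx ((G.mem_neighborFinset y x).2 h.symm)]
  calc ∑' x, ‖∑ y ∈ G.neighborFinset x, u y‖ₑ ^ 2
      ≤ ∑' x, d * ∑ y ∈ G.neighborFinset x, ‖u y‖ₑ ^ 2 := ENNReal.tsum_le_tsum h1
    _ = d * ∑' x, ∑' y, (if G.Adj x y then ‖u y‖ₑ ^ 2 else 0) := by
        rw [ENNReal.tsum_mul_left]
        simp only [h2]
    _ = d * ∑' y, ∑' x, (if G.Adj x y then ‖u y‖ₑ ^ 2 else 0) := by rw [ENNReal.tsum_comm]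
    _ ≤ d * ∑' y, d * ‖u y‖ₑ ^ 2 := by
        gcongr with y
        exact h3 y
    _ = (d : ℝ≥0∞) ^ 2 * ∑' y, ‖u y‖ₑ ^ 2 := by
        rw [ENNReal.tsum_mul_left]
        ring

theorem memℓp_two_iff (u : T → ℂ) : Memℓp u 2 ↔ ∑' x, ‖u x‖ₑ ^ 2 ≠ ∞ := by
  rw [memℓp_gen_iff (by norm_num)]
  have : ∀ x, ‖u x‖ₑ ^ 2 = ((‖u x‖₊ ^ 2 : NNReal) : ℝ≥0∞) := fun x => by simp [enorm_eq_nnnorm]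
  simp only [this]
  rw [ENNReal.tsum_coe_ne_top_iff_summable, ← NNReal.summable_coe]
  simp

theorem enorm_sq_eq_tsum (u : lp (fun _ : T => ℂ) 2) : ‖u‖ₑ ^ 2 = ∑' x, ‖u x‖ₑ ^ 2 := by
  have h := lp.hasSum_norm (p := 2) (by norm_num) u
  simp only [ENNReal.toReal_ofNat, Real.rpow_ofNat] at h
  have h' : HasSum (fun x => (‖u x‖₊ ^ 2 : NNReal)) (‖u‖₊ ^ 2) := by
    rw [← NNReal.hasSum_coe]
    simpa using h
  have h2 := (ENNReal.hasSum_coe.2 h').tsum_eq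
  simpa [enorm_eq_nnnorm] using h2.symm

theorem tsum_enorm_schrodingerFun_le (G : SimpleGraph T) [G.LocallyFinite] (d : ℕ)
    (hd : ∀ x, G.degree x ≤ d) (V : T → ℝ) (C : NNReal) (hV : ∀ x, |V x| ≤ C) (u : T → ℂ) :
    ∑' x, ‖schrodingerFun G V u x‖ₑ ^ 2 ≤
      (2 * ((d : ℝ≥0∞) ^ 2 + C ^ 2)) * ∑' x, ‖u x‖ₑ ^ 2 := by
  have h1 : ∀ x, ‖schrodingerFun G V u x‖ₑ ^ 2 ≤
      2 * (‖∑ y ∈ G.neighborFinset x, u y‖ₑ ^ 2 + C ^ 2 * ‖u x‖ₑ ^ 2) := by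
    intro x
    have hVx : ‖(V x : ℂ)‖₊ ≤ C := by
      rw [← NNReal.coe_le_coe]
      simpa using hV x
    have hr : ‖schrodingerFun G V u x‖₊ ^ 2 ≤
        2 * (‖∑ y ∈ G.neighborFinset x, u y‖₊ ^ 2 + C ^ 2 * ‖u x‖₊ ^ 2) := by
      calc ‖schrodingerFun G V u x‖₊ ^ 2
          ≤ (‖∑ y ∈ G.neighborFinset x, u y‖₊ + C * ‖u x‖₊) ^ 2 := by
            gcongr
            refine (nnnorm_add_le _ _).trans ?_
            rw [nnnorm_mul]
            gcongr
        _ ≤ 2 * (‖∑ y ∈ G.neighborFinset x, u y‖₊ ^ 2 + (C * ‖u x‖₊) ^ 2) := add_sq_le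
        _ = _ := by rw [mul_pow]
    simp only [enorm_eq_nnnorm]
    exact_mod_cast hr
  calc ∑' x, ‖schrodingerFun G V u x‖ₑ ^ 2
      ≤ ∑' x, 2 * (‖∑ y ∈ G.neighborFinset x, u y‖ₑ ^ 2 + C ^ 2 * ‖u x‖ₑ ^ 2) :=
        ENNReal.tsum_le_tsum h1
    _ = 2 * (∑' x, ‖∑ y ∈ G.neighborFinset x, u y‖ₑ ^ 2 + C ^ 2 * ∑' x, ‖u x‖ₑ ^ 2) := by
        rw [ENNReal.tsum_mul_left, ENNReal.tsum_add, ENNReal.tsum_mul_left]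
    _ ≤ 2 * ((d : ℝ≥0∞) ^ 2 * ∑' x, ‖u x‖ₑ ^ 2 + C ^ 2 * ∑' x, ‖u x‖ₑ ^ 2) := by
        gcongr
        exact tsum_enorm_adj_le G d hd u
    _ = _ := by ring

theorem memℓp_schrodingerFun (G : SimpleGraph T) [G.LocallyFinite]
    (hG : ∃ d : ℕ, ∀ x, G.degree x ≤ d) (V : T → ℝ) (hV : ∃ C : ℝ, ∀ x, |V x| ≤ C)
    (u : lp (fun _ : T => ℂ) 2) : Memℓp (schrodingerFun G V u) 2 := by
  obtain ⟨d, hd⟩ := hG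
  obtain ⟨C, hC⟩ := hV
  rw [memℓp_two_iff]
  refine ne_top_of_le_ne_top ?_ (tsum_enorm_schrodingerFun_le G d hd V C.toNNReal
    (fun x => (hC x).trans (Real.le_coe_toNNReal C)) u)
  rw [← enorm_sq_eq_tsum]
  finiteness

/-- The Schrödinger operator `H = H₀ + V` on `ℓ²` of the vertex set of a graph of bounded degree,
with a bounded real potential `V`; here `H₀` is the adjacency operator of the graph. -/
def schrodinger (G : SimpleGraph T) [G.LocallyFinite] (hG : ∃ d : ℕ, ∀ x, G.degree x ≤ d)
    (V : T → ℝ) (hV : ∃ C : ℝ, ∀ x, |V x| ≤ C) :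
    lp (fun _ : T => ℂ) 2 →L[ℂ] lp (fun _ : T => ℂ) 2 :=
  LinearMap.mkContinuousOfExistsBound
    { toFun := fun u => ⟨schrodingerFun G V u, memℓp_schrodingerFun G hG V hV u⟩
      map_add' := fun u v => by
        ext x
        simp only [schrodingerFun, lp.coeFn_add, Pi.add_apply, Finset.sum_add_distrib]
        ring
      map_smul' := fun c u => by
        ext x
        simp only [schrodingerFun, lp.coeFn_smul, Pi.smul_apply, smul_eq_mul, RingHom.id_apply,
          ← Finset.mul_sum]
        ring }
    (by
      obtain ⟨d, hd⟩ := hG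
      obtain ⟨C, hC⟩ := hV
      have hK := fun u : lp (fun _ : T => ℂ) 2 => tsum_enorm_schrodingerFun_le G d hd V C.toNNReal
        (fun x => (hC x).trans (Real.le_coe_toNNReal C)) u
      set K : NNReal := 2 * ((d : NNReal) ^ 2 + C.toNNReal ^ 2) with hKdef
      refine ⟨NNReal.sqrt K, fun u => ?_⟩
      set w : lp (fun _ : T => ℂ) 2 :=
        ⟨schrodingerFun G V u, memℓp_schrodingerFun G ⟨d, hd⟩ V ⟨C, hC⟩ u⟩ with hw
      have h1 : ‖w‖ₑ ^ 2 ≤ K * ‖u‖ₑ ^ 2 := by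
        rw [enorm_sq_eq_tsum, enorm_sq_eq_tsum]
        have := hK u
        rw [hKdef]
        push_cast
        exact this
      have h2 : ‖w‖₊ ^ 2 ≤ K * ‖u‖₊ ^ 2 := by
        simp only [enorm_eq_nnnorm] at h1
        exact_mod_cast h1
      have h3 : ‖w‖₊ ≤ NNReal.sqrt K * ‖u‖₊ := by
        rw [← pow_le_pow_iff_left₀ zero_le zero_le two_ne_zero, mul_pow, NNReal.sq_sqrt]
        exact h2
      have h4 : ‖w‖ ≤ NNReal.sqrt K * ‖u‖ := by
        have := NNReal.coe_le_coe.2 h3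
        rwa [NNReal.coe_mul, coe_nnnorm, coe_nnnorm] at this
      exact h4)

theorem schrodinger_apply (G : SimpleGraph T) [G.LocallyFinite]
    (hG : ∃ d : ℕ, ∀ x, G.degree x ≤ d) (V : T → ℝ) (hV : ∃ C : ℝ, ∀ x, |V x| ≤ C)
    (u : lp (fun _ : T => ℂ) 2) (x : T) :
    schrodinger G hG V hV u x = ∑ y ∈ G.neighborFinset x, u y + (V x : ℂ) * u x :=
  rfl

theorem isSelfAdjoint_schrodinger (G : SimpleGraph T) [G.LocallyFinite]
    (hG : ∃ d : ℕ, ∀ x, G.degree x ≤ d) (V : T → ℝ) (hV : ∃ C : ℝ, ∀ x, |V x| ≤ C) :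
    IsSelfAdjoint (schrodinger G hG V hV) := by
  classical
  set H := schrodinger G hG V hV with hH
  have hentry : ∀ x y, (H (lp.single 2 y (1 : ℂ))) x =
      (if G.Adj x y then 1 else 0) + if x = y then (V x : ℂ) else 0 := by
    intro x y
    rw [hH, schrodinger_apply]
    congr 1
    · simp only [lp.single_apply, Pi.single_apply, Finset.sum_ite_eq', SimpleGraph.mem_neighborFinset]
    · by_cases h : x = y
      · subst h
        simp [lp.single_apply]
      · simp [lp.single_apply, h]
  have hcol : ∀ x (u : lp (fun _ : T => ℂ) 2),
      ⟪H (lp.single 2 x (1 : ℂ)), u⟫_ℂ = (H u) x := by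
    intro x u
    rw [lp.inner_eq_tsum]
    have h0 : ∀ y, ⟪(H (lp.single 2 x (1 : ℂ))) y, u y⟫_ℂ =
        (if G.Adj x y then u y else 0) + if y = x then (V y : ℂ) * u y else 0 := by
      intro y
      rw [hentry, RCLike.inner_apply]
      simp only [G.adj_comm y x]
      split_ifs <;> simp <;> ring
    simp only [h0]
    rw [tsum_eq_sum (s := insert x (G.neighborFinset x)), Finset.sum_add_distrib, hH,
      schrodinger_apply]
    · congr 1
      · rw [Finset.sum_insert (by simp), if_neg (G.irrefl), zero_add]
        exact Finset.sum_congr rfl fun y hy => if_pos ((G.mem_neighborFinset x y).1 hy)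
      · simp
    · intro y hy
      simp only [Finset.mem_insert, SimpleGraph.mem_neighborFinset, not_or] at hy
      simp [hy.1, hy.2]
  rw [ContinuousLinearMap.isSelfAdjoint_iff']
  ext u x
  have h1 : ⟪lp.single 2 x (1 : ℂ), ContinuousLinearMap.adjoint H u⟫_ℂ =
      (ContinuousLinearMap.adjoint H u) x := by
    rw [lp.inner_single_left]
    simp
  rw [← h1, ContinuousLinearMap.adjoint_inner_right, hcol]

end Schrodinger

/-! ### The rooted branch and the Bethe lattice of degree three -/

/-- The neighbours of a vertex in the rooted binary tree. A vertex is a finite word in `{0, 1}`,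
most recent letter first; the root is the empty word, and the children of `w` are `0w` and `1w`. -/
def branchNeighbors : List (Fin 2) → Finset (List (Fin 2))
  | [] => {[0], [1]}
  | b :: w => {0 :: b :: w, 1 :: b :: w, w}

/-- The rooted binary tree: every vertex is joined to its two children. Its root has degree two and
all other vertices have degree three. -/
def branch : SimpleGraph (List (Fin 2)) where
  Adj u v := (∃ b, v = b :: u) ∨ (∃ b, u = b :: v)
  symm := ⟨fun _ _ h => h.symm⟩
  loopless := ⟨fun u h => by
    rcases h with ⟨b, h⟩ | ⟨b, h⟩ <;> simpa using congrArg List.length h⟩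

theorem mem_branchNeighbors (u v : List (Fin 2)) : v ∈ branchNeighbors u ↔ branch.Adj u v := by
  cases u with
  | nil => simp [branchNeighbors, branch, Fin.exists_fin_two]
  | cons a u =>
    have h : (∃ b, a :: u = b :: v) ↔ v = u := by simp [eq_comm]
    simp only [branch, h]
    simp [branchNeighbors, Fin.exists_fin_two, or_assoc]

instance : branch.LocallyFinite := fun u =>
  Fintype.ofFinset (branchNeighbors u) (mem_branchNeighbors u)

theorem branch_neighborFinset (u : List (Fin 2)) :
    branch.neighborFinset u = branchNeighbors u := by
  ext v
  rw [SimpleGraph.mem_neighborFinset, mem_branchNeighbors]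

theorem branch_degree_le : ∃ d : ℕ, ∀ u, branch.degree u ≤ d := by
  refine ⟨3, fun u => ?_⟩
  rw [SimpleGraph.degree, branch_neighborFinset]
  cases u with
  | nil => decide
  | cons a u => exact Finset.card_le_three

/-- The Bethe lattice of degree three (the infinite tree in which every vertex has three
neighbours), written as two rooted binary trees whose roots are joined by an edge. The vertices
`(0, w)` form the branch that is left when this edge is deleted at the vertex `O = (0, [])` together
with the part of the tree stemming from it. -/
def bethe : SimpleGraph (Fin 2 × List (Fin 2)) where
  Adj p q := (p.1 = q.1 ∧ branch.Adj p.2 q.2) ∨ (p.1 ≠ q.1 ∧ p.2 = [] ∧ q.2 = [])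
  symm := ⟨fun _ _ h => h.imp (fun h => ⟨h.1.symm, h.2.symm⟩) fun h => ⟨h.1.symm, h.2.2, h.2.1⟩⟩
  loopless := ⟨fun _ h => h.elim (fun h => branch.loopless.irrefl _ h.2) fun h => h.1 rfl⟩

/-- The neighbours of a vertex in the Bethe lattice. -/
def betheNeighbors (p : Fin 2 × List (Fin 2)) : Finset (Fin 2 × List (Fin 2)) :=
  (branchNeighbors p.2).image (fun w => (p.1, w)) ∪ (if p.2 = [] then {(p.1 + 1, [])} else ∅)

theorem mem_betheNeighbors (p q : Fin 2 × List (Fin 2)) :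
    q ∈ betheNeighbors p ↔ bethe.Adj p q := by
  obtain ⟨i, u⟩ := p
  obtain ⟨j, v⟩ := q
  have hij : ∀ i j : Fin 2, j = i + 1 ↔ i ≠ j := by decide
  by_cases hu : u = []
  · simp [betheNeighbors, bethe, hu, ← mem_branchNeighbors, hij]
    tauto
  · simp [betheNeighbors, bethe, hu, ← mem_branchNeighbors]
    tauto

instance : bethe.LocallyFinite := fun p =>
  Fintype.ofFinset (betheNeighbors p) (mem_betheNeighbors p)

theorem bethe_neighborFinset (p : Fin 2 × List (Fin 2)) :
    bethe.neighborFinset p = betheNeighbors p := by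
  ext q
  rw [SimpleGraph.mem_neighborFinset, mem_betheNeighbors]

theorem bethe_degree (p : Fin 2 × List (Fin 2)) : bethe.degree p = 3 := by
  obtain ⟨i, u⟩ := p
  rw [SimpleGraph.degree, bethe_neighborFinset, betheNeighbors]
  cases u with
  | nil => revert i; decide
  | cons a u =>
    simp only [reduceCtorEq, if_false, Finset.union_empty]
    rw [Finset.card_image_of_injective _ (Prod.mk_right_injective i)]
    have h : u ≠ 0 :: a :: u ∧ u ≠ 1 :: a :: u := by
      constructor <;> intro h <;> have := congrArg List.length h <;> simp at this <;> omega
    rw [branchNeighbors, Finset.card_insert_of_notMem (by simp [h.1.symm]),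
      Finset.card_insert_of_notMem (by simp [h.2.symm]), Finset.card_singleton]

theorem bethe_degree_le : ∃ d : ℕ, ∀ p, bethe.degree p ≤ d :=
  ⟨3, fun p => (bethe_degree p).le⟩

/-- `H = H₀ + V` on `ℓ²` of the rooted branch. -/
def branchOperator (V : List (Fin 2) → ℝ) (hV : ∃ C : ℝ, ∀ x, |V x| ≤ C) :
    lp (fun _ : List (Fin 2) => ℂ) 2 →L[ℂ] lp (fun _ : List (Fin 2) => ℂ) 2 :=
  schrodinger branch branch_degree_le V hV

theorem isSelfAdjoint_branchOperator (V : List (Fin 2) → ℝ) (hV : ∃ C : ℝ, ∀ x, |V x| ≤ C) :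
    IsSelfAdjoint (branchOperator V hV) :=
  isSelfAdjoint_schrodinger branch branch_degree_le V hV

/-- `H = H₀ + W` on `ℓ²` of the Bethe lattice. -/
def betheOperator (W : Fin 2 × List (Fin 2) → ℝ) (hW : ∃ C : ℝ, ∀ x, |W x| ≤ C) :
    lp (fun _ : Fin 2 × List (Fin 2) => ℂ) 2 →L[ℂ] lp (fun _ : Fin 2 × List (Fin 2) => ℂ) 2 :=
  schrodinger bethe bethe_degree_le W hW

theorem isSelfAdjoint_betheOperator (W : Fin 2 × List (Fin 2) → ℝ)
    (hW : ∃ C : ℝ, ∀ x, |W x| ≤ C) : IsSelfAdjoint (betheOperator W hW) :=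
  isSelfAdjoint_schrodinger bethe bethe_degree_le W hW

/-! ### The relative entropy of the spectral density at the root -/

/-- The density `(4π)⁻¹ √(8 - x²)` of the spectral measure of the free operator `H₀` of the branch
at the root; it vanishes outside `[-2√2, 2√2]`. -/
def freeDensity (x : ℝ) : ℝ := Real.sqrt (8 - x ^ 2) / (4 * Real.pi)

/-- The probability measure `dw = (4π)⁻¹ √(8 - x²) dx` on `[-2√2, 2√2]`. -/
def freeMeasure : Measure ℝ := volume.withDensity fun x => ENNReal.ofReal (freeDensity x)

/-- The spectral measure of `H` on the branch at the root. -/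
def rootMeasure (V : List (Fin 2) → ℝ) (hV : ∃ C : ℝ, ∀ x, |V x| ≤ C) : Measure ℝ :=
  spectralMeasure (branchOperator V hV) (lp.single 2 [] (1 : ℂ))

/-- The density (with respect to Lebesgue measure) of the absolutely continuous part of the spectral
measure at the root, divided by the free density. -/
def relDensity (V : List (Fin 2) → ℝ) (hV : ∃ C : ℝ, ∀ x, |V x| ≤ C) (x : ℝ) : ℝ≥0∞ :=
  (rootMeasure V hV).rnDeriv volume x / ENNReal.ofReal (freeDensity x)

/-- The integral of an extended real function, as the integral of its positive part minus the
integral of its negative part. -/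
def erealIntegral (μ : Measure ℝ) (f : ℝ → EReal) : EReal :=
  ((∫⁻ x, (f x).toENNReal ∂μ : ℝ≥0∞) : EReal) - ((∫⁻ x, (-f x).toENNReal ∂μ : ℝ≥0∞) : EReal)

/-- The relative entropy `s_O = ∫ log ρ dw`, with values in `[-∞, ∞]` and `log 0 = -∞`. -/
def entropy (V : List (Fin 2) → ℝ) (hV : ∃ C : ℝ, ∀ x, |V x| ≤ C) : EReal :=
  erealIntegral freeMeasure fun x => ENNReal.log (relDensity V hV x)

/-! ### Paths from the root to infinity -/

/-- The path without self-intersections that starts at the root and turns to the child `ω n` at its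
`n`-th step. Its vertices are `x₁ = path ω 0 = O`, `x₂ = path ω 1`, … -/
def path (ω : ℕ → Fin 2) : ℕ → List (Fin 2)
  | 0 => []
  | n + 1 => ω n :: path ω n

/-- Every path from the root to infinity without self-intersections is of the form `path ω`. -/
theorem exists_eq_path (x : ℕ → List (Fin 2)) (h0 : x 0 = [])
    (hadj : ∀ n, branch.Adj (x n) (x (n + 1))) (hinj : Function.Injective x) :
    ∃ ω, x = path ω := by
  have hstep : ∀ n, ∃ b, x (n + 1) = b :: x n := by
    intro n
    induction n with
    | zero =>
      rcases hadj 0 with h | ⟨b, h⟩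
      · exact h
      · simp [h0] at h
    | succ n ih =>
      rcases hadj (n + 1) with h | ⟨b, h⟩
      · exact h
      · obtain ⟨c, hc⟩ := ih
        rw [hc] at h
        have := hinj (List.cons.inj h).2
        omega
  choose ω hω using hstep
  refine ⟨ω, funext fun n => ?_⟩
  induction n with
  | zero => exact h0
  | succ n ih => rw [hω, ih, path]

/-- The law of independent fair coin tosses. -/
def coin : Measure (ℕ → Fin 2) :=
  Measure.infinitePi fun _ : ℕ => (PMF.uniformOfFintype (Fin 2)).toMeasure

/-- `∑ V²(xₙ)` over all vertices `xₙ` of the path `path ω`. -/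
def pathSum (V : List (Fin 2) → ℝ) (ω : ℕ → Fin 2) : ℝ≥0∞ :=
  ∑' n, ENNReal.ofReal (V (path ω n) ^ 2)

/-- `φ(t) = ∑ V²(xₙ)` over all vertices of the path given by the binary digits of `t`. -/
def phi (V : List (Fin 2) → ℝ) (t : ℝ) : ℝ≥0∞ := pathSum V (Real.digits t 2)

/-- `exp(-s/4)`, with value `0` at `s = ∞`. -/
def expNegQuarter (s : ℝ≥0∞) : ℝ≥0∞ := EReal.exp (-((s / 4 : ℝ≥0∞) : EReal))

end

end BetheLattice

/-! Write `m` for the Green function of the branch at the root, the Borel transform of the spectral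
measure. Removing the root leaves two branches of the same kind, so `m = 1/(V(O) - z - m₀ - m₁)`
(`rootGreen_mul`), and at height `ε` one gets `Im m = |m|² (ε + Im m₀ + Im m₁)`. The geometric mean
`G(f) = exp ∫ log f dw` of both sides is taken along the line `Im z = ε`, with respect to the
semicircle law `dw`.

Two inequalities make this a linear recursion. First, `G` is superadditive by Jensen
(`geomMean_add_le`). Secondly, `∫ log |m| dw` is bounded below by the first two moments of the
spectral measure (`integral_log_norm_borelTransform_ge`). For a finite sum of atoms, `m` is rational
with interlacing zeros `γ` and poles `β`, and `∫ log |m| dw` is the sum of the semicircle potential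
`U` over the zeros minus its sum over the poles. Now `U(x) = U(0) + x²/8` minus a defect that
vanishes at `0` and increases away from `0`. By interlacing the defect contributes with the
favourable sign; the quadratic part depends on `∑ γ² - ∑ β²` alone, hence on two moments. At the
root the moments are `V(O)` and `2 + V(O)²`, and the limit of `U(0)` as `ε → 0` is such that `G(Im
m) ≥ c_ε exp(-V(O)²/4) (G(Im m₀) + G(Im m₁))/2` with `c_ε → 1`. The coefficients `exp(-V²/4)` and
`1/2` are those of the random path.

For a potential of finite depth `N` the iteration ends at free branches. Dividing by the free value
and letting `ε → 0` gives `c G(f) ≤ ∫ f dσ` for every continuous `f` bounded between positive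
constants, where `c` is the mean over paths of length `N`. This property, `DominatesGeomMean`, is
the variational form of `exp s_O ≥ c`; it survives weak limits, which removes the truncation, and
taking for `f` the clamped inverse of the relative density yields the entropy bound
(`DominatesGeomMean.le_exp_erealIntegral`).

A finite entropy makes the density positive almost everywhere on the band, and then approximate
eigenvectors inside the absolutely continuous subspace put the band into the absolutely continuous
spectrum (`Icc_subset_acSpectrum`). On the full tree the vertex `O` has a third neighbour; its
branch only adds to `Im (-1/m)`, and the larger second moment costs a factor `exp(-1/2)`. -/

namespace BetheLattice

open Filter Topology

/-! ### Spectral measures: support, functional calculus and resolvent -/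

section SpectralTheory

variable {E : Type*} [NormedAddCommGroup E] [InnerProductSpace ℂ E] [CompleteSpace E]

theorem abs_le_norm_of_mem_spectrum (H : E →L[ℂ] E) {x : ℝ} (hx : x ∈ spectrum ℝ H) :
    |x| ≤ ‖H‖ := by
  have h1 := spectrum.norm_le_norm_mul_of_mem hx
  have h0 : ‖(1 : E →L[ℂ] E)‖ ≤ 1 := ContinuousLinearMap.norm_id_le
  exact h1.trans (mul_le_of_le_one_right (norm_nonneg _) h0)

theorem integral_spectralMeasure_of_hasCompactSupport (H : E →L[ℂ] E) (ψ : E) {f : ℝ → ℝ}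
    (hf : Continuous f) (hs : HasCompactSupport f) :
    ∫ x, f x ∂(spectralMeasure H ψ) = (⟪ψ, cfc f H ψ⟫_ℂ).re :=
  integral_spectralMeasure H ψ ⟨⟨f, hf⟩, hs⟩

/-- The spectral measure is carried by the interval `[-‖H‖, ‖H‖]`. -/
theorem spectralMeasure_compl_Icc (H : E →L[ℂ] E) (ψ : E) :
    spectralMeasure H ψ (Set.Icc (-‖H‖) ‖H‖)ᶜ = 0 := by
  have key : ∀ n : ℕ, spectralMeasure H ψ {x | ‖H‖ < |x| ∧ |x| < n} = 0 := by
    intro n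
    -- A tent that is positive exactly where `‖H‖ < |x| < n`; it vanishes on the spectrum, so `g(H)
    -- = 0`.
    set g : ℝ → ℝ := fun x => max 0 (min (|x| - ‖H‖) (n - |x|)) with hg
    have hgc : Continuous g := by fun_prop
    have hsupp : HasCompactSupport g := by
      refine HasCompactSupport.of_support_subset_isCompact
          (isCompact_Icc (a := -(n : ℝ)) (b := n)) ?_
      intro x hx
      by_contra h
      apply hx
      have : (n : ℝ) ≤ |x| := by
        by_contra h'
        exact h (abs_le.1 (not_le.1 h').le)
      simp only [hg]
      exact max_eq_left ((min_le_right _ _).trans (by linarith))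
    have h0 : ∫ x, g x ∂(spectralMeasure H ψ) = 0 := by
      rw [integral_spectralMeasure_of_hasCompactSupport H ψ hgc hsupp]
      have : cfc g H = cfc (fun _ => (0 : ℝ)) H := by
        apply cfc_congr
        intro x hx
        have := abs_le_norm_of_mem_spectrum H hx
        simp only [hg]
        exact max_eq_left ((min_le_left _ _).trans (by linarith))
      rw [this]
      have h0 : cfc (fun _ => (0 : ℝ)) H = 0 := cfc_const_zero ℝ H
      simp [h0]
    have hint : Integrable g (spectralMeasure H ψ) :=
      hgc.integrable_of_hasCompactSupport hsupp
    have hae := (integral_eq_zero_iff_of_nonneg (fun x => le_max_left _ _) hint).1 h0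
    refine measure_mono_null ?_ (ae_iff.1 hae)
    intro x hx
    have h1 : 0 < min (|x| - ‖H‖) (n - |x|) := lt_min (by linarith [hx.1]) (by linarith [hx.2])
    simp only [Set.mem_ofPred_eq, Pi.zero_apply]
    exact ne_of_gt (lt_max_of_lt_right h1)
  refine measure_mono_null ?_ (measure_iUnion_null key)
  intro x hx
  obtain ⟨n, hn⟩ := exists_nat_gt |x|
  refine Set.mem_iUnion.2 ⟨n, ?_, hn⟩
  by_contra h
  exact hx (abs_le.1 (not_lt.1 h))

instance (H : E →L[ℂ] E) (ψ : E) : IsFiniteMeasure (spectralMeasure H ψ) := by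
  constructor
  rw [← measure_add_measure_compl (measurableSet_Icc (a := -‖H‖) (b := ‖H‖)),
    spectralMeasure_compl_Icc, add_zero]
  exact isCompact_Icc.measure_lt_top

theorem ae_abs_le_norm (H : E →L[ℂ] E) (ψ : E) : ∀ᵐ x ∂(spectralMeasure H ψ), |x| ≤ ‖H‖ := by
  rw [ae_iff]
  refine measure_mono_null (fun x hx h => hx (abs_le.2 h)) (spectralMeasure_compl_Icc H ψ)

theorem integrable_spectralMeasure (H : E →L[ℂ] E) (ψ : E) {F : Type*} [NormedAddCommGroup F]
    [SecondCountableTopology F] {f : ℝ → F} (hf : Continuous f) :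
    Integrable f (spectralMeasure H ψ) := by
  obtain ⟨C, hC⟩ := (isCompact_Icc (a := -‖H‖) (b := ‖H‖)).exists_bound_of_continuousOn
    hf.continuousOn
  refine Integrable.of_bound hf.aestronglyMeasurable C ?_
  filter_upwards [ae_abs_le_norm H ψ] with x hx
  exact hC x (abs_le.1 hx)

/-- The spectral theorem for continuous functions without support condition. -/
theorem integral_spectralMeasure_of_continuous (H : E →L[ℂ] E) (ψ : E) {f : ℝ → ℝ}
    (hf : Continuous f) :
    ∫ x, f x ∂(spectralMeasure H ψ) = (⟪ψ, cfc f H ψ⟫_ℂ).re := by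
  -- A cutoff equal to `1` on `[-‖H‖, ‖H‖]` makes `f` compactly supported without changing `f(H)` or
  -- the integral.
  set χ : ℝ → ℝ := fun x => max 0 (min 1 (‖H‖ + 2 - |x|)) with hχ
  have hχ1 : ∀ x, |x| ≤ ‖H‖ → χ x = 1 := by
    intro x hx
    simp only [hχ]
    rw [min_eq_left (by linarith), max_eq_right zero_le_one]
  have hc : Continuous fun x => χ x * f x := by fun_prop
  have hs : HasCompactSupport fun x => χ x * f x := by
    refine HasCompactSupport.of_support_subset_isCompact
      (isCompact_Icc (a := -(‖H‖ + 2)) (b := ‖H‖ + 2)) ?_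
    intro x hx
    by_contra h
    apply hx
    have h' : ‖H‖ + 2 ≤ |x| := by
      by_contra h'
      exact h (abs_le.1 (not_le.1 h').le)
    have : χ x = 0 := max_eq_left ((min_le_right _ _).trans (by linarith))
    simp [this]
  have h1 : cfc f H = cfc (fun x => χ x * f x) H := by
    apply cfc_congr
    intro x hx
    simp [hχ1 x (abs_le_norm_of_mem_spectrum H hx)]
  rw [h1, ← integral_spectralMeasure_of_hasCompactSupport H ψ hc hs]
  apply integral_congr_ae
  filter_upwards [ae_abs_le_norm H ψ] with x hx
  simp [hχ1 x hx]

theorem inner_cfc_im (H : E →L[ℂ] E) (ψ : E) (f : ℝ → ℝ) : (⟪ψ, cfc f H ψ⟫_ℂ).im = 0 := by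
  have h : IsSelfAdjoint (cfc f H) := cfc_predicate f H
  have h1 : ⟪cfc f H ψ, ψ⟫_ℂ = ⟪ψ, cfc f H ψ⟫_ℂ := by
    rw [← ContinuousLinearMap.adjoint_inner_right, h.adjoint_eq]
  rw [← Complex.conj_eq_iff_im, inner_conj_symm, h1]

theorem inner_cfc_eq_integral (H : E →L[ℂ] E) (ψ : E) {f : ℝ → ℝ} (hf : Continuous f) :
    ⟪ψ, cfc f H ψ⟫_ℂ = ((∫ x, f x ∂(spectralMeasure H ψ) : ℝ) : ℂ) := by
  rw [integral_spectralMeasure_of_continuous H ψ hf]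
  apply Complex.ext
  · simp
  · simp [inner_cfc_im]

theorem inner_cfc_cfc (H : E →L[ℂ] E) (ψ : E) {f g : ℝ → ℝ} (hf : Continuous f)
    (hg : Continuous g) :
    ⟪cfc f H ψ, cfc g H ψ⟫_ℂ = ((∫ x, f x * g x ∂(spectralMeasure H ψ) : ℝ) : ℂ) := by
  rw [← inner_cfc_eq_integral H ψ (f := fun x => f x * g x) (hf.mul hg), cfc_mul f g H
      hf.continuousOn hg.continuousOn]
  have h : IsSelfAdjoint (cfc f H) := cfc_predicate f H
  conv_lhs => rw [← h.adjoint_eq, ContinuousLinearMap.adjoint_inner_left]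
  rfl

theorem norm_cfc_sq (H : E →L[ℂ] E) (ψ : E) {f : ℝ → ℝ} (hf : Continuous f) :
    ‖cfc f H ψ‖ ^ 2 = ∫ x, f x ^ 2 ∂(spectralMeasure H ψ) := by
  have h := inner_cfc_cfc H ψ hf hf
  rw [inner_self_eq_norm_sq_to_K] at h
  simp only [← pow_two] at h
  rw [← Complex.ofReal_inj, ← h]
  simp

theorem spectralMeasure_univ (H : E →L[ℂ] E) (hH : IsSelfAdjoint H) (ψ : E) :
    (spectralMeasure H ψ).real Set.univ = ‖ψ‖ ^ 2 := by
  have h := norm_cfc_sq H ψ (continuous_const (y := (1 : ℝ)))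
  have h1 : cfc (fun _ : ℝ => (1 : ℝ)) H = 1 := cfc_const_one ℝ H
  rw [h1] at h
  simpa using h.symm

theorem integral_id_spectralMeasure (H : E →L[ℂ] E) (hH : IsSelfAdjoint H) (ψ : E) :
    ∫ x, x ∂(spectralMeasure H ψ) = (⟪ψ, H ψ⟫_ℂ).re := by
  rw [integral_spectralMeasure_of_continuous H ψ (f := fun x => x) continuous_id, cfc_id' ℝ H]

theorem integral_pow_spectralMeasure (H : E →L[ℂ] E) (hH : IsSelfAdjoint H) (ψ : E) (n : ℕ) :
    ∫ x, x ^ n ∂(spectralMeasure H ψ) = (⟪ψ, (H ^ n) ψ⟫_ℂ).re := by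
  rw [integral_spectralMeasure_of_continuous H ψ (f := fun x => x ^ n) (continuous_id.pow n),
      cfc_pow_id H n]

/-- The Borel transform `∫ dμ(x) / (x - z)` of a measure on the line. -/
noncomputable def borelTransform (μ : Measure ℝ) (z : ℂ) : ℂ := ∫ x, ((x : ℂ) - z)⁻¹ ∂μ

theorem ofReal_sub_ne_zero {z : ℂ} (hz : 0 < z.im) (x : ℝ) : (x : ℂ) - z ≠ 0 := by
  intro h
  have := congrArg Complex.im h
  simp at this
  linarith

theorem continuous_inv_ofReal_sub {z : ℂ} (hz : 0 < z.im) :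
    Continuous fun x : ℝ => ((x : ℂ) - z)⁻¹ :=
  Continuous.inv₀ (by fun_prop) (ofReal_sub_ne_zero hz)

/-- Symmetry forces an eigenvalue to equal its conjugate. This gives uniqueness for the resolvent
equation. -/
theorem IsSelfAdjoint.eq_zero_of_map_eq_smul {H : E →L[ℂ] E} (hH : IsSelfAdjoint H) {z : ℂ}
    (hz : 0 < z.im) {u : E} (hu : H u = z • u) : u = 0 := by
  have h1 : ⟪H u, u⟫_ℂ = ⟪u, H u⟫_ℂ := by
    rw [← ContinuousLinearMap.adjoint_inner_right, hH.adjoint_eq]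
  rw [hu, inner_smul_left, inner_smul_right] at h1
  by_contra h0
  have h2 := mul_right_cancel₀ (inner_self_ne_zero.2 h0) h1
  have := congrArg Complex.im h2
  simp at this
  linarith

/-- The resolvent equation can be solved, and the diagonal matrix element of the resolvent is the
Borel transform of the spectral measure. -/
theorem exists_resolvent (H : E →L[ℂ] E) (hH : IsSelfAdjoint H) (ψ : E) {z : ℂ}
    (hz : 0 < z.im) :
    ∃ u : E, H u - z • u = ψ ∧ ⟪ψ, u⟫_ℂ = borelTransform (spectralMeasure H ψ) z := by
  -- The functional calculus is used for real functions only, so `(x - z)⁻¹ = q(x) + i (Im z) r(x)`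
  -- is split with `r = |x - z|⁻²` and `q = (x - Re z) r`.
  set r : ℝ → ℝ := fun x => ((x - z.re) ^ 2 + z.im ^ 2)⁻¹ with hr
  have hpos : ∀ x : ℝ, 0 < (x - z.re) ^ 2 + z.im ^ 2 := fun x => by positivity
  have hrc : Continuous r := Continuous.inv₀ (by fun_prop) fun x => (hpos x).ne'
  set q : ℝ → ℝ := fun x => (x - z.re) * r x with hq
  have hqc : Continuous q := by fun_prop
  have hqs : Continuous fun x => z.re • q x := by fun_prop
  have hrs : ∀ c : ℝ, Continuous fun x => c • r x := fun c => by fun_prop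
  have h1 : H * cfc q H = cfc (fun x => x * q x) H := by
    rw [cfc_mul (fun x : ℝ => x) q H continuous_id.continuousOn hqc.continuousOn, cfc_id' ℝ H]
  have h2 : H * cfc r H = cfc (fun x => x * r x) H := by
    rw [cfc_mul (fun x : ℝ => x) r H continuous_id.continuousOn hrc.continuousOn, cfc_id' ℝ H]
  have h3 : cfc (fun x => x * q x) H = 1 + z.re • cfc q H - (z.im ^ 2) • cfc r H := by
    rw [← cfc_smul z.re q H hqc.continuousOn, ← cfc_smul (z.im ^ 2) r H hrc.continuousOn,
      ← cfc_const_one ℝ H,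
      ← cfc_add H (fun _ => 1) (fun x => z.re • q x) continuousOn_const
        hqs.continuousOn,
      ← cfc_sub (fun x => 1 + z.re • q x) (fun x => z.im ^ 2 • r x) H
        (continuousOn_const.add hqs.continuousOn)
        (hrs _).continuousOn]
    apply cfc_congr
    intro x _
    have := (hpos x).ne'
    simp only [hq, hr, smul_eq_mul]
    field_simp
    ring
  have h4 : cfc (fun x => x * r x) H = cfc q H + z.re • cfc r H := by
    rw [← cfc_smul z.re r H hrc.continuousOn,
      ← cfc_add H q (fun x => z.re • r x) hqc.continuousOn (hrs _).continuousOn]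
    apply cfc_congr
    intro x _
    simp only [hq, smul_eq_mul]
    ring
  refine ⟨cfc q H ψ + (Complex.I * z.im) • cfc r H ψ, ?_, ?_⟩
  · have e1 : H (cfc q H ψ) = ψ + (z.re : ℂ) • cfc q H ψ - ((z.im : ℂ) ^ 2) • cfc r H ψ := by
      have := congrArg (fun A : E →L[ℂ] E => A ψ) (h1.trans h3)
      simp only [mul_apply_eq_comp, sub_apply, add_apply,
        one_apply_eq_self, smul_apply] at this
      rw [this, ← Complex.coe_smul, ← Complex.coe_smul]
      push_cast
      rfl
    have e2 : H (cfc r H ψ) = cfc q H ψ + (z.re : ℂ) • cfc r H ψ := by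
      have := congrArg (fun A : E →L[ℂ] E => A ψ) (h2.trans h4)
      simp only [mul_apply_eq_comp, add_apply, smul_apply] at this
      rw [this, ← Complex.coe_smul]
    rw [map_add, map_smul, e1, e2]
    have hI := Complex.I_sq
    conv_lhs => rw [← Complex.re_add_im z]
    simp only [Complex.add_re, Complex.ofReal_re, Complex.mul_re, Complex.I_re, mul_zero,
      Complex.ofReal_im, Complex.I_im, mul_one, sub_self, add_zero, Complex.add_im,
      Complex.mul_im, zero_add]
    match_scalars
    · ring
    · ring
    · linear_combination (-(z.im : ℂ) ^ 2) * hI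
  · rw [inner_add_right, inner_smul_right, inner_cfc_eq_integral H ψ hqc,
      inner_cfc_eq_integral H ψ hrc, borelTransform]
    have hi1 : Integrable (fun x => (q x : ℂ)) (spectralMeasure H ψ) :=
      integrable_spectralMeasure H ψ (Complex.continuous_ofReal.comp hqc)
    have hi2 : Integrable (fun x => (r x : ℂ)) (spectralMeasure H ψ) :=
      integrable_spectralMeasure H ψ (Complex.continuous_ofReal.comp hrc)
    rw [← integral_complex_ofReal, ← integral_complex_ofReal, ← integral_const_mul,
      ← integral_add hi1 (hi2.const_mul _)]
    apply integral_congr_ae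
    filter_upwards with x
    have h5 := ofReal_sub_ne_zero hz x
    have h6 : ((x : ℂ) - z) * (((x - z.re : ℝ) : ℂ) + Complex.I * z.im) =
        (((x - z.re) ^ 2 + z.im ^ 2 : ℝ) : ℂ) := by
      conv_lhs => rw [← Complex.re_add_im z]
      simp only [Complex.add_re, Complex.ofReal_re, Complex.mul_re, Complex.I_re, mul_zero,
        Complex.ofReal_im, Complex.I_im, mul_one, sub_self, add_zero, Complex.add_im,
        Complex.mul_im, zero_add]
      push_cast
      linear_combination (-(z.im : ℂ) ^ 2) * Complex.I_sq
    have h7 : (((x - z.re) ^ 2 + z.im ^ 2 : ℝ) : ℂ) ≠ 0 := by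
      exact_mod_cast (hpos x).ne'
    simp only [hq, hr]
    refine eq_inv_of_mul_eq_one_right ?_
    push_cast at h6 h7 ⊢
    rw [← add_mul, ← mul_assoc, h6, mul_inv_cancel₀ h7]

theorem borelTransform_of_resolvent {H : E →L[ℂ] E} (hH : IsSelfAdjoint H) {ψ u : E} {z : ℂ}
    (hz : 0 < z.im) (hu : H u - z • u = ψ) :
    ⟪ψ, u⟫_ℂ = borelTransform (spectralMeasure H ψ) z := by
  obtain ⟨v, hv, h⟩ := exists_resolvent H hH ψ hz
  have : u - v = 0 := by
    apply IsSelfAdjoint.eq_zero_of_map_eq_smul hH hz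
    rw [map_sub, smul_sub]
    have := hu.trans hv.symm
    rw [sub_eq_sub_iff_sub_eq_sub] at this
    exact this
  rw [sub_eq_zero.1 this, h]

end SpectralTheory

/-! ### Cyclic vectors, absolutely continuous spectrum and strong limits -/

section SpectralTheory

variable {E : Type*} [NormedAddCommGroup E] [InnerProductSpace ℂ E] [CompleteSpace E]

/-- The norm of the operator square of the defect `H - t` through the spectral measure. -/
theorem norm_sub_smul_sq (H : E →L[ℂ] E) (hH : IsSelfAdjoint H) (φ : E) (t : ℝ) :
    ‖H φ - (t : ℂ) • φ‖ ^ 2 = ∫ x, (x - t) ^ 2 ∂(spectralMeasure H φ) := by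
  have hc : Continuous fun x : ℝ => x - t := by fun_prop
  rw [← norm_cfc_sq H φ (f := fun x => x - t) hc,
    cfc_sub (fun x : ℝ => x) (fun _ => t) H continuousOn_id continuousOn_const, cfc_id' ℝ H,
    cfc_const t H]
  simp [Algebra.algebraMap_eq_smul_one]

/-- Every restriction of the spectral measure at `ψ` to a Borel set is again the spectral measure at
some vector. -/
theorem exists_spectralMeasure_eq_restrict (H : E →L[ℂ] E) (ψ : E)
    {A : Set ℝ} (hA : MeasurableSet A) :
    ∃ φ : E, spectralMeasure H φ = (spectralMeasure H ψ).restrict A := by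
  set σ := spectralMeasure H ψ with hσ
  set a : ℝ → ℝ := A.indicator fun _ => 1 with ha
  have hab : ∀ x, 0 ≤ a x ∧ a x ≤ 1 := fun x => by
    by_cases h : x ∈ A <;> simp [ha, h]
  have haint : Integrable a σ := (integrable_const _).indicator hA
  have hsq : ∀ x, a x ^ 2 = a x := fun x => by
    by_cases h : x ∈ A <;> simp [ha, h]
  -- continuous approximations with values in `[0, 1]`
  have happ : ∀ n : ℕ, ∃ f : ℝ → ℝ, Continuous f ∧ (∀ x, 0 ≤ f x ∧ f x ≤ 1) ∧
      ∫ x, |f x - a x| ∂σ ≤ 1 / (n + 1) := by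
    intro n
    obtain ⟨g, hg, hgi⟩ := haint.exists_boundedContinuous_integral_sub_le
      (ε := 1 / (n + 1)) (by positivity)
    refine ⟨fun x => max 0 (min 1 (g x)), by fun_prop,
      fun x => ⟨le_max_left _ _, max_le zero_le_one (min_le_left _ _)⟩, le_trans ?_ hg⟩
    apply integral_mono_of_nonneg (Eventually.of_forall fun x => abs_nonneg _)
      (haint.sub hgi).norm
    refine Eventually.of_forall fun x => ?_
    have h1 : a x = max 0 (min 1 (a x)) := by
      rw [min_eq_right (hab x).2, max_eq_right (hab x).1]
    have : |max 0 (min 1 (g x)) - a x| ≤ |g x - a x| := by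
      conv_lhs => rw [h1]
      refine (abs_max_sub_max_le_max _ _ _ _).trans ?_
      rw [sub_self, abs_zero]
      refine max_le (abs_nonneg _) ((abs_min_sub_min_le_max _ _ _ _).trans ?_)
      simp
    simpa [Real.norm_eq_abs, abs_sub_comm (a x)] using this
  choose f hfc hf01 hfa using happ
  have hfint : ∀ n, Integrable (fun x => |f n x - a x|) σ := fun n =>
    ((integrable_spectralMeasure H ψ (hfc n)).sub haint).abs
  -- the Cauchy property
  have hdist : ∀ m n : ℕ, ‖cfc (f m) H ψ - cfc (f n) H ψ‖ ^ 2 ≤ 1 / (m + 1) + 1 / (n + 1) := by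
    intro m n
    have e1 : cfc (f m) H ψ - cfc (f n) H ψ = cfc (fun x => f m x - f n x) H ψ := by
      rw [cfc_sub (f m) (f n) H (hfc m).continuousOn (hfc n).continuousOn]
      rfl
    rw [e1, norm_cfc_sq H ψ (f := fun x => f m x - f n x) ((hfc m).sub (hfc n))]
    refine le_trans ?_ (add_le_add (hfa m) (hfa n))
    rw [← integral_add (hfint m) (hfint n)]
    apply integral_mono_of_nonneg (Eventually.of_forall fun x => sq_nonneg _)
      ((hfint m).add (hfint n))
    refine Eventually.of_forall fun x => ?_
    -- A difference of functions with values in `[0, 1]` has square at most its modulus, so `L¹`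
    -- approximation suffices for a Cauchy sequence of vectors.
    have h1 : |f m x - f n x| ≤ 1 :=
      abs_le.2 ⟨by linarith [(hf01 m x).1, (hf01 n x).2], by linarith [(hf01 m x).2, (hf01 n x).1]⟩
    have h2 : |f m x - f n x| ≤ |f m x - a x| + |f n x - a x| := by
      rw [abs_sub_comm (f n x)]
      exact abs_sub_le _ _ _
    have h3 := abs_nonneg (f m x - f n x)
    have h4 : (f m x - f n x) ^ 2 = |f m x - f n x| ^ 2 := (sq_abs _).symm
    simp only [Pi.add_apply]
    nlinarith
  have hcauchy : CauchySeq fun n => cfc (f n) H ψ := by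
    rw [Metric.cauchySeq_iff']
    intro ε hε
    obtain ⟨N, hN⟩ := exists_nat_gt (2 / ε ^ 2)
    refine ⟨N, fun n hn => ?_⟩
    rw [dist_eq_norm]
    refine lt_of_pow_lt_pow_left₀ 2 hε.le ((hdist n N).trans_lt ?_)
    have hN0 : (0 : ℝ) < N := lt_trans (by positivity) hN
    have h1 : (1 : ℝ) / (n + 1) ≤ 1 / N := by
      apply one_div_le_one_div_of_le hN0
      have : (N : ℝ) ≤ n := by exact_mod_cast hn
      linarith
    have h2 : (1 : ℝ) / (N + 1) ≤ 1 / N := one_div_le_one_div_of_le hN0 (by linarith)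
    have h3 : 2 / (N : ℝ) < ε ^ 2 := by
      rw [div_lt_iff₀ hN0]
      rw [div_lt_iff₀ (by positivity)] at hN
      linarith
    have h4 : (1 : ℝ) / N + 1 / N = 2 / N := by ring
    linarith
  obtain ⟨φ, hφ⟩ := cauchySeq_tendsto_of_complete hcauchy
  refine ⟨φ, ?_⟩
  have : (σ.restrict A).Regular := by
    have : IsFiniteMeasure (σ.restrict A) := inferInstance
    infer_instance
  apply Measure.ext_of_integral_eq_on_compactlySupported
  intro g
  have hgc : Continuous fun x => g x := g.continuous
  rw [integral_spectralMeasure]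
  have hL : Tendsto (fun n => (⟪cfc (f n) H ψ, cfc (fun t => g t) H (cfc (f n) H ψ)⟫_ℂ).re) atTop
      (𝓝 (⟪φ, cfc (fun t => g t) H φ⟫_ℂ).re) := by
    apply (Complex.continuous_re.tendsto _).comp
    exact hφ.inner (((cfc (fun t => g t) H).continuous.tendsto _).comp hφ)
  refine tendsto_nhds_unique hL ?_
  have e2 : ∀ n, (⟪cfc (f n) H ψ, cfc (fun t => g t) H (cfc (f n) H ψ)⟫_ℂ).re =
      ∫ x, f n x * (g x * f n x) ∂σ := by
    intro n
    have : cfc (fun t => g t) H (cfc (f n) H ψ) = cfc (fun t => g t * f n t) H ψ := by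
      rw [cfc_mul (fun t => g t) (f n) H hgc.continuousOn (hfc n).continuousOn]
      rfl
    rw [this, inner_cfc_cfc H ψ (g := fun t => g t * f n t) (hfc n) (hgc.mul (hfc n)),
        Complex.ofReal_re]
  simp only [e2]
  rw [← integral_indicator hA]
  have e3 : ∀ x, A.indicator (fun x => g x) x = a x * (g x * a x) := by
    intro x
    by_cases h : x ∈ A <;> simp [ha, h]
  simp only [e3]
  obtain ⟨C, hC⟩ := g.hasCompactSupport.exists_bound_of_continuous hgc
  rw [tendsto_iff_norm_sub_tendsto_zero]
  have hC0 : 0 ≤ C := (norm_nonneg _).trans (hC 0)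
  have hbd : ∀ n : ℕ, ‖∫ x, f n x * (g x * f n x) ∂σ - ∫ x, a x * (g x * a x) ∂σ‖ ≤
      2 * C * (1 / (n + 1)) := by
    intro n
    have i1 : Integrable (fun x => f n x * (g x * f n x)) σ :=
      integrable_spectralMeasure H ψ ((hfc n).mul (hgc.mul (hfc n)))
    have i2 : Integrable (fun x => a x * (g x * a x)) σ := by
      simp only [← e3]
      exact (integrable_spectralMeasure H ψ hgc).indicator hA
    rw [← integral_sub i1 i2]
    refine (norm_integral_le_integral_norm _).trans ?_
    refine le_trans ?_ (mul_le_mul_of_nonneg_left (hfa n) (by positivity))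
    rw [← integral_const_mul]
    apply integral_mono_of_nonneg (Eventually.of_forall fun x => norm_nonneg _)
      ((hfint n).const_mul _)
    refine Eventually.of_forall fun x => ?_
    have e4 : f n x * (g x * f n x) - a x * (g x * a x) =
        g x * ((f n x + a x) * (f n x - a x)) := by ring
    simp only [e4]
    rw [norm_mul, norm_mul, mul_comm 2 C, mul_assoc]
    refine mul_le_mul (hC x) ?_ (by positivity) hC0
    refine mul_le_mul_of_nonneg_right ?_ (abs_nonneg _)
    rw [Real.norm_eq_abs, abs_le]
    constructor <;> linarith [(hf01 n x).1, (hf01 n x).2, (hab x).1, (hab x).2]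
  refine squeeze_zero (fun n => norm_nonneg _) hbd ?_
  simpa using (tendsto_one_div_add_atTop_nhds_zero_nat (𝕜 := ℝ)).const_mul (2 * C)

/-- If the density of the spectral measure at some vector is positive almost everywhere on an
interval, then the interval belongs to the absolutely continuous spectrum. -/
theorem Icc_subset_acSpectrum (H : E →L[ℂ] E) (hH : IsSelfAdjoint H) (ψ : E) {a b : ℝ}
    (hab : a < b)
    (hpos : ∀ᵐ x ∂(volume : Measure ℝ), x ∈ Set.Ioo a b →
      (spectralMeasure H ψ).rnDeriv volume x ≠ 0) :
    Set.Icc a b ⊆ acSpectrum H hH := by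
  intro t ht
  set σ := spectralMeasure H ψ with hσ
  by_contra hspec
  have hunit : IsUnit (algebraMap ℂ _ (t : ℂ) - H.restrict (map_mem_acSubspace H hH)) := by
    simpa [acSpectrum, spectrum.mem_iff] using hspec
  obtain ⟨B, hB⟩ := hunit.exists_left_inv
  -- Chosen with `‖B‖ δ < 1`: a nonzero vector with `‖(H - t)φ‖ ≤ δ ‖φ‖` then contradicts the
  -- inverse `B`.
  set δ : ℝ := 1 / (2 * (‖B‖ + 1)) with hδ
  have hδ0 : 0 < δ := by positivity
  have hBδ : ‖B‖ * δ < 1 := by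
    rw [hδ, mul_one_div, div_lt_one (by positivity)]
    linarith [norm_nonneg B]
  obtain ⟨S, hS, hSsing, hSvol⟩ := Measure.mutuallySingular_singularPart σ volume
  -- a small interval around `t` that meets `(a, b)`
  set J : Set ℝ := Set.Ioo (max a (t - δ)) (min b (t + δ)) with hJ
  have hJne : max a (t - δ) < min b (t + δ) := by
    rw [max_lt_iff, lt_min_iff, lt_min_iff]
    exact ⟨⟨hab, by linarith [ht.1]⟩, by linarith [ht.2], by linarith⟩
  -- On `S` the singular part of `σ` vanishes and `Sᶜ` is Lebesgue null, so restricting `σ` to `A`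
  -- leaves an absolutely continuous measure and loses nothing of the density on `J`.
  set A : Set ℝ := S ∩ J with hA
  have hAm : MeasurableSet A := hS.inter measurableSet_Ioo
  obtain ⟨φ, hφ⟩ := exists_spectralMeasure_eq_restrict H ψ hAm
  have hdecomp := Measure.haveLebesgueDecomposition_add σ (volume : Measure ℝ)
  have hrestr : σ.restrict A = (volume.withDensity (σ.rnDeriv volume)).restrict A := by
    conv_lhs => rw [hdecomp]
    rw [Measure.restrict_add, Measure.restrict_eq_zero.2 (measure_mono_null Set.inter_subset_left
      hSsing), zero_add]
  have hφac : φ ∈ acSubspace H := by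
    change spectralMeasure H φ ≪ volume
    rw [hφ, ← hσ, hrestr]
    exact (Measure.absolutelyContinuous_of_le Measure.restrict_le_self).trans
      (withDensity_absolutelyContinuous _ _)
  have hφpos : 0 < ‖φ‖ := by
    rw [norm_pos_iff]
    rintro rfl
    rw [spectralMeasure_zero, ← hσ, hrestr, eq_comm, Measure.restrict_eq_zero,
      withDensity_apply _ hAm, lintegral_eq_zero_iff (Measure.measurable_rnDeriv _ _)] at hφ
    -- If `φ = 0`, the density vanishes almost everywhere on `A`; being nonzero there, it forces
    -- `A`, hence the nonempty interval `J`, to be null.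
    have h1 : ∀ᵐ x ∂(volume.restrict A : Measure ℝ), False := by
      filter_upwards [hφ, ae_restrict_of_ae hpos, ae_restrict_mem hAm] with x h1 h2 h3
      exact h2 ⟨(le_max_left _ _).trans_lt h3.2.1, h3.2.2.trans_le (min_le_left _ _)⟩ h1
    have h2 : volume A = 0 := by
      rw [ae_iff] at h1
      simpa using h1
    have h3 : volume J = 0 := by
      refine measure_mono_null (?_ : J ⊆ A ∪ Sᶜ) (measure_union_null h2 hSvol)
      intro x hx
      by_cases hxS : x ∈ S
      · exact Or.inl ⟨hxS, hx⟩
      · exact Or.inr hxS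
    rw [hJ, Real.volume_Ioo, ENNReal.ofReal_eq_zero] at h3
    linarith
  have hdefect : ‖H φ - (t : ℂ) • φ‖ ≤ δ * ‖φ‖ := by
    apply (pow_le_pow_iff_left₀ (norm_nonneg _) (by positivity) two_ne_zero).1
    rw [norm_sub_smul_sq H hH, mul_pow, ← spectralMeasure_univ H hH φ]
    have hle : ∫ x, (x - t) ^ 2 ∂(spectralMeasure H φ) ≤ ∫ x, δ ^ 2 ∂(spectralMeasure H φ) := by
      apply integral_mono_of_nonneg (Eventually.of_forall fun x => sq_nonneg _)
        (integrable_const _)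
      rw [hφ]
      filter_upwards [ae_restrict_mem hAm] with x hx
      have h1 := (le_max_right _ _).trans_lt hx.2.1
      have h2 := hx.2.2.trans_le (min_le_right _ _)
      exact sq_le_sq' (by linarith) (by linarith)
    refine hle.trans (le_of_eq ?_)
    rw [integral_const, smul_eq_mul, mul_comm]
  have hinv : (⟨φ, hφac⟩ : acSubspace H) =
      B ((algebraMap ℂ _ (t : ℂ) - H.restrict (map_mem_acSubspace H hH)) ⟨φ, hφac⟩) := by
    rw [← mul_apply_eq_comp, hB, one_apply_eq_self]
  have hn : ‖φ‖ ≤ ‖B‖ * ‖H φ - (t : ℂ) • φ‖ := by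
    have h1 := congrArg norm hinv
    have h2 := B.le_opNorm ((algebraMap ℂ _ (t : ℂ) - H.restrict (map_mem_acSubspace H hH))
      ⟨φ, hφac⟩)
    rw [← h1] at h2
    refine h2.trans (le_of_eq ?_)
    have h4 : (((algebraMap ℂ _ (t : ℂ) - H.restrict (map_mem_acSubspace H hH))
        ⟨φ, hφac⟩ : acSubspace H) : E) = (t : ℂ) • φ - H φ := by
      simp [Algebra.algebraMap_eq_smul_one]
    rw [norm_sub_rev, ← h4]
    rfl
  have h3 : ‖B‖ * ‖H φ - (t : ℂ) • φ‖ ≤ ‖B‖ * (δ * ‖φ‖) :=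
    mul_le_mul_of_nonneg_left hdefect (norm_nonneg B)
  nlinarith

/-- Spectral measures converge weakly along strongly convergent bounded sequences of self-adjoint
operators. -/
theorem tendsto_integral_spectralMeasure {H : E →L[ℂ] E} (hH : IsSelfAdjoint H)
    {K : ℕ → E →L[ℂ] E} (hK : ∀ n, IsSelfAdjoint (K n)) {C : ℝ} (hC : ∀ n, ‖K n‖ ≤ C)
    (hlim : ∀ u, Tendsto (fun n => K n u) atTop (𝓝 (H u))) (ψ : E) {f : ℝ → ℝ}
    (hf : Continuous f) :
    Tendsto (fun n => ∫ x, f x ∂(spectralMeasure (K n) ψ)) atTop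
      (𝓝 (∫ x, f x ∂(spectralMeasure H ψ))) := by
  have hC0 : 0 ≤ C := (norm_nonneg _).trans (hC 0)
  -- The uniform norm bound carries strong convergence over to powers, hence to all moments;
  -- Weierstrass approximation on one interval containing all the spectra does the rest.
  have hpow : ∀ k : ℕ, Tendsto (fun n => (K n ^ k) ψ) atTop (𝓝 ((H ^ k) ψ)) := by
    intro k
    induction k with
    | zero => simp
    | succ k ih =>
      simp only [pow_succ', mul_apply_eq_comp]
      rw [tendsto_iff_norm_sub_tendsto_zero] at ih ⊢
      have h2 := tendsto_iff_norm_sub_tendsto_zero.1 (hlim ((H ^ k) ψ))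
      have h3 := (ih.const_mul C).add h2
      rw [mul_zero, add_zero] at h3
      refine squeeze_zero (fun n => norm_nonneg _) (fun n => ?_) h3
      have e : K n ((K n ^ k) ψ) - H ((H ^ k) ψ) =
          K n ((K n ^ k) ψ - (H ^ k) ψ) + (K n ((H ^ k) ψ) - H ((H ^ k) ψ)) := by
        rw [map_sub]
        abel
      rw [e]
      refine (norm_add_le _ _).trans (add_le_add ?_ le_rfl)
      exact (K n).le_of_opNorm_le (hC n) _
  have hmono : ∀ k : ℕ, Tendsto (fun n => ∫ x, x ^ k ∂(spectralMeasure (K n) ψ)) atTop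
      (𝓝 (∫ x, x ^ k ∂(spectralMeasure H ψ))) := by
    intro k
    rw [integral_pow_spectralMeasure H hH]
    simp only [integral_pow_spectralMeasure _ (hK _)]
    exact (Complex.continuous_re.tendsto _).comp (tendsto_const_nhds.inner (hpow k))
  have hpoly : ∀ p : Polynomial ℝ, Tendsto (fun n => ∫ x, p.eval x ∂(spectralMeasure (K n) ψ))
      atTop (𝓝 (∫ x, p.eval x ∂(spectralMeasure H ψ))) := by
    intro p
    have e : ∀ L : E →L[ℂ] E, ∫ x, p.eval x ∂(spectralMeasure L ψ) =
        ∑ k ∈ Finset.range (p.natDegree + 1), p.coeff k * ∫ x, x ^ k ∂(spectralMeasure L ψ) := by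
      intro L
      simp only [Polynomial.eval_eq_sum_range]
      rw [integral_finsetSum]
      · simp only [integral_const_mul]
      · intro k _
        exact integrable_spectralMeasure L ψ (by fun_prop)
    simp only [e]
    exact tendsto_finsetSum _ fun k _ => (hmono k).const_mul _
  rw [Metric.tendsto_atTop]
  intro ε hε
  set D : ℝ := max C ‖H‖ with hD
  -- All the measures have mass `‖ψ‖²`, so a uniform error `η` on the common interval costs at most
  -- `ε / 4` in each integral.
  set η : ℝ := ε / (4 * (‖ψ‖ ^ 2 + 1)) with hη
  have hη0 : 0 < η := by positivity
  obtain ⟨p, hp⟩ := exists_polynomial_near_of_continuousOn (-D) D f hf.continuousOn η hη0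
  have happ : ∀ L : E →L[ℂ] E, IsSelfAdjoint L → ‖L‖ ≤ D →
      |∫ x, f x ∂(spectralMeasure L ψ) - ∫ x, p.eval x ∂(spectralMeasure L ψ)| ≤ ε / 4 := by
    intro L hL hLD
    rw [← integral_sub (integrable_spectralMeasure L ψ hf)
      (integrable_spectralMeasure L ψ p.continuous)]
    have h1 : ‖∫ x, (f x - p.eval x) ∂(spectralMeasure L ψ)‖ ≤
        η * (spectralMeasure L ψ).real Set.univ := by
      apply norm_integral_le_of_norm_le_const
      filter_upwards [ae_abs_le_norm L ψ] with x hx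
      rw [norm_sub_rev]
      exact (hp x (abs_le.1 (hx.trans hLD))).le
    rw [spectralMeasure_univ L hL] at h1
    refine h1.trans ?_
    rw [hη, div_mul_eq_mul_div, div_le_div_iff₀ (by positivity) (by positivity)]
    nlinarith [sq_nonneg ‖ψ‖]
  obtain ⟨N, hN⟩ := (Metric.tendsto_atTop.1 (hpoly p)) (ε / 4) (by positivity)
  refine ⟨N, fun n hn => ?_⟩
  have h1 := happ (K n) (hK n) ((hC n).trans (le_max_left _ _))
  have h2 := happ H hH (le_max_right _ _)
  have h3 := hN n hn
  rw [Real.dist_eq] at h3 ⊢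
  rw [abs_le] at h1 h2
  rw [abs_lt] at h3 ⊢
  constructor <;> linarith [h1.1, h1.2, h2.1, h2.2, h3.1, h3.2]

end SpectralTheory

/-! ### The semicircle measure -/

section FreeMeasure

theorem freeDensity_nonneg (x : ℝ) : 0 ≤ freeDensity x := by
  unfold freeDensity
  positivity

theorem continuous_freeDensity : Continuous freeDensity := by
  unfold freeDensity
  fun_prop

theorem measurable_freeDensity : Measurable freeDensity := continuous_freeDensity.measurable

theorem two_sqrt_two_sq : (2 * Real.sqrt 2) ^ 2 = 8 := by
  rw [mul_pow, Real.sq_sqrt (by norm_num)]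
  norm_num

theorem mem_band_iff {x : ℝ} :
    x ∈ Set.Ioo (-(2 * Real.sqrt 2)) (2 * Real.sqrt 2) ↔ x ^ 2 < 8 := by
  rw [← two_sqrt_two_sq, sq_lt_sq, abs_of_pos (a := 2 * Real.sqrt 2) (by positivity), abs_lt]
  rfl

theorem freeDensity_pos {x : ℝ} (hx : x ∈ Set.Ioo (-(2 * Real.sqrt 2)) (2 * Real.sqrt 2)) :
    0 < freeDensity x := by
  rw [mem_band_iff] at hx
  unfold freeDensity
  have : 0 < 8 - x ^ 2 := by linarith
  positivity

theorem freeDensity_eq_zero {x : ℝ}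
    (hx : x ∉ Set.Ioo (-(2 * Real.sqrt 2)) (2 * Real.sqrt 2)) : freeDensity x = 0 := by
  rw [mem_band_iff] at hx
  unfold freeDensity
  rw [Real.sqrt_eq_zero_of_nonpos (by linarith), zero_div]

theorem freeDensity_le_one (x : ℝ) : freeDensity x ≤ 1 := by
  unfold freeDensity
  rw [div_le_one (by positivity)]
  have h1 : Real.sqrt (8 - x ^ 2) ≤ 3 := by
    rw [Real.sqrt_le_left (by norm_num)]
    nlinarith [sq_nonneg x]
  linarith [Real.pi_gt_three]

theorem integral_freeMeasure_eq {F : Type*} [NormedAddCommGroup F] [NormedSpace ℝ F]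
    (g : ℝ → F) : ∫ x, g x ∂freeMeasure = ∫ x, freeDensity x • g x := by
  have h : freeMeasure = volume.withDensity
      (fun x => (((freeDensity x).toNNReal : NNReal) : ℝ≥0∞)) := rfl
  rw [h, integral_withDensity_eq_integral_smul measurable_freeDensity.real_toNNReal]
  congr 1
  ext x
  rw [NNReal.smul_def, Real.coe_toNNReal _ (freeDensity_nonneg x)]

theorem integral_freeMeasure_eq_setIntegral {F : Type*} [NormedAddCommGroup F] [NormedSpace ℝ F]
    (g : ℝ → F) : ∫ x, g x ∂freeMeasure =
      ∫ x in Set.Ioo (-(2 * Real.sqrt 2)) (2 * Real.sqrt 2), freeDensity x • g x := by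
  rw [integral_freeMeasure_eq, setIntegral_eq_integral_of_forall_compl_eq_zero]
  intro x hx
  rw [freeDensity_eq_zero hx, zero_smul]

/-- The substitution `x = 2√2 cos θ`. -/
theorem integral_freeMeasure_eq_cos {F : Type*} [NormedAddCommGroup F] [NormedSpace ℝ F]
    (g : ℝ → F) : ∫ x, g x ∂freeMeasure =
      ∫ θ in (0 : ℝ)..Real.pi, (2 / Real.pi * Real.sin θ ^ 2) • g (2 * Real.sqrt 2 * Real.cos θ)
        := by
  rw [integral_freeMeasure_eq_setIntegral, intervalIntegral.integral_of_le Real.pi_pos.le,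
    ← integral_Ioc_eq_integral_Ioo]
  have himg : (fun θ => 2 * Real.sqrt 2 * Real.cos θ) '' Set.Ioo 0 Real.pi =
      Set.Ioo (-(2 * Real.sqrt 2)) (2 * Real.sqrt 2) := by
    have hs : 0 < 2 * Real.sqrt 2 := by positivity
    ext x
    constructor
    · rintro ⟨θ, hθ, rfl⟩
      rw [mem_band_iff, mul_pow, two_sqrt_two_sq]
      have h1 := Real.sin_pos_of_mem_Ioo hθ
      nlinarith [Real.sin_sq_add_cos_sq θ]
    · intro hx
      have h1 : -1 < x / (2 * Real.sqrt 2) := by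
        rw [lt_div_iff₀ hs]
        linarith [hx.1]
      have h2 : x / (2 * Real.sqrt 2) < 1 := by
        rw [div_lt_iff₀ hs]
        linarith [hx.2]
      refine ⟨Real.arccos (x / (2 * Real.sqrt 2)), ⟨Real.arccos_pos.2 h2, ?_⟩, ?_⟩
      · refine lt_of_le_of_ne (Real.arccos_le_pi _) fun h => ?_
        rw [Real.arccos_eq_pi] at h
        linarith
      · simp only [Real.cos_arccos h1.le h2.le]
        field_simp
  have hinj : Set.InjOn (fun θ => 2 * Real.sqrt 2 * Real.cos θ) (Set.Ioo 0 Real.pi) := by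
    intro a ha b hb h
    have h' : Real.cos a = Real.cos b :=
      mul_left_cancel₀ (by positivity : 2 * Real.sqrt 2 ≠ 0) h
    exact Real.injOn_cos (Set.Ioo_subset_Icc_self ha) (Set.Ioo_subset_Icc_self hb) h'
  have hder : ∀ θ ∈ Set.Ioo 0 Real.pi, HasDerivWithinAt (fun θ => 2 * Real.sqrt 2 * Real.cos θ)
      (2 * Real.sqrt 2 * -Real.sin θ) (Set.Ioo 0 Real.pi) θ := fun θ _ =>
    ((Real.hasDerivAt_cos θ).const_mul _).hasDerivWithinAt
  rw [integral_Ioc_eq_integral_Ioo, integral_Ioc_eq_integral_Ioo, ← himg,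
    integral_image_eq_integral_abs_deriv_smul measurableSet_Ioo hder hinj]
  apply setIntegral_congr_fun measurableSet_Ioo
  intro θ hθ
  have h1 := Real.sin_pos_of_mem_Ioo hθ
  simp only [← smul_assoc, smul_eq_mul]
  congr 1
  have h2 : |2 * Real.sqrt 2 * -Real.sin θ| = 2 * Real.sqrt 2 * Real.sin θ := by
    rw [mul_neg, abs_neg, abs_of_pos (by positivity)]
  have h3 : freeDensity (2 * Real.sqrt 2 * Real.cos θ) =
      2 * Real.sqrt 2 * Real.sin θ / (4 * Real.pi) := by
    unfold freeDensity
    congr 1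
    rw [Real.sqrt_eq_iff_mul_self_eq
        (by rw [mul_pow, two_sqrt_two_sq]; nlinarith [Real.cos_sq_le_one θ])
      (by positivity)]
    linear_combination -(Real.sin θ ^ 2 + Real.cos θ ^ 2) * two_sqrt_two_sq -
      8 * Real.sin_sq_add_cos_sq θ
  rw [h2, h3]
  have := two_sqrt_two_sq
  field_simp
  linear_combination (1 / 2) * this

theorem freeMeasure_le : freeMeasure ≤
    volume.restrict (Set.Ioo (-(2 * Real.sqrt 2)) (2 * Real.sqrt 2)) := by
  rw [Measure.le_iff]
  intro s hs
  rw [freeMeasure, withDensity_apply _ hs, Measure.restrict_apply hs,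
    ← setLIntegral_one, Set.inter_comm, ← Measure.restrict_restrict measurableSet_Ioo,
    ← lintegral_indicator measurableSet_Ioo]
  apply lintegral_mono
  intro x
  by_cases hx : x ∈ Set.Ioo (-(2 * Real.sqrt 2)) (2 * Real.sqrt 2)
  · rw [Set.indicator_of_mem hx]
    simpa using freeDensity_le_one x
  · simp [Set.indicator_of_notMem hx, freeDensity_eq_zero hx]

theorem ae_mem_band :
    ∀ᵐ x ∂freeMeasure, x ∈ Set.Ioo (-(2 * Real.sqrt 2)) (2 * Real.sqrt 2) :=
  (Measure.absolutelyContinuous_of_le freeMeasure_le).ae_le (ae_restrict_mem measurableSet_Ioo)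

instance : IsFiniteMeasure freeMeasure :=
  isFiniteMeasure_of_le _ freeMeasure_le

instance : IsProbabilityMeasure freeMeasure := by
  constructor
  have h := integral_freeMeasure_eq_cos (fun _ => (1 : ℝ))
  simp only [integral_const, smul_eq_mul, mul_one, intervalIntegral.integral_const_mul,
    integral_sin_sq] at h
  simp only [Real.sin_zero, Real.cos_zero, Real.sin_pi] at h
  have h1 : freeMeasure.real Set.univ = 1 := by
    rw [h]
    field_simp
    ring
  rwa [measureReal_def, ENNReal.toReal_eq_one_iff] at h1

theorem integrable_freeMeasure {F : Type*} [NormedAddCommGroup F] [SecondCountableTopology F]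
    {f : ℝ → F} (hf : Continuous f) :
    Integrable f freeMeasure := by
  obtain ⟨C, hC⟩ := (isCompact_Icc (a := -(2 * Real.sqrt 2))
      (b := 2 * Real.sqrt 2)).exists_bound_of_continuousOn
    hf.continuousOn
  refine Integrable.of_bound hf.aestronglyMeasurable C ?_
  filter_upwards [ae_mem_band] with x hx
  exact hC x (Set.Ioo_subset_Icc_self hx)

/-- The Joukowsky coordinate of a point of the upper half-plane. -/
theorem exists_joukowsky {z : ℂ} (hz : 0 < z.im) :
    ∃ ζ : ℂ, ζ ≠ 0 ∧ ‖ζ‖ < 1 ∧ z = Real.sqrt 2 * (ζ + ζ⁻¹) := by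
  have h2 : ((Real.sqrt 2 : ℝ) : ℂ) ≠ 0 := by
    exact_mod_cast (Real.sqrt_pos.2 (by norm_num : (0 : ℝ) < 2)).ne'
  obtain ⟨s, hs⟩ := IsAlgClosed.exists_eq_mul_self
      (discrim ((Real.sqrt 2 : ℝ) : ℂ) (-z) (Real.sqrt 2 : ℝ))
  obtain ⟨ζ, hζ⟩ := exists_quadratic_eq_zero h2 ⟨s, hs⟩
  have hζ0 : ζ ≠ 0 := by
    rintro rfl
    simp at hζ
  have hzζ : z = Real.sqrt 2 * (ζ + ζ⁻¹) := by
    field_simp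
    linear_combination -hζ
  -- The roots of the quadratic are inverse to each other; on the unit circle `ζ⁻¹` is the conjugate
  -- of `ζ` and `z` would be real. Hence one of the two lies in the open disc.
  have hne : ‖ζ‖ ≠ 1 := by
    intro h1
    have h3 : ζ⁻¹ = (starRingEnd ℂ) ζ := by
      rw [Complex.inv_def, Complex.normSq_eq_norm_sq, h1]
      simp
    rw [hzζ, h3, Complex.add_conj, ← Complex.ofReal_mul, Complex.ofReal_im] at hz
    exact lt_irrefl _ hz
  rcases lt_or_gt_of_ne hne with h | h
  · exact ⟨ζ, hζ0, h, hzζ⟩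
  · refine ⟨ζ⁻¹, inv_ne_zero hζ0, ?_, ?_⟩
    · rw [norm_inv]
      exact inv_lt_one_of_one_lt₀ h
    · rw [inv_inv, add_comm, hzζ]

theorem one_sub_mul_ne_zero {ζ w : ℂ} (hζ : ‖ζ‖ < 1) (hw : ‖w‖ ≤ 1) : 1 - ζ * w ≠ 0 := by
  intro h
  have h1 : ζ * w = 1 := by linear_combination -h
  have h2 := congrArg norm h1
  rw [norm_mul, norm_one] at h2
  nlinarith [norm_nonneg ζ, norm_nonneg w]

/-- With `w = exp(iθ)` the integrand is `w/(w - ζ) · (1 - ζw)⁻¹`, whose circle average is, by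
Cauchy's formula, the value of `(1 - ζw)⁻¹` at `w = ζ`. The symmetry `θ ↦ 2π - θ` halves the circle.
-/
theorem integral_poisson {ζ : ℂ} (hζ : ‖ζ‖ < 1) :
    ∫ θ in (0 : ℝ)..Real.pi, (1 + ζ ^ 2 - ζ * (2 * Real.cos θ))⁻¹ = Real.pi / (1 - ζ ^ 2) := by
  set h : ℝ → ℂ := fun θ => (1 + ζ ^ 2 - ζ * (2 * Real.cos θ))⁻¹ with hh
  have hfac : ∀ θ : ℝ, (1 + ζ ^ 2 - ζ * (2 * Real.cos θ) : ℂ) =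
      (1 - ζ * Complex.exp (θ * Complex.I)) * (1 - ζ * Complex.exp (-(θ * Complex.I))) := by
    intro θ
    have e1 : (2 * Real.cos θ : ℂ) =
        Complex.exp (θ * Complex.I) + Complex.exp (-(θ * Complex.I)) := by
      rw [Complex.ofReal_cos, Complex.two_cos, neg_mul]
    have e2 : Complex.exp (θ * Complex.I) * Complex.exp (-(θ * Complex.I)) = 1 := by
      rw [← Complex.exp_add, add_neg_cancel, Complex.exp_zero]
    rw [e1]
    linear_combination (-ζ ^ 2) * e2
  have hn1 : ∀ θ : ℝ, 1 - ζ * Complex.exp (θ * Complex.I) ≠ 0 := fun θ =>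
    one_sub_mul_ne_zero hζ (by rw [Complex.norm_exp_ofReal_mul_I])
  have hn2 : ∀ θ : ℝ, 1 - ζ * Complex.exp (-(θ * Complex.I)) ≠ 0 := fun θ =>
    one_sub_mul_ne_zero hζ (by
      rw [← neg_mul, ← Complex.ofReal_neg, Complex.norm_exp_ofReal_mul_I])
  have hcont : Continuous h := by
    refine Continuous.inv₀ (by fun_prop) fun θ => ?_
    rw [hfac]
    exact mul_ne_zero (hn1 θ) (hn2 θ)
  have hcirc : Real.circleAverage
      (fun w => ((w - 0) / (w - ζ)) • (1 - ζ * w)⁻¹) 0 1 = (1 - ζ * ζ)⁻¹ := by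
    apply DiffContOnCl.circleAverage_smul_div (f := fun w => (1 - ζ * w)⁻¹)
    · apply DifferentiableOn.diffContOnCl
      intro w hw
      rw [abs_one, closure_ball _ one_ne_zero, mem_closedBall_zero_iff] at hw
      apply DifferentiableAt.differentiableWithinAt
      exact DifferentiableAt.inv (by fun_prop) (one_sub_mul_ne_zero hζ hw)
    · simpa using hζ
  have hfull : ∫ θ in (0 : ℝ)..(2 * Real.pi), h θ = 2 * Real.pi / (1 - ζ ^ 2) := by
    rw [Real.circleAverage_def] at hcirc
    have e : ∀ θ : ℝ, ((circleMap 0 1 θ - 0) / (circleMap 0 1 θ - ζ)) •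
        (1 - ζ * circleMap 0 1 θ)⁻¹ = h θ := by
      intro θ
      have e1 : circleMap 0 1 θ = Complex.exp (θ * Complex.I) := by simp [circleMap]
      have e2 : Complex.exp (θ * Complex.I) * Complex.exp (-(θ * Complex.I)) = 1 := by
        rw [← Complex.exp_add, add_neg_cancel, Complex.exp_zero]
      have e3 : Complex.exp (θ * Complex.I) - ζ =
          Complex.exp (θ * Complex.I) * (1 - ζ * Complex.exp (-(θ * Complex.I))) := by
        linear_combination ζ * e2
      simp only [hh]
      rw [e1, hfac, sub_zero, e3, smul_eq_mul]
      have := hn1 θ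
      have := hn2 θ
      have := Complex.exp_ne_zero (θ * Complex.I)
      field_simp
    simp only [e] at hcirc
    have hpi : (Real.pi : ℂ) ≠ 0 := by exact_mod_cast Real.pi_ne_zero
    rw [div_eq_mul_inv, pow_two, ← hcirc, Complex.real_smul]
    push_cast
    field_simp
  have hsym : ∫ θ in Real.pi..(2 * Real.pi), h θ = ∫ θ in (0 : ℝ)..Real.pi, h θ := by
    have := intervalIntegral.integral_comp_sub_left (a := 0) (b := Real.pi) h (2 * Real.pi)
    rw [sub_zero, show 2 * Real.pi - Real.pi = Real.pi by ring] at this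
    rw [← this]
    simp only [hh, Real.cos_two_pi_sub]
  rw [← intervalIntegral.integral_add_adjacent_intervals (hcont.intervalIntegrable 0 Real.pi)
    (hcont.intervalIntegrable Real.pi _), hsym] at hfull
  linear_combination hfull / 2

/-- The Borel transform of the semicircle measure in the Joukowsky coordinate. -/
theorem borelTransform_freeMeasure {z ζ : ℂ} (hz : 0 < z.im) (hζ0 : ζ ≠ 0) (hζ : ‖ζ‖ < 1)
    (hzζ : z = Real.sqrt 2 * (ζ + ζ⁻¹)) :
    borelTransform freeMeasure z = -(ζ / Real.sqrt 2) := by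
  have h2 : ((Real.sqrt 2 : ℝ) : ℂ) ≠ 0 := by
    exact_mod_cast (Real.sqrt_pos.2 (by norm_num : (0 : ℝ) < 2)).ne'
  have hpi : (Real.pi : ℂ) ≠ 0 := by exact_mod_cast Real.pi_ne_zero
  have h22 : ((Real.sqrt 2 : ℝ) : ℂ) ^ 2 = 2 := by
    exact_mod_cast Real.sq_sqrt (by norm_num : (0 : ℝ) ≤ 2)
  have hζ1 : 1 - ζ ^ 2 ≠ 0 := by
    rw [pow_two]
    exact one_sub_mul_ne_zero hζ hζ.le
  have hP := integral_poisson hζ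
  have hden : ∀ θ : ℝ, (1 + ζ ^ 2 - ζ * (2 * Real.cos θ) : ℂ) ≠ 0 := by
    intro θ h
    apply ofReal_sub_ne_zero hz (2 * Real.sqrt 2 * Real.cos θ)
    rw [hzζ]
    push_cast at h ⊢
    field_simp
    linear_combination -(Real.sqrt 2 : ℂ) * h
  -- Division with remainder of `sin² θ`, a polynomial in `cos θ`, by the linear denominator: the
  -- quotient integrates elementarily and the remainder is handled by `integral_poisson`.
  have e : ∀ θ : ℝ, (2 / Real.pi * Real.sin θ ^ 2) •
      (((2 * Real.sqrt 2 * Real.cos θ : ℝ) : ℂ) - z)⁻¹ =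
      (-(ζ / (Real.sqrt 2 * Real.pi))) * (((1 + ζ ^ 2) / (2 * ζ ^ 2) + (1 / ζ) * Real.cos θ) -
        (1 - ζ ^ 2) ^ 2 / (2 * ζ ^ 2) * (1 + ζ ^ 2 - ζ * (2 * Real.cos θ))⁻¹) := by
    intro θ
    have h4 := hden θ
    have h5 : ((2 * Real.sqrt 2 * Real.cos θ : ℝ) : ℂ) - z =
        -(Real.sqrt 2 / ζ) * (1 + ζ ^ 2 - ζ * (2 * Real.cos θ)) := by
      rw [hzζ]
      push_cast
      field_simp
      ring
    have h6 : ((Real.sin θ : ℝ) : ℂ) ^ 2 = 1 - (Real.cos θ : ℂ) ^ 2 := by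
      rw [← Complex.ofReal_pow, Real.sin_sq]
      push_cast
      rfl
    rw [h5, Complex.real_smul]
    push_cast
    push_cast at h4 h6
    rw [h6]
    generalize hD : 1 + ζ ^ 2 - ζ * (2 * Complex.cos θ) = D at h4 ⊢
    have hC : Complex.cos θ = (1 + ζ ^ 2 - D) / (2 * ζ) := by
      rw [← hD]
      field_simp
      ring
    rw [hC]
    field_simp
    ring
  rw [borelTransform, integral_freeMeasure_eq_cos]
  simp only [e]
  have hcont : Continuous fun θ : ℝ => (1 + ζ ^ 2 - ζ * (2 * Real.cos θ) : ℂ)⁻¹ :=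
    Continuous.inv₀ (by fun_prop) hden
  have hcos : ∫ θ in (0 : ℝ)..Real.pi, ((Real.cos θ : ℝ) : ℂ) = 0 := by
    rw [intervalIntegral.integral_ofReal, integral_cos]
    simp
  have c1 : IntervalIntegrable (fun θ : ℝ => (1 + ζ ^ 2) / (2 * ζ ^ 2) + (1 / ζ) * (Real.cos θ : ℂ))
      volume 0 Real.pi := Continuous.intervalIntegrable (by fun_prop) _ _
  have c2 : IntervalIntegrable (fun θ : ℝ => (1 - ζ ^ 2) ^ 2 / (2 * ζ ^ 2) *
      (1 + ζ ^ 2 - ζ * (2 * Real.cos θ) : ℂ)⁻¹)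
      volume 0 Real.pi := (hcont.const_mul _).intervalIntegrable _ _
  have c3 : IntervalIntegrable (fun θ : ℝ => (1 / ζ) * (Real.cos θ : ℂ))
      volume 0 Real.pi := Continuous.intervalIntegrable (by fun_prop) _ _
  rw [intervalIntegral.integral_const_mul, intervalIntegral.integral_sub c1 c2,
    intervalIntegral.integral_const_mul, hP,
    intervalIntegral.integral_add (continuous_const.intervalIntegrable _ _) c3,
    intervalIntegral.integral_const_mul, hcos, intervalIntegral.integral_const]
  rw [Complex.real_smul]
  push_cast
  field_simp
  ring

end FreeMeasure

/-! ### The logarithmic potential of the semicircle measure at height `ε` -/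

section Potential

/-- The logarithmic potential `∫ log |x - λ + iε| dw(λ)`. -/
noncomputable def freePotential (ε x : ℝ) : ℝ :=
  ∫ l, 2⁻¹ * Real.log ((x - l) ^ 2 + ε ^ 2) ∂freeMeasure

theorem continuous_log_sq_add {ε : ℝ} (hε : 0 < ε) (x : ℝ) :
    Continuous fun l : ℝ => 2⁻¹ * Real.log ((x - l) ^ 2 + ε ^ 2) :=
  continuous_const.mul (Continuous.log (by fun_prop) fun l => by positivity)

/-- The derivative `(x - l)/((x - l)² + ε²)` of the kernel is minus the real part of `(l - x -
iε)⁻¹`, and it is bounded by `1/(2ε)`, which allows differentiation under the integral. -/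
theorem hasDerivAt_freePotential {ε : ℝ} (hε : 0 < ε) (x : ℝ) :
    HasDerivAt (freePotential ε) (-(borelTransform freeMeasure ⟨x, ε⟩).re) x := by
  have hpos : ∀ y l : ℝ, 0 < (y - l) ^ 2 + ε ^ 2 := fun y l => by positivity
  have h := (hasDerivAt_integral_of_dominated_loc_of_deriv_le (μ := freeMeasure) (x₀ := x)
    (s := Set.univ) (bound := fun _ => 1 / (2 * ε))
    (F := fun x l => 2⁻¹ * Real.log ((x - l) ^ 2 + ε ^ 2))
    (F' := fun x l => (x - l) / ((x - l) ^ 2 + ε ^ 2)) univ_mem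
    (Eventually.of_forall fun y => (continuous_log_sq_add hε y).aestronglyMeasurable)
    (integrable_freeMeasure (continuous_log_sq_add hε x))
    (Continuous.aestronglyMeasurable (Continuous.div (by fun_prop) (by fun_prop)
      fun l => (hpos x l).ne'))
    (Eventually.of_forall fun l y _ => by
      rw [Real.norm_eq_abs, abs_div, abs_of_pos (hpos y l),
        div_le_div_iff₀ (hpos y l) (by positivity)]
      nlinarith [sq_nonneg (|y - l| - ε), sq_abs (y - l)])
    (integrable_const _)
    (Eventually.of_forall fun l y _ => by
      have h1 : HasDerivAt (fun y : ℝ => (y - l) ^ 2 + ε ^ 2) (2 * (y - l)) y := by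
        have := (((hasDerivAt_id y).sub_const l).pow 2).add_const (ε ^ 2)
        simpa using this
      have h2 := (h1.log (hpos y l).ne').const_mul (2⁻¹ : ℝ)
      exact h2.congr_deriv (by ring))).2
  refine HasDerivAt.congr_deriv (f := freePotential ε) h ?_
  have hz : 0 < (⟨x, ε⟩ : ℂ).im := hε
  rw [borelTransform, ← Complex.reCLM_apply,
    ← ContinuousLinearMap.integral_comp_comm _
      (integrable_freeMeasure (continuous_inv_ofReal_sub hz)),
    ← integral_neg]
  refine integral_congr_ae (Eventually.of_forall fun l => ?_)
  simp only []
  rw [Complex.reCLM_apply, Complex.inv_re, Complex.normSq_apply]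
  simp only [Complex.sub_re, Complex.ofReal_re, Complex.sub_im, Complex.ofReal_im, zero_sub]
  rw [show (l - x) * (l - x) + -ε * -ε = (x - l) ^ 2 + ε ^ 2 by ring]
  ring

/-- The excess `x²/8 + U(0) - U(x)` of the quadratic over the logarithmic potential. -/
noncomputable def potentialDefect (ε x : ℝ) : ℝ :=
  x ^ 2 / 8 + freePotential ε 0 - freePotential ε x

theorem potentialDefect_zero (ε : ℝ) : potentialDefect ε 0 = 0 := by
  simp [potentialDefect]

/-- The derivative of the defect has the sign of the argument. -/
theorem hasDerivAt_potentialDefect {ε : ℝ} (hε : 0 < ε) (x : ℝ) :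
    ∃ c : ℝ, 0 ≤ c ∧ HasDerivAt (potentialDefect ε) (c * x) x := by
  have hz : 0 < (⟨x, ε⟩ : ℂ).im := hε
  obtain ⟨ζ, hζ0, hζ, hzζ⟩ := exists_joukowsky hz
  have h1 := hasDerivAt_freePotential hε x
  rw [borelTransform_freeMeasure hz hζ0 hζ hzζ] at h1
  have h2 : HasDerivAt (potentialDefect ε) (x / 4 - (ζ / Real.sqrt 2).re) x := by
    have h3 : HasDerivAt (fun y : ℝ => y ^ 2 / 8 + freePotential ε 0) (x / 4) x := by
      have := (((hasDerivAt_id x).pow 2).div_const 8).add_const (freePotential ε 0)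
      exact this.congr_deriv (by simp only [id]; ring)
    exact (h3.sub h1).congr_deriv (by rw [Complex.neg_re, neg_neg])
  have hs : 0 < Real.sqrt 2 := by positivity
  have hs2 : Real.sqrt 2 * Real.sqrt 2 = 2 := Real.mul_self_sqrt (by norm_num)
  set q : ℝ := Complex.normSq ζ with hq
  have hq0 : 0 < q := Complex.normSq_pos.2 hζ0
  have hq1 : q < 1 := by
    rw [hq, Complex.normSq_eq_norm_sq]
    nlinarith [norm_nonneg ζ]
  have hx : x = Real.sqrt 2 * (ζ.re + ζ.re / q) := by
    have := congrArg Complex.re hzζ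
    rw [Complex.re_ofReal_mul, Complex.add_re, Complex.inv_re] at this
    exact this
  have hre : (ζ / Real.sqrt 2).re = ζ.re / Real.sqrt 2 := Complex.div_ofReal_re _ _
  -- The derivative is `x/4 - Re ζ/√2`, and `x = √2 (1 + 1/q) Re ζ` expresses `Re ζ` through `x`.
  -- The coefficient is nonnegative because `q = |ζ|² < 1`.
  refine ⟨(1 - q) / (4 * (1 + q)), div_nonneg (by linarith) (by linarith), ?_⟩
  convert h2 using 1
  rw [hre, hx]
  field_simp
  linear_combination (-2 * q * (1 + q) * ζ.re) * hs2

theorem differentiable_potentialDefect {ε : ℝ} (hε : 0 < ε) :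
    Differentiable ℝ (potentialDefect ε) := fun x => by
  obtain ⟨c, -, h⟩ := hasDerivAt_potentialDefect hε x
  exact h.differentiableAt

theorem monotoneOn_potentialDefect {ε : ℝ} (hε : 0 < ε) :
    MonotoneOn (potentialDefect ε) (Set.Ici 0) := by
  apply monotoneOn_of_deriv_nonneg (convex_Ici 0)
    (differentiable_potentialDefect hε).continuous.continuousOn
    (differentiable_potentialDefect hε).differentiableOn
  intro x hx
  rw [interior_Ici] at hx
  obtain ⟨c, hc, h⟩ := hasDerivAt_potentialDefect hε x
  rw [h.deriv]
  exact mul_nonneg hc (le_of_lt hx)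

theorem antitoneOn_potentialDefect {ε : ℝ} (hε : 0 < ε) :
    AntitoneOn (potentialDefect ε) (Set.Iic 0) := by
  apply antitoneOn_of_deriv_nonpos (convex_Iic 0)
    (differentiable_potentialDefect hε).continuous.continuousOn
    (differentiable_potentialDefect hε).differentiableOn
  intro x hx
  rw [interior_Iic] at hx
  obtain ⟨c, hc, h⟩ := hasDerivAt_potentialDefect hε x
  rw [h.deriv]
  exact mul_nonpos_of_nonneg_of_nonpos hc (le_of_lt hx)

/-- Integration by parts with the primitive `sin θ cos θ` of `cos 2θ`; the boundary function is
continuous at `0` because `t log t` is. -/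
theorem integral_cos_two_mul_log_sin :
    ∫ θ in (0 : ℝ)..(Real.pi / 2), Real.cos (2 * θ) * Real.log (Real.sin θ) = -(Real.pi / 4) := by
  have hpi := Real.pi_pos
  have hint : IntervalIntegrable (fun θ => Real.cos (2 * θ) * Real.log (Real.sin θ)) volume 0
      (Real.pi / 2) :=
    intervalIntegrable_log_sin.continuousOn_mul (by fun_prop)
  rw [intervalIntegral.integral_eq_sub_of_hasDerivAt_of_le (f := fun θ =>
    Real.cos θ * (Real.sin θ * Real.log (Real.sin θ)) - (θ / 2 + Real.sin (2 * θ) / 4))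
    (by linarith) _ _ hint]
  · have h1 : Real.sin (2 * (Real.pi / 2)) = 0 := by
      rw [mul_div_cancel₀ _ two_ne_zero, Real.sin_pi]
    simp only [Real.cos_pi_div_two, h1, Real.sin_zero, mul_zero]
    ring
  · have : Continuous fun θ => Real.sin θ * Real.log (Real.sin θ) :=
      Real.continuous_mul_log.comp Real.continuous_sin
    exact Continuous.continuousOn (by fun_prop)
  · intro θ hθ
    have hs : Real.sin θ ≠ 0 := (Real.sin_pos_of_mem_Ioo ⟨hθ.1, by linarith [hθ.2]⟩).ne'
    have h1 := Real.hasDerivAt_sin θ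
    have h2 := (Real.hasDerivAt_cos θ).mul (h1.mul (h1.log hs))
    have h3 : HasDerivAt (fun θ => Real.sin (2 * θ)) (Real.cos (2 * θ) * 2) θ := by
      have := (Real.hasDerivAt_sin (2 * θ)).comp θ ((hasDerivAt_id θ).const_mul 2)
      exact this.congr_deriv (by ring)
    have h4 := h2.sub (((hasDerivAt_id θ).div_const 2).add (h3.div_const 4))
    refine HasDerivAt.congr_deriv (f := fun θ =>
      Real.cos θ * (Real.sin θ * Real.log (Real.sin θ)) - (θ / 2 + Real.sin (2 * θ) / 4)) h4 ?_
    rw [Real.cos_two_mul, Pi.mul_apply]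
    have := Real.sin_sq_add_cos_sq θ
    field_simp
    linear_combination (-8 * Real.log (Real.sin θ)) * this

theorem integral_cos_sq_mul_log_sin :
    ∫ θ in (0 : ℝ)..(Real.pi / 2), Real.cos θ ^ 2 * Real.log (Real.sin θ) =
      -(Real.pi / 4 * Real.log 2) - Real.pi / 8 := by
  have e : ∀ θ : ℝ, Real.cos θ ^ 2 * Real.log (Real.sin θ) =
      2⁻¹ * (Real.log (Real.sin θ) + Real.cos (2 * θ) * Real.log (Real.sin θ)) := by
    intro θ
    rw [Real.cos_two_mul]
    ring
  have hint : IntervalIntegrable (fun θ => Real.cos (2 * θ) * Real.log (Real.sin θ)) volume 0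
      (Real.pi / 2) :=
    intervalIntegrable_log_sin.continuousOn_mul (by fun_prop)
  have hlog : IntervalIntegrable (fun θ => Real.log (Real.sin θ)) volume 0 (Real.pi / 2) :=
    intervalIntegrable_log_sin
  simp only [e]
  rw [intervalIntegral.integral_const_mul, intervalIntegral.integral_add hlog hint,
    integral_log_sin_zero_pi_div_two, integral_cos_two_mul_log_sin]
  ring

theorem integral_sin_sq_mul_log_cos :
    ∫ θ in (0 : ℝ)..Real.pi, Real.sin θ ^ 2 * Real.log (Real.cos θ) =
      -(Real.pi / 2 * Real.log 2) - Real.pi / 4 := by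
  set h : ℝ → ℝ := fun θ => Real.sin θ ^ 2 * Real.log (Real.cos θ) with hh
  have hi : ∀ a b : ℝ, IntervalIntegrable h volume a b := fun a b =>
    intervalIntegrable_log_cos.continuousOn_mul (by fun_prop)
  have h1 : ∫ θ in (0 : ℝ)..(Real.pi / 2), h θ =
      ∫ θ in (0 : ℝ)..(Real.pi / 2), Real.cos θ ^ 2 * Real.log (Real.sin θ) := by
    have := intervalIntegral.integral_comp_sub_left (a := 0) (b := Real.pi / 2) h (Real.pi / 2)
    rw [sub_zero, sub_self] at this
    rw [← this]
    simp only [hh, Real.sin_pi_div_two_sub, Real.cos_pi_div_two_sub]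
  -- `Real.log` is even, so the half where the cosine is negative repeats the other one.
  have h2 : ∫ θ in (Real.pi / 2)..Real.pi, h θ = ∫ θ in (0 : ℝ)..(Real.pi / 2), h θ := by
    have := intervalIntegral.integral_comp_sub_left (a := 0) (b := Real.pi / 2) h Real.pi
    rw [sub_zero, show Real.pi - Real.pi / 2 = Real.pi / 2 by ring] at this
    rw [← this]
    simp only [hh, Real.sin_pi_sub, Real.cos_pi_sub, Real.log_neg_eq_log]
  rw [← intervalIntegral.integral_add_adjacent_intervals (hi 0 (Real.pi / 2)) (hi _ _), h2, h1,
    integral_cos_sq_mul_log_sin]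
  ring

/-- As `Real.log l` means `log |l|`, this is the potential of the semicircle law at its centre. The
exact value matters: `exp(-1 - 2U(0)) = 1/2` cancels against the number of children. -/
theorem integral_log_freeMeasure :
    ∫ l, Real.log l ∂freeMeasure = 2⁻¹ * Real.log 2 - 2⁻¹ := by
  have hpi := Real.pi_pos
  rw [integral_freeMeasure_eq_cos]
  have hlog : Real.log (2 * Real.sqrt 2) = 3 / 2 * Real.log 2 := by
    rw [Real.log_mul two_ne_zero (by positivity), Real.log_sqrt (by norm_num)]
    ring
  have e : ∀ θ ∈ Set.Ioo 0 Real.pi, θ ≠ Real.pi / 2 →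
      (2 / Real.pi * Real.sin θ ^ 2) • Real.log (2 * Real.sqrt 2 * Real.cos θ) =
      2 / Real.pi * (Real.sin θ ^ 2 * (3 / 2 * Real.log 2) +
        Real.sin θ ^ 2 * Real.log (Real.cos θ)) := by
    intro θ hθ hne
    have hc : Real.cos θ ≠ 0 := by
      intro h0
      apply hne
      apply Real.injOn_cos (Set.Ioo_subset_Icc_self hθ) ⟨by linarith, by linarith⟩
      rw [h0, Real.cos_pi_div_two]
    rw [Real.log_mul (by positivity) hc, hlog, smul_eq_mul]
    ring
  have e' : ∫ θ in (0 : ℝ)..Real.pi,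
      (2 / Real.pi * Real.sin θ ^ 2) • Real.log (2 * Real.sqrt 2 * Real.cos θ) =
      ∫ θ in (0 : ℝ)..Real.pi, 2 / Real.pi * (Real.sin θ ^ 2 * (3 / 2 * Real.log 2) +
        Real.sin θ ^ 2 * Real.log (Real.cos θ)) := by
    rw [intervalIntegral.integral_of_le hpi.le, intervalIntegral.integral_of_le hpi.le,
      integral_Ioc_eq_integral_Ioo, integral_Ioc_eq_integral_Ioo]
    apply integral_congr_ae
    have hne : ∀ᵐ θ ∂(volume.restrict (Set.Ioo 0 Real.pi)), θ ≠ Real.pi / 2 :=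
      ae_restrict_of_ae (Measure.ae_ne volume _)
    filter_upwards [ae_restrict_mem measurableSet_Ioo, hne] with θ h1 h2
    exact e θ h1 h2
  have i1 : IntervalIntegrable (fun θ => Real.sin θ ^ 2 * (3 / 2 * Real.log 2)) volume 0 Real.pi :=
    Continuous.intervalIntegrable (by fun_prop) _ _
  have i2 : IntervalIntegrable (fun θ => Real.sin θ ^ 2 * Real.log (Real.cos θ)) volume 0 Real.pi :=
    intervalIntegrable_log_cos.continuousOn_mul (by fun_prop)
  rw [e', intervalIntegral.integral_const_mul, intervalIntegral.integral_add i1 i2,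
    intervalIntegral.integral_mul_const, integral_sin_sq_mul_log_cos, integral_sin_sq]
  simp only [Real.sin_zero, Real.cos_zero, Real.sin_pi]
  field_simp
  ring

theorem integrable_log_freeMeasure : Integrable Real.log freeMeasure := by
  have h : IntegrableOn Real.log (Set.Ioo (-(2 * Real.sqrt 2)) (2 * Real.sqrt 2)) volume := by
    have h1 : IntervalIntegrable Real.log volume (-(2 * Real.sqrt 2)) (2 * Real.sqrt 2) :=
      intervalIntegral.intervalIntegrable_log'
    rw [intervalIntegrable_iff_integrableOn_Ioo_of_le (by linarith [Real.sqrt_nonneg 2])] at h1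
    exact h1
  exact Integrable.mono_measure h freeMeasure_le

theorem tendsto_freePotential_zero :
    Tendsto (fun ε => freePotential ε 0) (𝓝[>] 0) (𝓝 (2⁻¹ * Real.log 2 - 2⁻¹)) := by
  rw [← integral_log_freeMeasure]
  unfold freePotential
  have hmem : ∀ᶠ ε : ℝ in 𝓝[>] 0, ε ∈ Set.Ioo (0 : ℝ) 1 := Ioo_mem_nhdsGT one_pos
  have hne : ∀ᵐ l ∂freeMeasure, l ≠ 0 :=
    (Measure.absolutelyContinuous_of_le freeMeasure_le).ae_le
      (ae_restrict_of_ae (Measure.ae_ne volume _))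
  have hlogeq : ∀ l : ℝ, Real.log l = 2⁻¹ * Real.log (l ^ 2) := fun l => by
    rw [Real.log_pow]
    push_cast
    ring
  -- From below the integrand is at least `log |l|`; from above `log t ≤ t - 1` and `l² + ε² < 9` on
  -- the band suffice.
  apply tendsto_integral_filter_of_dominated_convergence (fun l => |Real.log l| + 9)
  · filter_upwards [hmem] with ε hε
    exact (continuous_log_sq_add hε.1 0).aestronglyMeasurable
  · filter_upwards [hmem] with ε hε
    filter_upwards [hne, ae_mem_band] with l hl hb
    rw [mem_band_iff] at hb
    have hl2 : 0 < l ^ 2 := by positivity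
    have h1 : Real.log (l ^ 2) ≤ Real.log ((0 - l) ^ 2 + ε ^ 2) := by
      apply Real.log_le_log hl2
      nlinarith [sq_nonneg ε]
    have h2 : Real.log ((0 - l) ^ 2 + ε ^ 2) ≤ (0 - l) ^ 2 + ε ^ 2 - 1 :=
      Real.log_le_sub_one_of_pos (by positivity)
    have h3 : ε ^ 2 ≤ 1 := by nlinarith [hε.1, hε.2]
    have h4 := hlogeq l
    have h5 := neg_abs_le (Real.log l)
    have h6 := abs_nonneg (Real.log l)
    rw [Real.norm_eq_abs, abs_le]
    constructor <;> nlinarith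
  · exact integrable_log_freeMeasure.abs.add (integrable_const _)
  · filter_upwards [hne] with l hl
    have hc : ContinuousAt (fun ε : ℝ => 2⁻¹ * Real.log ((0 - l) ^ 2 + ε ^ 2)) 0 := by
      refine ContinuousAt.mul continuousAt_const (ContinuousAt.log (by fun_prop) ?_)
      have : 0 < l ^ 2 := by positivity
      simpa using hl
    have h := hc.tendsto.mono_left (nhdsWithin_le_nhds (s := Set.Ioi 0))
    have e : Real.log l = 2⁻¹ * Real.log ((0 - l) ^ 2 + 0 ^ 2) := by
      rw [hlogeq l]
      congr 2
      ring
    rw [e]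
    exact h

end Potential

/-! ### A lower bound for the logarithmic integral of a Borel transform -/

section LogBound

/-- Splitting `f` at `0` gives a nondecreasing and a nonincreasing part, both nonnegative. For the
former each `γ` is compared with the next `β`, for the latter with the preceding one; the one `β`
left over contributes a nonnegative amount. -/
theorem sum_le_sum_of_interlacing {f : ℝ → ℝ} (h0 : f 0 = 0) (hmono : MonotoneOn f (Set.Ici 0))
    (hanti : AntitoneOn f (Set.Iic 0)) {n : ℕ} {β : Fin (n + 1) → ℝ} {γ : Fin n → ℝ}
    (h1 : ∀ i, β i.castSucc ≤ γ i) (h2 : ∀ i, γ i ≤ β i.succ) :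
    ∑ i, f (γ i) ≤ ∑ i, f (β i) := by
  have hsplit : ∀ x, f x = f (max x 0) + f (min x 0) := by
    intro x
    rcases le_total x 0 with h | h
    · rw [max_eq_right h, min_eq_left h, h0, zero_add]
    · rw [max_eq_left h, min_eq_right h, h0, add_zero]
  have hp : ∀ x y, x ≤ y → f (max x 0) ≤ f (max y 0) := fun x y h =>
    hmono (Set.mem_Ici.2 (le_max_right _ _)) (Set.mem_Ici.2 (le_max_right _ _))
      (max_le_max_right 0 h)
  have hm : ∀ x y, x ≤ y → f (min y 0) ≤ f (min x 0) := fun x y h =>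
    hanti (Set.mem_Iic.2 (min_le_right _ _)) (Set.mem_Iic.2 (min_le_right _ _))
      (min_le_min_right 0 h)
  have hp0 : ∀ x, 0 ≤ f (max x 0) := fun x =>
    h0.symm.le.trans <| hmono (Set.mem_Ici.2 le_rfl) (Set.mem_Ici.2 (le_max_right _ _))
      (le_max_right _ _)
  have hm0 : ∀ x, 0 ≤ f (min x 0) := fun x =>
    h0.symm.le.trans <| hanti (Set.mem_Iic.2 (min_le_right _ _)) (Set.mem_Iic.2 le_rfl)
      (min_le_right _ _)
  simp only [hsplit (γ _), hsplit (β _), Finset.sum_add_distrib]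
  apply add_le_add
  · rw [Fin.sum_univ_succ]
    have := Finset.sum_le_sum fun i (_ : i ∈ Finset.univ) => hp _ _ (h2 i)
    linarith [hp0 (β 0)]
  · rw [Fin.sum_univ_castSucc]
    have := Finset.sum_le_sum fun i (_ : i ∈ Finset.univ) => hm _ _ (h1 i)
    linarith [hm0 (β (Fin.last n))]

/-- The numerator of the rational function `∑ pₖ / (z - βₖ)`. -/
noncomputable def numerator {n : ℕ} (β p : Fin (n + 1) → ℝ) : Polynomial ℝ :=
  ∑ k, Polynomial.C (p k) * ∏ j ∈ Finset.univ.erase k, (Polynomial.X - Polynomial.C (β j))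

theorem eval_numerator {n : ℕ} (β p : Fin (n + 1) → ℝ) (x : ℝ) :
    (numerator β p).eval x = ∑ k, p k * ∏ j ∈ Finset.univ.erase k, (x - β j) := by
  simp [numerator, Polynomial.eval_finsetSum, Polynomial.eval_prod]

theorem eval_numerator_node {n : ℕ} (β p : Fin (n + 1) → ℝ) (i : Fin (n + 1)) :
    (numerator β p).eval (β i) = p i * ∏ j ∈ Finset.univ.erase i, (β i - β j) := by
  rw [eval_numerator, Finset.sum_eq_single i]
  · intro k _ hk
    rw [Finset.prod_eq_zero (i := i) (Finset.mem_erase.2 ⟨hk.symm, Finset.mem_univ _⟩)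
      (sub_self _), mul_zero]
  · simp

/-- At the node `β i` only one term of the numerator survives. Between consecutive nodes the only
factor that changes sign is the difference of these two nodes, so the values have opposite signs. -/
theorem exists_root_between {n : ℕ} {β p : Fin (n + 1) → ℝ} (hβ : StrictMono β)
    (hp : ∀ i, 0 < p i) (i : Fin n) :
    ∃ x ∈ Set.Ioo (β i.castSucc) (β i.succ), (numerator β p).eval x = 0 := by
  set a := i.castSucc with ha
  set b := i.succ with hb
  have hab : a < b := Fin.castSucc_lt_succ
  have hba : b ∈ Finset.univ.erase a := Finset.mem_erase.2 ⟨hab.ne', Finset.mem_univ _⟩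
  have hab' : a ∈ Finset.univ.erase b := Finset.mem_erase.2 ⟨hab.ne, Finset.mem_univ _⟩
  have hneg : (numerator β p).eval (β a) * (numerator β p).eval (β b) < 0 := by
    rw [eval_numerator_node, eval_numerator_node, ← Finset.mul_prod_erase _ _ hba,
      ← Finset.mul_prod_erase _ _ hab', Finset.erase_right_comm (a := b)]
    set R := (Finset.univ.erase a).erase b with hR
    have hpos : 0 < (∏ j ∈ R, (β a - β j)) * ∏ j ∈ R, (β b - β j) := by
      rw [← Finset.prod_mul_distrib]
      apply Finset.prod_pos
      intro j hj
      simp only [hR, Finset.mem_erase, Finset.mem_univ, and_true] at hj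
      rcases lt_or_gt_of_ne hj.2 with h | h
      · exact mul_pos (sub_pos.2 (hβ h)) (sub_pos.2 (hβ (h.trans hab)))
      · have h' : b < j := by
          refine lt_of_le_of_ne ?_ (Ne.symm hj.1)
          rw [Fin.lt_def] at h
          rw [Fin.le_def]
          simpa [ha, hb] using h
        exact mul_pos_of_neg_of_neg (sub_neg.2 (hβ h)) (sub_neg.2 (hβ h'))
    have h1 : 0 < (β b - β a) ^ 2 := by
      have := hβ hab
      have : 0 < β b - β a := by linarith
      positivity
    have h2 := mul_pos (mul_pos (hp a) (hp b)) (mul_pos h1 hpos)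
    nlinarith
  have hlt : β a < β b := hβ hab
  have hcont : ContinuousOn (fun x => (numerator β p).eval x) (Set.Icc (β a) (β b)) :=
    (numerator β p).continuous.continuousOn
  rcases mul_neg_iff.1 hneg with ⟨h1, h2⟩ | ⟨h1, h2⟩
  · obtain ⟨x, hx, h⟩ := intermediate_value_Ioo' hlt.le hcont ⟨h2, h1⟩
    exact ⟨x, hx, h⟩
  · obtain ⟨x, hx, h⟩ := intermediate_value_Ioo hlt.le hcont ⟨h1, h2⟩
    exact ⟨x, hx, h⟩

theorem natDegree_numerator_term {n : ℕ} (β : Fin (n + 1) → ℝ) (k : Fin (n + 1)) :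
    (∏ j ∈ Finset.univ.erase k, (Polynomial.X - Polynomial.C (β j))).natDegree = n := by
  rw [Polynomial.natDegree_prod_of_monic _ _ fun j _ => Polynomial.monic_X_sub_C _]
  simp

/-- The numerator has degree at most `n` and, as the weights sum to `1`, coefficient `1` at `Xⁿ`.
The gaps between the poles supply `n` distinct roots, so it equals the monic polynomial with these
roots. -/
theorem exists_interlacing_roots {n : ℕ} {β p : Fin (n + 1) → ℝ} (hβ : StrictMono β)
    (hp : ∀ i, 0 < p i) (hp1 : ∑ i, p i = 1) :
    ∃ γ : Fin n → ℝ, (∀ i, β i.castSucc ≤ γ i) ∧ (∀ i, γ i ≤ β i.succ) ∧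
      numerator β p = ∏ i, (Polynomial.X - Polynomial.C (γ i)) := by
  choose γ hγ hroot using exists_root_between hβ hp
  refine ⟨γ, fun i => (hγ i).1.le, fun i => (hγ i).2.le, ?_⟩
  have hmono : StrictMono γ := by
    intro i j hij
    refine (hγ i).2.trans_le (le_trans (hβ.monotone ?_) (hγ j).1.le)
    rw [Fin.le_def]
    simpa using hij
  set q : Polynomial ℝ := ∏ i, (Polynomial.X - Polynomial.C (γ i)) with hq
  have hqd : q.natDegree = n := by
    rw [hq, Polynomial.natDegree_prod_of_monic _ _ fun j _ => Polynomial.monic_X_sub_C _]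
    simp
  have hqm : q.Monic := Polynomial.monic_prod_of_monic _ _ fun j _ => Polynomial.monic_X_sub_C _
  have hnd : (numerator β p).natDegree ≤ n := by
    apply Polynomial.natDegree_sum_le_of_forall_le
    intro k _
    refine (Polynomial.natDegree_C_mul_le _ _).trans (natDegree_numerator_term β k).le
  have hnc : (numerator β p).coeff n = 1 := by
    rw [numerator, Polynomial.finsetSum_coeff, ← hp1]
    apply Finset.sum_congr rfl
    intro k _
    have hm : (∏ j ∈ Finset.univ.erase k, (Polynomial.X - Polynomial.C (β j))).Monic :=
      Polynomial.monic_prod_of_monic _ _ fun j _ => Polynomial.monic_X_sub_C _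
    have := hm.coeff_natDegree
    rw [natDegree_numerator_term] at this
    rw [Polynomial.coeff_C_mul, this, mul_one]
  by_contra hne
  have hsub : numerator β p - q ≠ 0 := sub_ne_zero.2 hne
  have hdeg : (numerator β p - q).natDegree < n ∨ n = 0 := by
    rcases Nat.eq_zero_or_pos n with h | h
    · exact Or.inr h
    · left
      refine lt_of_le_of_ne ((Polynomial.natDegree_sub_le_of_le hnd hqd.le).trans (by simp)) ?_
      intro hn
      have hl : (numerator β p - q).leadingCoeff = 0 := by
        rw [Polynomial.leadingCoeff, hn, Polynomial.coeff_sub, hnc]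
        have := hqm.coeff_natDegree
        rw [hqd] at this
        rw [this, sub_self]
      exact hsub (Polynomial.leadingCoeff_eq_zero.1 hl)
  have hroots : ∀ i, (numerator β p - q).eval (γ i) = 0 := by
    intro i
    rw [Polynomial.eval_sub, hroot, hq, Polynomial.eval_prod,
      Finset.prod_eq_zero (Finset.mem_univ i) (by simp), sub_zero]
  rcases hdeg with hdeg | hn
  · have hcard : (Finset.univ.image γ).card ≤ (numerator β p - q).natDegree :=
      Polynomial.card_le_degree_of_subset_roots (by
        intro x hx
        have hx' : x ∈ Finset.univ.image γ := hx
        obtain ⟨i, -, rfl⟩ := Finset.mem_image.1 hx'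
        exact (Polynomial.mem_roots hsub).2 (hroots i))
    rw [Finset.card_image_of_injective _ hmono.injective, Finset.card_fin] at hcard
    omega
  · subst hn
    apply hne
    have h1 := Polynomial.eq_C_of_natDegree_le_zero hnd
    have h2 := Polynomial.eq_C_of_natDegree_le_zero hqd.le
    have h3 := hqm.coeff_natDegree
    rw [hqd] at h3
    rw [h1, h2, hnc, h3]

theorem hasDerivAt_log_one_sub_mul {a w : ℝ} (h : 1 - w * a ≠ 0) :
    HasDerivAt (fun w => Real.log (1 - w * a)) (-(a / (1 - w * a))) w := by
  have h1 : HasDerivAt (fun w : ℝ => 1 - w * a) (-a) w := by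
    have := ((hasDerivAt_id w).mul_const a).const_sub 1
    exact this.congr_deriv (by ring)
  exact (h1.log h).congr_deriv (by ring)

theorem hasDerivAt_div_one_sub_mul {a w : ℝ} (c : ℝ) (h : 1 - w * a ≠ 0) :
    HasDerivAt (fun w => c / (1 - w * a)) (c * a / (1 - w * a) ^ 2) w := by
  have h1 : HasDerivAt (fun w : ℝ => 1 - w * a) (-a) w := by
    have := ((hasDerivAt_id w).mul_const a).const_sub 1
    exact this.congr_deriv (by ring)
  exact ((hasDerivAt_const w c).div h1 h).congr_deriv (by ring)

/-- The first two power sums of poles and zeros through the moments. -/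
theorem power_sums_of_roots {n : ℕ} {β p : Fin (n + 1) → ℝ} {γ : Fin n → ℝ}
    (hp1 : ∑ i, p i = 1)
    (hroots : numerator β p = ∏ i, (Polynomial.X - Polynomial.C (γ i))) :
    ∑ i, β i ^ 2 - ∑ i, γ i ^ 2 = 2 * ∑ i, p i * β i ^ 2 - (∑ i, p i * β i) ^ 2 := by
  have hne : ∀ a : ℝ, ∀ᶠ w in 𝓝 (0 : ℝ), 0 < 1 - w * a := by
    intro a
    have : ContinuousAt (fun w : ℝ => 1 - w * a) 0 := by fun_prop
    exact this.eventually (lt_mem_nhds (by simp))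
  have hβ : ∀ᶠ w in 𝓝 (0 : ℝ), ∀ i, 0 < 1 - w * β i := eventually_all.2 fun i => hne _
  have hγ : ∀ᶠ w in 𝓝 (0 : ℝ), ∀ i, 0 < 1 - w * γ i := eventually_all.2 fun i => hne _
  -- `F` is the generating function of the moments and equals `∏ (1 - wγ) / ∏ (1 - wβ)` near `0`.
  -- Its logarithmic derivative `K` generates the differences of power sums; `F' = F K` and its
  -- derivative at `w = 0` give the identity.
  set F : ℝ → ℝ := fun w => ∑ i, p i / (1 - w * β i) with hF
  set L : ℝ → ℝ := fun w => ∑ i, Real.log (1 - w * γ i) - ∑ i, Real.log (1 - w * β i) with hL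
  set K : ℝ → ℝ := fun w => ∑ i, β i / (1 - w * β i) - ∑ i, γ i / (1 - w * γ i) with hK
  have hFL : ∀ᶠ w in 𝓝 (0 : ℝ), F w = Real.exp (L w) := by
    filter_upwards [hβ, hγ] with w h1 h2
    have hid : ∑ k, p k * ∏ j ∈ Finset.univ.erase k, (1 - w * β j) = ∏ i, (1 - w * γ i) := by
      by_cases hw : w = 0
      · simp [hw, hp1]
      · have := congrArg (Polynomial.eval w⁻¹) hroots
        rw [eval_numerator, Polynomial.eval_prod] at this
        simp only [Polynomial.eval_sub, Polynomial.eval_X, Polynomial.eval_C] at this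
        have e : ∀ a : ℝ, 1 - w * a = w * (w⁻¹ - a) := fun a => by field_simp
        simp only [e, Finset.prod_mul_distrib, Finset.prod_const, Finset.card_erase_of_mem
          (Finset.mem_univ _), Finset.card_fin]
        rw [← this, Finset.mul_sum]
        apply Finset.sum_congr rfl
        intro k _
        simp only [Nat.add_sub_cancel]
        ring
    have h3 : Real.exp (L w) = (∏ i, (1 - w * γ i)) / ∏ i, (1 - w * β i) := by
      rw [hL]
      simp only []
      rw [Real.exp_sub, Real.exp_sum, Real.exp_sum]
      congr 1
      · exact Finset.prod_congr rfl fun i _ => Real.exp_log (h2 i)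
      · exact Finset.prod_congr rfl fun i _ => Real.exp_log (h1 i)
    rw [h3, ← hid, Finset.sum_div]
    apply Finset.sum_congr rfl
    intro k _
    rw [← Finset.mul_prod_erase Finset.univ (fun j => 1 - w * β j) (Finset.mem_univ k)]
    have h4 : ∏ j ∈ Finset.univ.erase k, (1 - w * β j) ≠ 0 :=
      Finset.prod_ne_zero_iff.2 fun j _ => (h1 j).ne'
    have h5 := (h1 k).ne'
    field_simp
  have hdF : ∀ᶠ w in 𝓝 (0 : ℝ), ∑ i, p i * β i / (1 - w * β i) ^ 2 = F w * K w := by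
    filter_upwards [hFL.eventually_nhds, hβ, hγ] with w h0 h1 h2
    have d1 : HasDerivAt F (∑ i, p i * β i / (1 - w * β i) ^ 2) w :=
      HasDerivAt.fun_sum fun i _ => hasDerivAt_div_one_sub_mul (p i) (h1 i).ne'
    have d2 : HasDerivAt L (K w) w := by
      have e1 : HasDerivAt (fun w => ∑ i, Real.log (1 - w * γ i))
          (∑ i, -(γ i / (1 - w * γ i))) w :=
        HasDerivAt.fun_sum fun i _ => hasDerivAt_log_one_sub_mul (h2 i).ne'
      have e2 : HasDerivAt (fun w => ∑ i, Real.log (1 - w * β i))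
          (∑ i, -(β i / (1 - w * β i))) w :=
        HasDerivAt.fun_sum fun i _ => hasDerivAt_log_one_sub_mul (h1 i).ne'
      refine (e1.sub e2).congr_deriv ?_
      simp only [hK, Finset.sum_neg_distrib]
      ring
    have d3 := (d2.exp).congr_of_eventuallyEq h0
    rw [d1.unique d3, ← h0.self_of_nhds]
  have dL : HasDerivAt (fun w => ∑ i, p i * β i / (1 - w * β i) ^ 2)
      (∑ i, 2 * (p i * β i ^ 2)) 0 := by
    apply HasDerivAt.fun_sum
    intro i _
    have h1 : HasDerivAt (fun w : ℝ => (1 - w * β i) ^ 2) (-(2 * β i)) 0 := by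
      have := (((hasDerivAt_id (0 : ℝ)).mul_const (β i)).const_sub 1).pow 2
      exact this.congr_deriv (by simp)
    exact ((hasDerivAt_const (0 : ℝ) (p i * β i)).div h1 (by simp)).congr_deriv (by simp; ring)
  have dF : HasDerivAt F (∑ i, p i * β i) 0 := by
    have : HasDerivAt F (∑ i, p i * β i / (1 - 0 * β i) ^ 2) 0 :=
      HasDerivAt.fun_sum fun i _ => hasDerivAt_div_one_sub_mul (p i) (by simp)
    simpa using this
  have dK : HasDerivAt K (∑ i, β i ^ 2 - ∑ i, γ i ^ 2) 0 := by
    have e1 : HasDerivAt (fun w => ∑ i, β i / (1 - w * β i))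
        (∑ i, β i * β i / (1 - 0 * β i) ^ 2) 0 :=
      HasDerivAt.fun_sum fun i _ => hasDerivAt_div_one_sub_mul (β i) (by simp)
    have e2 : HasDerivAt (fun w => ∑ i, γ i / (1 - w * γ i))
        (∑ i, γ i * γ i / (1 - 0 * γ i) ^ 2) 0 :=
      HasDerivAt.fun_sum fun i _ => hasDerivAt_div_one_sub_mul (γ i) (by simp)
    refine (e1.sub e2).congr_deriv ?_
    simp [pow_two]
  have h1 := dL.unique ((dF.mul dK).congr_of_eventuallyEq hdF)
  have h2 := hdF.self_of_nhds
  have hF0 : F 0 = 1 := by simp [hF, hp1]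
  simp only [zero_mul, sub_zero, one_pow, div_one, hF0, one_mul] at h2
  rw [hF0, ← h2, ← Finset.mul_sum] at h1
  linear_combination -h1

theorem norm_sub_mk_sq (a l ε : ℝ) : ‖(⟨l, ε⟩ : ℂ) - a‖ ^ 2 = (a - l) ^ 2 + ε ^ 2 := by
  rw [← Complex.normSq_eq_norm_sq, Complex.normSq_apply]
  simp
  ring

/-- The logarithmic integral of a rational Borel transform. -/
theorem integral_log_norm_sum_ge {ε : ℝ} (hε : 0 < ε) {n : ℕ} {β p : Fin (n + 1) → ℝ}
    (hβ : StrictMono β) (hp : ∀ i, 0 < p i) (hp1 : ∑ i, p i = 1) :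
    -(2 * ∑ i, p i * β i ^ 2 - (∑ i, p i * β i) ^ 2) / 8 - freePotential ε 0 ≤
      ∫ l, Real.log ‖∑ i, (p i : ℂ) * ((β i : ℂ) - ⟨l, ε⟩)⁻¹‖ ∂freeMeasure := by
  obtain ⟨γ, h1, h2, hroots⟩ := exists_interlacing_roots hβ hp hp1
  have hz : ∀ l a : ℝ, (⟨l, ε⟩ : ℂ) - a ≠ 0 := by
    intro l a h
    have := congrArg Complex.im h
    simp at this
    linarith
  have hlog : ∀ l a : ℝ, Real.log ‖(⟨l, ε⟩ : ℂ) - a‖ = 2⁻¹ * Real.log ((a - l) ^ 2 + ε ^ 2) := by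
    intro l a
    rw [← norm_sub_mk_sq, Real.log_pow]
    push_cast
    ring
  have key : ∀ l : ℝ, Real.log ‖∑ i, (p i : ℂ) * ((β i : ℂ) - ⟨l, ε⟩)⁻¹‖ =
      ∑ i, 2⁻¹ * Real.log ((γ i - l) ^ 2 + ε ^ 2) - ∑ i, 2⁻¹ * Real.log ((β i - l) ^ 2 + ε ^ 2) :=
        by
    intro l
    set z : ℂ := ⟨l, ε⟩ with hzdef
    have e0 := congrArg (Polynomial.aeval z) hroots
    have e1 : ∑ k, (p k : ℂ) * ∏ j ∈ Finset.univ.erase k, (z - β j) = ∏ i, (z - γ i) := by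
      simpa [numerator, map_sum, map_prod] using e0
    have e2 : ∑ i, (p i : ℂ) * ((β i : ℂ) - z)⁻¹ = -((∏ i, (z - γ i)) / ∏ i, (z - β i)) := by
      rw [← e1, Finset.sum_div, ← Finset.sum_neg_distrib]
      apply Finset.sum_congr rfl
      intro k _
      rw [← Finset.mul_prod_erase Finset.univ (fun j => z - (β j : ℂ)) (Finset.mem_univ k)]
      have h4 : ∏ j ∈ Finset.univ.erase k, (z - (β j : ℂ)) ≠ 0 :=
        Finset.prod_ne_zero_iff.2 fun j _ => hz l _
      have h5 : z - (β k : ℂ) ≠ 0 := hz l _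
      have h6 : (β k : ℂ) - z ≠ 0 := by
        rw [← neg_sub]
        exact neg_ne_zero.2 h5
      field_simp
      ring
    rw [e2, norm_neg, norm_div, Complex.norm_prod, Complex.norm_prod, Real.log_div, Real.log_prod,
      Real.log_prod]
    · simp only [hzdef, hlog]
    · exact fun i _ => norm_ne_zero_iff.2 (hz l _)
    · exact fun i _ => norm_ne_zero_iff.2 (hz l _)
    · exact Finset.prod_ne_zero_iff.2 fun i _ => norm_ne_zero_iff.2 (hz l _)
    · exact Finset.prod_ne_zero_iff.2 fun i _ => norm_ne_zero_iff.2 (hz l _)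
  have hi : ∀ a, Integrable (fun l => 2⁻¹ * Real.log ((a - l) ^ 2 + ε ^ 2)) freeMeasure :=
    fun a => integrable_freeMeasure (continuous_log_sq_add hε a)
  simp only [key]
  rw [integral_sub (integrable_finsetSum _ fun i _ => hi _)
      (integrable_finsetSum _ fun i _ => hi _),
    integral_finsetSum _ fun i _ => hi _, integral_finsetSum _ fun i _ => hi _]
  have hU : ∀ x, ∫ l, 2⁻¹ * Real.log ((x - l) ^ 2 + ε ^ 2) ∂freeMeasure =
      x ^ 2 / 8 + freePotential ε 0 - potentialDefect ε x := fun x => by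
    rw [potentialDefect, freePotential, freePotential]
    ring
  -- The defect enters with a plus sign at the poles and a minus sign at the zeros, so interlacing
  -- allows it to be dropped. There is one pole more than zeros, whence the single `-freePotential ε
  -- 0`.
  have hE := sum_le_sum_of_interlacing (potentialDefect_zero ε) (monotoneOn_potentialDefect hε)
    (antitoneOn_potentialDefect hε) h1 h2
  have hS := power_sums_of_roots hp1 hroots
  simp only [hU, Finset.sum_sub_distrib, Finset.sum_add_distrib, Finset.sum_const, Finset.card_fin,
    nsmul_eq_mul, ← Finset.sum_div]
  push_cast
  linarith

end LogBound

/-! ### Passage from rational to general Borel transforms -/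

section BorelTransform

variable (μ : Measure ℝ)

theorem norm_inv_ofReal_sub_le {z : ℂ} (hz : 0 < z.im) (x : ℝ) : ‖((x : ℂ) - z)⁻¹‖ ≤ z.im⁻¹ := by
  rw [norm_inv]
  apply inv_anti₀ hz
  have := Complex.abs_im_le_norm ((x : ℂ) - z)
  rw [Complex.sub_im, Complex.ofReal_im, zero_sub, abs_neg, abs_of_pos hz] at this
  exact this

theorem integrable_inv_ofReal_sub [IsFiniteMeasure μ] {z : ℂ} (hz : 0 < z.im) :
    Integrable (fun x : ℝ => ((x : ℂ) - z)⁻¹) μ :=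
  Integrable.of_bound (continuous_inv_ofReal_sub hz).aestronglyMeasurable _
    (Eventually.of_forall (norm_inv_ofReal_sub_le hz))

theorem norm_borelTransform_le [IsProbabilityMeasure μ] {z : ℂ} (hz : 0 < z.im) :
    ‖borelTransform μ z‖ ≤ z.im⁻¹ := by
  have := norm_integral_le_of_norm_le_const (μ := μ)
    (Eventually.of_forall (norm_inv_ofReal_sub_le hz))
  simpa [borelTransform] using this

theorem im_inv_ofReal_sub (z : ℂ) (x : ℝ) :
    (((x : ℂ) - z)⁻¹).im = z.im / ((x - z.re) ^ 2 + z.im ^ 2) := by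
  rw [Complex.inv_im, Complex.normSq_apply]
  simp only [Complex.sub_re, Complex.ofReal_re, Complex.sub_im, Complex.ofReal_im, zero_sub]
  congr 1 <;> ring

theorem im_borelTransform [IsFiniteMeasure μ] {z : ℂ} (hz : 0 < z.im) :
    (borelTransform μ z).im = ∫ x, z.im / ((x - z.re) ^ 2 + z.im ^ 2) ∂μ := by
  rw [borelTransform, ← Complex.imCLM_apply,
    ← ContinuousLinearMap.integral_comp_comm _ (integrable_inv_ofReal_sub μ hz)]
  simp only [Complex.imCLM_apply, im_inv_ofReal_sub]

theorem integrable_im_kernel [IsFiniteMeasure μ] {z : ℂ} (hz : 0 < z.im) :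
    Integrable (fun x : ℝ => z.im / ((x - z.re) ^ 2 + z.im ^ 2)) μ := by
  have := (integrable_inv_ofReal_sub μ hz).im
  refine this.congr (Eventually.of_forall fun x => ?_)
  exact im_inv_ofReal_sub z x

theorem le_im_borelTransform [IsProbabilityMeasure μ] {C : ℝ} (hC : ∀ᵐ x ∂μ, |x| ≤ C) {z : ℂ}
    (hz : 0 < z.im) {B : ℝ} (hB : |z.re| ≤ B) :
    z.im / ((C + B) ^ 2 + z.im ^ 2) ≤ (borelTransform μ z).im := by
  rw [im_borelTransform μ hz]
  have h1 : ∫ _, z.im / ((C + B) ^ 2 + z.im ^ 2) ∂μ ≤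
      ∫ x, z.im / ((x - z.re) ^ 2 + z.im ^ 2) ∂μ := by
    apply integral_mono_ae (integrable_const _) (integrable_im_kernel μ hz)
    filter_upwards [hC] with x hx
    have h2 : |x - z.re| ≤ C + B := (abs_sub _ _).trans (add_le_add hx hB)
    have h3 : (x - z.re) ^ 2 ≤ (C + B) ^ 2 := by
      rw [← sq_abs (x - z.re)]
      exact pow_le_pow_left₀ (abs_nonneg _) h2 2
    apply div_le_div_of_nonneg_left hz.le (by positivity)
    linarith
  simpa using h1

theorem continuous_borelTransform [IsFiniteMeasure μ] {ε : ℝ} (hε : 0 < ε) :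
    Continuous fun l : ℝ => borelTransform μ ⟨l, ε⟩ := by
  unfold borelTransform
  have hz : ∀ l : ℝ, 0 < (⟨l, ε⟩ : ℂ).im := fun l => hε
  have hmk : Continuous fun l : ℝ => (⟨l, ε⟩ : ℂ) := by
    have : (fun l : ℝ => (⟨l, ε⟩ : ℂ)) = fun l : ℝ => (l : ℂ) + ε * Complex.I := by
      ext l
      exact Complex.mk_eq_add_mul_I l ε
    rw [this]
    fun_prop
  refine continuous_of_dominated (bound := fun _ => ε⁻¹)
    (fun l => (continuous_inv_ofReal_sub (hz l)).aestronglyMeasurable)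
    (fun l => Eventually.of_forall (norm_inv_ofReal_sub_le (hz l))) (integrable_const _)
    (Eventually.of_forall fun x => ?_)
  exact Continuous.inv₀ (by fun_prop) fun l => ofReal_sub_ne_zero (hz l) x

theorem integral_comp_simpleFunc {F : Type*} [NormedAddCommGroup F] [NormedSpace ℝ F]
    [CompleteSpace F] [IsFiniteMeasure μ] (φ : SimpleFunc ℝ ℝ) (g : ℝ → F) :
    ∫ x, g (φ x) ∂μ = ∑ a ∈ φ.range, μ.real (φ ⁻¹' {a}) • g a := by
  have e : ∀ x, g (φ x) = ∑ a ∈ φ.range, (φ ⁻¹' {a}).indicator (fun _ => g a) x := by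
    intro x
    rw [Finset.sum_eq_single (φ x)]
    · simp
    · intro b _ hb
      rw [Set.indicator_of_notMem]
      intro h
      exact hb (by simpa using h.symm)
    · intro h
      exact absurd (SimpleFunc.mem_range_self φ x) h
  simp only [e]
  rw [integral_finsetSum]
  · apply Finset.sum_congr rfl
    intro a _
    rw [integral_indicator_const _ (φ.measurableSet_fiber a)]
  · intro a _
    exact (integrable_const _).indicator (φ.measurableSet_fiber a)

theorem sum_orderEmbOfFin {F : Type*} [AddCommMonoid F] {s : Finset ℝ} {n : ℕ} (h : s.card = n)
    (f : ℝ → F) : ∑ i, f (s.orderEmbOfFin h i) = ∑ a ∈ s, f a := by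
  conv_rhs => rw [← Finset.map_orderEmbOfFin_univ s h, Finset.sum_map]
  rfl

/-- The image of `μ` under a simple function is a finite sum of atoms, so the rational case applies
once the values are listed in increasing order. -/
theorem integral_log_norm_simpleFunc_ge [IsProbabilityMeasure μ] (φ : SimpleFunc ℝ ℝ) {ε : ℝ}
    (hε : 0 < ε) :
    -(2 * ∫ x, φ x ^ 2 ∂μ - (∫ x, φ x ∂μ) ^ 2) / 8 - freePotential ε 0 ≤
      ∫ l, Real.log ‖∫ x, ((φ x : ℂ) - ⟨l, ε⟩)⁻¹ ∂μ‖ ∂freeMeasure := by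
  set p : ℝ → ℝ := fun a => μ.real (φ ⁻¹' {a}) with hp
  -- Values of zero mass are discarded, since interlacing needs strictly positive weights.
  set s : Finset ℝ := φ.range.filter fun a => p a ≠ 0 with hs
  have hsum : ∀ {F : Type} [NormedAddCommGroup F] [NormedSpace ℝ F] [CompleteSpace F] (g : ℝ → F),
      ∫ x, g (φ x) ∂μ = ∑ a ∈ s, p a • g a := by
    intro F _ _ _ g
    rw [integral_comp_simpleFunc, hs, Finset.sum_filter_of_ne]
    intro a _ h h0
    exact h (by rw [← hp] at *; rw [h0, zero_smul])
  have h1 : ∑ a ∈ s, p a = 1 := by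
    have := hsum fun _ => (1 : ℝ)
    simp only [integral_const, smul_eq_mul, mul_one, probReal_univ] at this
    exact this.symm
  have hne : s.Nonempty := by
    rw [Finset.nonempty_iff_ne_empty]
    intro h
    simp [h] at h1
  obtain ⟨n, hn⟩ : ∃ n, s.card = n + 1 := ⟨s.card - 1, by have := hne.card_pos; omega⟩
  have hpos : ∀ i, 0 < p (s.orderEmbOfFin hn i) := by
    intro i
    exact lt_of_le_of_ne measureReal_nonneg
      (Ne.symm (Finset.mem_filter.1 (s.orderEmbOfFin_mem hn i)).2)
  have h := integral_log_norm_sum_ge hε (β := s.orderEmbOfFin hn)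
    (p := fun i => p (s.orderEmbOfFin hn i)) (s.orderEmbOfFin hn).strictMono hpos
    (by rw [sum_orderEmbOfFin hn p, h1])
  rw [sum_orderEmbOfFin hn fun a => p a * a ^ 2, sum_orderEmbOfFin hn fun a => p a * a] at h
  rw [hsum fun x => x ^ 2, hsum fun x => x]
  refine h.trans (le_of_eq ?_)
  congr 1
  ext l
  rw [hsum fun x => ((x : ℂ) - ⟨l, ε⟩)⁻¹,
    sum_orderEmbOfFin hn fun a => (p a : ℂ) * ((a : ℂ) - ⟨l, ε⟩)⁻¹]
  simp only [Complex.real_smul]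

theorem tendsto_integral_comp_simpleFunc {F : Type*} [NormedAddCommGroup F] [NormedSpace ℝ F]
    [SecondCountableTopology F] [IsFiniteMeasure μ] {φ : ℕ → SimpleFunc ℝ ℝ} {C : ℝ}
    (hmem : ∀ n x, |φ n x| ≤ C) (hlim : ∀ᵐ x ∂μ, Tendsto (fun n => φ n x) atTop (𝓝 x))
    {g : ℝ → F} (hg : Continuous g) :
    Tendsto (fun n => ∫ x, g (φ n x) ∂μ) atTop (𝓝 (∫ x, g x ∂μ)) := by
  obtain ⟨D, hD⟩ := (isCompact_Icc (a := -C) (b := C)).exists_bound_of_continuousOn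
    hg.continuousOn
  apply tendsto_integral_of_dominated_convergence (fun _ => D)
  · intro n
    exact (hg.stronglyMeasurable.comp_measurable (φ n).measurable).aestronglyMeasurable
  · exact integrable_const _
  · intro n
    exact Eventually.of_forall fun x => hD _ (abs_le.1 (hmem n x))
  · filter_upwards [hlim] with x hx
    exact (hg.tendsto x).comp hx

/-- The logarithmic integral of the Borel transform of a probability measure with bounded support is
bounded below in terms of the first two moments. -/
theorem integral_log_norm_borelTransform_ge [IsProbabilityMeasure μ] {C : ℝ}
    (hC : ∀ᵐ x ∂μ, |x| ≤ C) {ε : ℝ} (hε : 0 < ε) :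
    -(2 * ∫ x, x ^ 2 ∂μ - (∫ x, x ∂μ) ^ 2) / 8 - freePotential ε 0 ≤
      ∫ l, Real.log ‖borelTransform μ ⟨l, ε⟩‖ ∂freeMeasure := by
  have hC0 : 0 ≤ C := by
    obtain ⟨x, hx⟩ := hC.exists
    exact (abs_nonneg x).trans hx
  have h0 : (0 : ℝ) ∈ Set.Icc (-C) C := ⟨by linarith, hC0⟩
  obtain ⟨φ, hmem, hlim⟩ : ∃ φ : ℕ → SimpleFunc ℝ ℝ, (∀ n x, |φ n x| ≤ C) ∧
      ∀ᵐ x ∂μ, Tendsto (fun n => φ n x) atTop (𝓝 x) := by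
    refine ⟨fun n => SimpleFunc.approxOn (fun x : ℝ => x) measurable_id (Set.Icc (-C) C) 0 h0 n,
      fun n x => abs_le.2 (SimpleFunc.approxOn_mem (f := fun x : ℝ => x) measurable_id h0 n x), ?_⟩
    filter_upwards [hC] with x hx
    exact SimpleFunc.tendsto_approxOn (f := fun x : ℝ => x) measurable_id h0
      (subset_closure (abs_le.1 hx))
  have hz : ∀ l : ℝ, 0 < (⟨l, ε⟩ : ℂ).im := fun l => hε
  have hL : Tendsto (fun n => -(2 * ∫ x, φ n x ^ 2 ∂μ - (∫ x, φ n x ∂μ) ^ 2) / 8 -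
      freePotential ε 0) atTop
      (𝓝 (-(2 * ∫ x, x ^ 2 ∂μ - (∫ x, x ∂μ) ^ 2) / 8 - freePotential ε 0)) := by
    have e1 := tendsto_integral_comp_simpleFunc μ hmem hlim (continuous_pow 2)
    have e2 := tendsto_integral_comp_simpleFunc μ hmem hlim continuous_id
    exact (((e1.const_mul 2).sub (e2.pow 2)).neg.div_const 8).sub_const _
  have hm : ∀ l, Tendsto (fun n => ∫ x, ((φ n x : ℂ) - ⟨l, ε⟩)⁻¹ ∂μ) atTop
      (𝓝 (borelTransform μ ⟨l, ε⟩)) := fun l => by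
    unfold borelTransform
    exact tendsto_integral_comp_simpleFunc μ hmem hlim (continuous_inv_ofReal_sub (hz l))
  have hmap : ∀ n l, ∫ x, ((φ n x : ℂ) - ⟨l, ε⟩)⁻¹ ∂μ = borelTransform (μ.map (φ n)) ⟨l, ε⟩ := by
    intro n l
    rw [borelTransform, integral_map (φ n).measurable.aemeasurable
      (continuous_inv_ofReal_sub (hz l)).aestronglyMeasurable]
  have hprob : ∀ n, IsProbabilityMeasure (μ.map (φ n)) := fun n =>
    Measure.isProbabilityMeasure_map (φ n).measurable.aemeasurable
  have hmapC : ∀ n, ∀ᵐ x ∂(μ.map (φ n)), |x| ≤ C := by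
    intro n
    rw [ae_map_iff (φ n).measurable.aemeasurable
        (measurableSet_le continuous_abs.measurable measurable_const)]
    exact Eventually.of_forall (hmem n)
  -- A lower bound for `Im m` over the band, common to all measures carried by `[-C, C]`; with the
  -- upper bound `ε⁻¹` it dominates the logarithms.
  set c : ℝ := ε / ((C + 2 * Real.sqrt 2) ^ 2 + ε ^ 2) with hc
  have hc0 : 0 < c := by positivity
  have hbd : ∀ (ν : Measure ℝ) [IsProbabilityMeasure ν], (∀ᵐ x ∂ν, |x| ≤ C) →
      ∀ l ∈ Set.Ioo (-(2 * Real.sqrt 2)) (2 * Real.sqrt 2), c ≤ ‖borelTransform ν ⟨l, ε⟩‖ := by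
    intro ν _ hν l hl
    have h1 := le_im_borelTransform ν hν (hz l) (B := 2 * Real.sqrt 2) (abs_le.2 ⟨hl.1.le, hl.2.le⟩)
    exact h1.trans ((le_abs_self _).trans (Complex.abs_im_le_norm _))
  have hR : Tendsto (fun n => ∫ l, Real.log ‖∫ x, ((φ n x : ℂ) - ⟨l, ε⟩)⁻¹ ∂μ‖ ∂freeMeasure) atTop
      (𝓝 (∫ l, Real.log ‖borelTransform μ ⟨l, ε⟩‖ ∂freeMeasure)) := by
    apply tendsto_integral_of_dominated_convergence (fun _ => |Real.log c| + |Real.log ε⁻¹|)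
    · intro n
      simp only [hmap]
      exact (Real.measurable_log.comp
        (continuous_borelTransform _ hε).norm.measurable).aestronglyMeasurable
    · exact integrable_const _
    · intro n
      filter_upwards [ae_mem_band] with l hl
      rw [hmap]
      have h1 := hbd _ (hmapC n) l hl
      have h2 : ‖borelTransform (μ.map (φ n)) ⟨l, ε⟩‖ ≤ ε⁻¹ := norm_borelTransform_le _ (hz l)
      have h3 := Real.log_le_log hc0 h1
      have h4 := Real.log_le_log (hc0.trans_le h1) h2
      rw [Real.norm_eq_abs, abs_le]
      constructor
      · linarith [neg_abs_le (Real.log c), abs_nonneg (Real.log ε⁻¹)]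
      · linarith [le_abs_self (Real.log ε⁻¹), abs_nonneg (Real.log c)]
    · filter_upwards [ae_mem_band] with l hl
      have h1 := hbd μ hC l hl
      exact ((Real.continuousAt_log (hc0.trans_le h1).ne').tendsto).comp (hm l).norm
  exact le_of_tendsto_of_tendsto' hL hR fun n => integral_log_norm_simpleFunc_ge μ (φ n) hε

end BorelTransform

/-! ### A variational lower bound for the relative entropy -/

section Entropy

/-- The measure `τ` dominates, with constant `c`, the geometric means of continuous functions with
respect to the semicircle measure. -/
def DominatesGeomMean (τ : Measure ℝ) (c : ℝ) : Prop :=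
  ∀ f : ℝ → ℝ, Continuous f → ∀ a b : ℝ, 0 < a → (∀ x, a ≤ f x ∧ f x ≤ b) →
    c * Real.exp (∫ x, Real.log (f x) ∂freeMeasure) ≤ ∫ x, f x ∂τ

theorem abs_log_sub_log_le {a x y : ℝ} (ha : 0 < a) (hx : a ≤ x) (hy : a ≤ y) :
    |Real.log x - Real.log y| ≤ |x - y| / a := by
  have key : ∀ {x y : ℝ}, a ≤ x → a ≤ y → Real.log x - Real.log y ≤ |x - y| / a := by
    intro x y hx hy
    have hx0 := ha.trans_le hx
    have hy0 := ha.trans_le hy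
    rw [← Real.log_div hx0.ne' hy0.ne']
    refine (Real.log_le_sub_one_of_pos (by positivity)).trans ?_
    have h1 : x / y - 1 = (x - y) / y := by field_simp
    rw [h1]
    calc (x - y) / y ≤ |x - y| / y := by gcongr; exact le_abs_self _
      _ ≤ |x - y| / a := by gcongr
  rw [abs_le]
  constructor
  · have := key hy hx
    rw [abs_sub_comm] at this
    linarith
  · exact key hx hy

/-- Continuous functions are dense in `L¹` of `τ + freeMeasure`. Clamping an approximant to `[a, b]`
does not increase the error, and there the logarithm is Lipschitz with constant `1/a`, so both sides
pass to the limit. -/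
theorem DominatesGeomMean.of_measurable {τ : Measure ℝ} [IsFiniteMeasure τ] {c : ℝ}
    (h : DominatesGeomMean τ c) (hc : 0 ≤ c) {f : ℝ → ℝ} (hf : Measurable f) {a b : ℝ} (ha : 0 < a)
    (hfab : ∀ x, a ≤ f x ∧ f x ≤ b) :
    c * Real.exp (∫ x, Real.log (f x) ∂freeMeasure) ≤ ∫ x, f x ∂τ := by
  have hab : a ≤ b := (hfab 0).1.trans (hfab 0).2
  set μ : Measure ℝ := τ + freeMeasure with hμ
  have hτμ : τ ≤ μ := Measure.le_add_right le_rfl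
  have hwμ : freeMeasure ≤ μ := Measure.le_add_left le_rfl
  have hbd : ∀ {g : ℝ → ℝ}, (∀ x, a ≤ g x ∧ g x ≤ b) → ∀ x, ‖g x‖ ≤ b := fun hg x => by
    rw [Real.norm_eq_abs, abs_of_pos (ha.trans_le (hg x).1)]
    exact (hg x).2
  have hint : ∀ {g : ℝ → ℝ} (ν : Measure ℝ) [IsFiniteMeasure ν], Measurable g →
      (∀ x, a ≤ g x ∧ g x ≤ b) → Integrable g ν := fun ν _ hg hgab =>
    Integrable.of_bound hg.aestronglyMeasurable b (Eventually.of_forall (hbd hgab))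
  have hlint : ∀ {g : ℝ → ℝ}, Measurable g → (∀ x, a ≤ g x ∧ g x ≤ b) →
      Integrable (fun x => Real.log (g x)) freeMeasure := fun hg hgab => by
    refine Integrable.of_bound (Real.measurable_log.comp hg).aestronglyMeasurable
      (|Real.log a| + |Real.log b|) (Eventually.of_forall fun x => ?_)
    have h1 := Real.log_le_log ha (hgab x).1
    have h2 := Real.log_le_log (ha.trans_le (hgab x).1) (hgab x).2
    rw [Real.norm_eq_abs, abs_le]
    constructor
    · linarith [neg_abs_le (Real.log a), abs_nonneg (Real.log b)]
    · linarith [le_abs_self (Real.log b), abs_nonneg (Real.log a)]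
  have key : ∀ n : ℕ, c * Real.exp (∫ x, Real.log (f x) ∂freeMeasure - 1 / (n + 1) / a) ≤
      ∫ x, f x ∂τ + 1 / (n + 1) := by
    intro n
    obtain ⟨g₀, hg₀, hg₀i⟩ := (hint μ hf hfab).exists_boundedContinuous_integral_sub_le
      (ε := 1 / (n + 1)) (by positivity)
    set g : ℝ → ℝ := fun x => max a (min b (g₀ x)) with hg
    have hgc : Continuous g := by fun_prop
    have hgab : ∀ x, a ≤ g x ∧ g x ≤ b := fun x =>
      ⟨le_max_left _ _, max_le hab (min_le_left _ _)⟩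
    have hdiff : ∀ x, |f x - g x| ≤ ‖f x - g₀ x‖ := by
      intro x
      have h1 : f x = max a (min b (f x)) := by
        rw [min_eq_right (hfab x).2, max_eq_right (hfab x).1]
      conv_lhs => rw [h1]
      refine (abs_max_sub_max_le_max _ _ _ _).trans ?_
      rw [sub_self, abs_zero]
      refine max_le (abs_nonneg _) ((abs_min_sub_min_le_max _ _ _ _).trans ?_)
      simp
    have hdi : Integrable (fun x => |f x - g x|) μ :=
      ((hint μ hf hfab).sub (hint μ hgc.measurable hgab)).abs
    have hle : ∫ x, |f x - g x| ∂μ ≤ 1 / (n + 1) := by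
      refine le_trans ?_ hg₀
      exact integral_mono hdi ((hint μ hf hfab).sub hg₀i).norm hdiff
    have hτ : ∫ x, |f x - g x| ∂τ ≤ 1 / (n + 1) :=
      (integral_mono_measure hτμ (Eventually.of_forall fun x => abs_nonneg _) hdi).trans hle
    have hw : ∫ x, |f x - g x| ∂freeMeasure ≤ 1 / (n + 1) :=
      (integral_mono_measure hwμ (Eventually.of_forall fun x => abs_nonneg _) hdi).trans hle
    have h1 : ∫ x, g x ∂τ ≤ ∫ x, f x ∂τ + 1 / (n + 1) := by
      have h2 : ∫ x, g x ∂τ - ∫ x, f x ∂τ ≤ ∫ x, |f x - g x| ∂τ := by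
        rw [← integral_sub (hint τ hgc.measurable hgab) (hint τ hf hfab)]
        apply integral_mono ((hint τ hgc.measurable hgab).sub (hint τ hf hfab))
          (hdi.mono_measure hτμ)
        intro x
        simp only [Pi.sub_apply]
        rw [abs_sub_comm]
        exact le_abs_self _
      linarith
    have h2 : ∫ x, Real.log (f x) ∂freeMeasure - 1 / (n + 1) / a ≤
        ∫ x, Real.log (g x) ∂freeMeasure := by
      have h3 : ∫ x, Real.log (f x) ∂freeMeasure - ∫ x, Real.log (g x) ∂freeMeasure ≤
          ∫ x, |f x - g x| / a ∂freeMeasure := by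
        rw [← integral_sub (hlint hf hfab) (hlint hgc.measurable hgab)]
        apply integral_mono ((hlint hf hfab).sub (hlint hgc.measurable hgab))
          ((hdi.mono_measure hwμ).div_const a)
        intro x
        exact (le_abs_self _).trans (abs_log_sub_log_le ha (hfab x).1 (hgab x).1)
      rw [integral_div] at h3
      have h4 : (∫ x, |f x - g x| ∂freeMeasure) / a ≤ 1 / (n + 1) / a := by gcongr
      linarith
    calc _ ≤ c * Real.exp (∫ x, Real.log (g x) ∂freeMeasure) := by gcongr
      _ ≤ ∫ x, g x ∂τ := h g hgc a b ha hgab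
      _ ≤ _ := h1
  have h0 := tendsto_one_div_add_atTop_nhds_zero_nat (𝕜 := ℝ)
  have hL : Tendsto (fun n : ℕ =>
      c * Real.exp (∫ x, Real.log (f x) ∂freeMeasure - 1 / (n + 1) / a)) atTop
      (𝓝 (c * Real.exp (∫ x, Real.log (f x) ∂freeMeasure - 0 / a))) :=
    ((Real.continuous_exp.tendsto _).comp ((h0.div_const a).const_sub _)).const_mul c
  have hR := h0.const_add (∫ x, f x ∂τ)
  rw [zero_div, sub_zero] at hL
  rw [add_zero] at hR
  exact le_of_tendsto_of_tendsto' hL hR key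

variable (τ : Measure ℝ)

/-- The density of the absolutely continuous part relative to the semicircle density. -/
noncomputable def realDensity (x : ℝ) : ℝ := (τ.rnDeriv volume x).toReal / freeDensity x

theorem realDensity_nonneg (x : ℝ) : 0 ≤ realDensity τ x :=
  div_nonneg ENNReal.toReal_nonneg (freeDensity_nonneg x)

theorem measurable_realDensity : Measurable (realDensity τ) :=
  (Measure.measurable_rnDeriv _ _).ennreal_toReal.div measurable_freeDensity

theorem freeDensity_mul_realDensity_le (x : ℝ) :
    freeDensity x * realDensity τ x ≤ (τ.rnDeriv volume x).toReal := by
  by_cases hx : freeDensity x = 0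
  · rw [hx, zero_mul]
    exact ENNReal.toReal_nonneg
  · rw [realDensity, mul_div_cancel₀ _ hx]

theorem integrable_realDensity [IsFiniteMeasure τ] : Integrable (realDensity τ) freeMeasure := by
  have h : freeMeasure = volume.withDensity
      (fun x => (((freeDensity x).toNNReal : NNReal) : ℝ≥0∞)) := rfl
  rw [h, integrable_withDensity_iff_integrable_smul measurable_freeDensity.real_toNNReal]
  refine Integrable.mono' (Measure.integrable_toReal_rnDeriv (μ := τ) (ν := volume))
    (measurable_freeDensity.real_toNNReal.smul (measurable_realDensity τ)).aestronglyMeasurable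
    (Eventually.of_forall fun x => ?_)
  rw [NNReal.smul_def, Real.coe_toNNReal _ (freeDensity_nonneg x), smul_eq_mul, Real.norm_eq_abs,
    abs_of_nonneg (mul_nonneg (freeDensity_nonneg x) (realDensity_nonneg τ x))]
  exact freeDensity_mul_realDensity_le τ x

theorem integral_realDensity_le [IsFiniteMeasure τ] :
    ∫ x, realDensity τ x ∂freeMeasure ≤ τ.real Set.univ := by
  rw [integral_freeMeasure_eq]
  have h1 : ∫ x, freeDensity x • realDensity τ x ≤ ∫ x, (τ.rnDeriv volume x).toReal := by
    apply integral_mono_of_nonneg (Eventually.of_forall fun x =>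
      mul_nonneg (freeDensity_nonneg x) (realDensity_nonneg τ x))
      Measure.integrable_toReal_rnDeriv
    exact Eventually.of_forall (freeDensity_mul_realDensity_le τ)
  refine h1.trans ?_
  have := Measure.setIntegral_toReal_rnDeriv_le (μ := τ) (ν := volume) (s := Set.univ)
    (measure_ne_top _ _)
  rwa [setIntegral_univ] at this

/-- The optimal test function is the inverse of the relative density `ρ`. Here `ρ` is clamped to
`[κ, Λ]`, and the inverse is used only on a set `A` that misses the singular part of `τ` and carries
`freeMeasure`; elsewhere the test function is the minimal value `1/Λ`. Its integral against `τ` is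
at most `1 + 2T/Λ`, where `T` is the mass of `τ`. -/
theorem DominatesGeomMean.log_le_integral_clamp {τ : Measure ℝ} [IsFiniteMeasure τ] {c : ℝ}
    (h : DominatesGeomMean τ c) (hc : 0 < c) {κ Λ : ℝ} (hκ : 0 < κ) (hκΛ : κ ≤ Λ) :
    Real.log c - 2 * τ.real Set.univ / Λ ≤
      ∫ x, Real.log (max κ (min Λ (realDensity τ x))) ∂freeMeasure := by
  set T := τ.real Set.univ with hT
  have hΛ : 0 < Λ := hκ.trans_le hκΛ
  obtain ⟨S, hS, hSsing, hSvol⟩ := Measure.mutuallySingular_singularPart τ volume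
  set ρ := realDensity τ with hρ
  have hρm : Measurable ρ := measurable_realDensity τ
  set A : Set ℝ := S ∩ Set.Ioo (-(2 * Real.sqrt 2)) (2 * Real.sqrt 2) with hA
  have hAm : MeasurableSet A := hS.inter measurableSet_Ioo
  set D : ℝ → ℝ := fun x => max κ (min Λ (ρ x)) with hD
  have hDm : Measurable D := measurable_const.max (measurable_const.min hρm)
  have hD1 : ∀ x, κ ≤ D x := fun x => le_max_left _ _
  have hD2 : ∀ x, D x ≤ Λ := fun x => max_le hκΛ (min_le_left _ _)
  set g : ℝ → ℝ := fun x => (D x)⁻¹ with hg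
  have hgm : Measurable g := hDm.inv
  have hg1 : ∀ x, Λ⁻¹ ≤ g x := fun x => inv_anti₀ (hκ.trans_le (hD1 x)) (hD2 x)
  have hg2 : ∀ x, g x ≤ κ⁻¹ := fun x => inv_anti₀ hκ (hD1 x)
  have hg0 : ∀ x, 0 < g x := fun x => (inv_pos.2 hΛ).trans_le (hg1 x)
  classical
  set f : ℝ → ℝ := A.piecewise g fun _ => Λ⁻¹ with hf
  have hfm : Measurable f := Measurable.piecewise hAm hgm measurable_const
  have hfab : ∀ x, Λ⁻¹ ≤ f x ∧ f x ≤ κ⁻¹ := by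
    intro x
    by_cases hx : x ∈ A
    · simp only [hf, Set.piecewise_eq_of_mem _ _ _ hx]
      exact ⟨hg1 x, hg2 x⟩
    · simp only [hf, Set.piecewise_eq_of_notMem _ _ _ hx]
      exact ⟨le_rfl, inv_anti₀ hκ hκΛ⟩
  have key := h.of_measurable hc.le hfm (inv_pos.2 hΛ) hfab
  -- the left-hand side
  have hae : ∀ᵐ x ∂freeMeasure, x ∈ A := by
    have h1 : ∀ᵐ x ∂freeMeasure, x ∈ S :=
      ((Measure.absolutelyContinuous_of_le freeMeasure_le).trans
        (Measure.absolutelyContinuous_of_le Measure.restrict_le_self)).ae_le (by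
          rw [mem_ae_iff]
          exact hSvol)
    filter_upwards [h1, ae_mem_band] with x hx1 hx2
    exact ⟨hx1, hx2⟩
  have hlog : ∫ x, Real.log (f x) ∂freeMeasure = -∫ x, Real.log (D x) ∂freeMeasure := by
    rw [← integral_neg]
    apply integral_congr_ae
    filter_upwards [hae] with x hx
    simp only [hf, Set.piecewise_eq_of_mem _ _ _ hx, hg, Real.log_inv]
  -- the right-hand side
  have hgint : Integrable g τ := Integrable.of_bound hgm.aestronglyMeasurable κ⁻¹
    (Eventually.of_forall fun x => by
      rw [Real.norm_eq_abs, abs_of_pos (hg0 x)]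
      exact hg2 x)
  have hsplit : ∫ x, f x ∂τ ≤ ∫ x in A, g x ∂τ + T / Λ := by
    have h1 : ∀ x, f x ≤ A.indicator g x + Λ⁻¹ := by
      intro x
      by_cases hx : x ∈ A
      · simp only [hf, Set.piecewise_eq_of_mem _ _ _ hx, Set.indicator_of_mem hx]
        linarith [inv_pos.2 hΛ]
      · simp only [hf, Set.piecewise_eq_of_notMem _ _ _ hx, Set.indicator_of_notMem hx]
        linarith
    have h2 : Integrable f τ := Integrable.of_bound hfm.aestronglyMeasurable κ⁻¹
      (Eventually.of_forall fun x => by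
        rw [Real.norm_eq_abs, abs_of_pos ((inv_pos.2 hΛ).trans_le (hfab x).1)]
        exact (hfab x).2)
    have h3 := integral_mono h2 ((hgint.indicator hAm).add (integrable_const Λ⁻¹)) h1
    simp only [Pi.add_apply] at h3
    rw [integral_add (hgint.indicator hAm) (integrable_const _), integral_indicator hAm,
      integral_const, smul_eq_mul] at h3
    rwa [div_eq_mul_inv]
  have hrestr : τ.restrict A = (volume.withDensity (τ.rnDeriv volume)).restrict A := by
    conv_lhs => rw [Measure.haveLebesgueDecomposition_add τ (volume : Measure ℝ)]
    rw [Measure.restrict_add, Measure.restrict_eq_zero.2 (measure_mono_null Set.inter_subset_left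
      hSsing), zero_add]
  have hgA : ∫ x in A, g x ∂τ = ∫ x in A, (τ.rnDeriv volume x).toReal * g x := by
    rw [hrestr, setIntegral_withDensity_eq_setIntegral_toReal_smul (Measure.measurable_rnDeriv _ _)
      (ae_restrict_of_ae (Measure.rnDeriv_lt_top τ volume)) _ hAm]
    simp only [smul_eq_mul]
  -- Below `Λ` the clamped density dominates `ρ` and the product is at most `1`; above `Λ` it is
  -- `ρ/Λ`.
  have hDρ : ∀ x, ρ x * g x ≤ 1 + ρ x / Λ := by
    intro x
    have hρ0 : 0 ≤ ρ x := realDensity_nonneg τ x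
    rcases le_total (ρ x) Λ with h1 | h1
    · have h2 : ρ x ≤ D x := by
        simp only [hD, min_eq_right h1]
        exact le_max_right _ _
      have h3 : ρ x * g x ≤ 1 := by
        simp only [hg]
        rw [← div_eq_mul_inv, div_le_one (hκ.trans_le (hD1 x))]
        exact h2
      have : 0 ≤ ρ x / Λ := by positivity
      linarith
    · have h2 : D x = Λ := by
        simp only [hD, min_eq_left h1]
        exact max_eq_right hκΛ
      simp only [hg, h2]
      rw [div_eq_mul_inv]
      linarith
  have hρint : Integrable ρ freeMeasure := integrable_realDensity τ
  have hgA' : ∫ x in A, (τ.rnDeriv volume x).toReal * g x ≤ 1 + T / Λ := by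
    have h1 : ∫ x in A, (τ.rnDeriv volume x).toReal * g x ≤ ∫ x, freeDensity x • (ρ x * g x) := by
      rw [← integral_indicator hAm]
      apply integral_mono_of_nonneg
      · refine Eventually.of_forall fun x => Set.indicator_nonneg (fun y _ => ?_) x
        exact mul_nonneg ENNReal.toReal_nonneg (hg0 y).le
      · refine Integrable.mono' ((Measure.integrable_toReal_rnDeriv (μ := τ)
          (ν := volume)).mul_const κ⁻¹)
          (measurable_freeDensity.smul (hρm.mul hgm)).aestronglyMeasurable
          (Eventually.of_forall fun x => ?_)
        rw [smul_eq_mul, ← mul_assoc, Real.norm_eq_abs, abs_of_nonneg (mul_nonneg (mul_nonneg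
          (freeDensity_nonneg x) (realDensity_nonneg τ x)) (hg0 x).le)]
        exact mul_le_mul (freeDensity_mul_realDensity_le τ x) (hg2 x) (hg0 x).le
          ENNReal.toReal_nonneg
      · refine Eventually.of_forall fun x => ?_
        by_cases hx : x ∈ A
        · simp only [Set.indicator_of_mem hx, hρ, realDensity, smul_eq_mul]
          rw [← mul_assoc, mul_div_cancel₀ _ (freeDensity_pos hx.2).ne']
        · simp only [Set.indicator_of_notMem hx, smul_eq_mul]
          exact mul_nonneg (freeDensity_nonneg x)
            (mul_nonneg (realDensity_nonneg τ x) (hg0 x).le)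
    rw [← integral_freeMeasure_eq] at h1
    refine h1.trans ?_
    have h2 : ∫ x, ρ x * g x ∂freeMeasure ≤ ∫ x, (1 + ρ x / Λ) ∂freeMeasure :=
      integral_mono_of_nonneg (Eventually.of_forall fun x =>
        mul_nonneg (realDensity_nonneg τ x) (hg0 x).le)
        ((integrable_const _).add (hρint.div_const _)) (Eventually.of_forall hDρ)
    rw [integral_add (integrable_const _) (hρint.div_const _), integral_div] at h2
    have h3 : (∫ x, ρ x ∂freeMeasure) / Λ ≤ T / Λ := by
      have := integral_realDensity_le τ
      gcongr
    simp only [integral_const, probReal_univ, smul_eq_mul, mul_one] at h2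
    linarith
  rw [hlog] at key
  -- The bound `1 + 2T/Λ` is replaced by the exponential so that taking logarithms gives a linear
  -- error.
  have hfin : c * Real.exp (-∫ x, Real.log (D x) ∂freeMeasure) ≤ Real.exp (2 * T / Λ) := by
    have h1 := Real.add_one_le_exp (2 * T / Λ)
    have h2 : 2 * T / Λ = T / Λ + T / Λ := by ring
    linarith
  have h4 := Real.log_le_log (by positivity) hfin
  rw [Real.log_mul hc.ne' (Real.exp_pos _).ne', Real.log_exp, Real.log_exp] at h4
  linarith

/-- The upper clamp is removed by `Λ = n + 1 → ∞`: the clamped logarithm is at most `log⁺ ρ` minus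
the truncated `log⁻ ρ`. The lower clamp `κ` stays so that the negative part is bounded. -/
theorem DominatesGeomMean.integral_neg_log_le {τ : Measure ℝ} [IsFiniteMeasure τ] {c : ℝ}
    (h : DominatesGeomMean τ c) (hc : 0 < c) {κ : ℝ} (hκ : 0 < κ) (hκ1 : κ ≤ 1) :
    ∫ x, -Real.log (max κ (min 1 (realDensity τ x))) ∂freeMeasure ≤
      ∫ x, Real.log (max 1 (realDensity τ x)) ∂freeMeasure - Real.log c := by
  set ρ := realDensity τ with hρ
  have hρm : Measurable ρ := measurable_realDensity τ
  have hρ0 : ∀ x, 0 ≤ ρ x := realDensity_nonneg τ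
  have i1 : Integrable (fun x => Real.log (max 1 (ρ x))) freeMeasure := by
    refine Integrable.mono' (integrable_realDensity τ)
      (Real.measurable_log.comp (measurable_const.max hρm)).aestronglyMeasurable
      (Eventually.of_forall fun x => ?_)
    have h1 : 0 ≤ Real.log (max 1 (ρ x)) := Real.log_nonneg (le_max_left _ _)
    rw [Real.norm_eq_abs, abs_of_nonneg h1]
    rcases le_total (ρ x) 1 with h2 | h2
    · rw [max_eq_left h2, Real.log_one]
      exact hρ0 x
    · rw [max_eq_right h2]
      have := Real.log_le_sub_one_of_pos (by linarith : 0 < ρ x)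
      linarith
  have i2 : Integrable (fun x => -Real.log (max κ (min 1 (ρ x)))) freeMeasure := by
    refine Integrable.of_bound (Real.measurable_log.comp
      (measurable_const.max (measurable_const.min hρm))).neg.aestronglyMeasurable (-Real.log κ)
      (Eventually.of_forall fun x => ?_)
    have h1 : Real.log (max κ (min 1 (ρ x))) ≤ 0 :=
      Real.log_nonpos (hκ.le.trans (le_max_left _ _)) (max_le hκ1 (min_le_left _ _))
    have h2 := Real.log_le_log hκ (le_max_left κ (min 1 (ρ x)))
    rw [Real.norm_eq_abs, abs_of_nonneg (by linarith)]
    linarith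
  have key : ∀ n : ℕ, Real.log c - 2 * τ.real Set.univ * (1 / (n + 1)) ≤
      ∫ x, Real.log (max 1 (ρ x)) ∂freeMeasure -
        ∫ x, -Real.log (max κ (min 1 (ρ x))) ∂freeMeasure := by
    intro n
    have hΛ : (1 : ℝ) ≤ n + 1 := by
      have : (0 : ℝ) ≤ n := Nat.cast_nonneg n
      linarith
    have h1 := h.log_le_integral_clamp hc hκ (hκ1.trans hΛ)
    rw [mul_one_div]
    refine h1.trans ?_
    rw [← integral_sub i1 i2]
    have hcl : ∀ x, 0 < max κ (min ((n : ℝ) + 1) (ρ x)) := fun x => hκ.trans_le (le_max_left _ _)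
    have hle : ∀ x, Real.log (max κ (min ((n : ℝ) + 1) (ρ x))) ≤
        Real.log (max 1 (ρ x)) - -Real.log (max κ (min 1 (ρ x))) := by
      intro x
      rcases le_total (ρ x) 1 with h2 | h2
      · rw [max_eq_left h2, Real.log_one, min_eq_right h2, min_eq_right (h2.trans hΛ)]
        linarith
      · rw [max_eq_right h2, min_eq_left h2, max_eq_right hκ1, Real.log_one, neg_zero, sub_zero]
        exact Real.log_le_log (hcl x) (max_le (hκ1.trans h2) (min_le_right _ _))
    refine integral_mono ?_ (i1.sub i2) hle
    refine Integrable.of_bound (Real.measurable_log.comp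
      (measurable_const.max (measurable_const.min hρm))).aestronglyMeasurable
      (|Real.log κ| + |Real.log (n + 1)|) (Eventually.of_forall fun x => ?_)
    have h3 := Real.log_le_log hκ (le_max_left κ (min ((n : ℝ) + 1) (ρ x)))
    have h4 := Real.log_le_log (hcl x) (max_le (hκ1.trans hΛ) (min_le_left _ _))
    rw [Real.norm_eq_abs, abs_le]
    constructor
    · linarith [neg_abs_le (Real.log κ), abs_nonneg (Real.log ((n : ℝ) + 1))]
    · linarith [le_abs_self (Real.log ((n : ℝ) + 1)), abs_nonneg (Real.log κ)]
  have hlim := (((tendsto_one_div_add_atTop_nhds_zero_nat (𝕜 := ℝ)).const_mul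
    (2 * τ.real Set.univ)).const_sub (Real.log c))
  rw [mul_zero, sub_zero] at hlim
  have := le_of_tendsto' hlim key
  linarith

theorem ae_relDensity_eq [SigmaFinite τ] : ∀ᵐ x ∂freeMeasure,
    τ.rnDeriv volume x / ENNReal.ofReal (freeDensity x) = ENNReal.ofReal (realDensity τ x) := by
  have h1 : ∀ᵐ x ∂freeMeasure, τ.rnDeriv volume x < ∞ :=
    ((Measure.absolutelyContinuous_of_le freeMeasure_le).trans
      (Measure.absolutelyContinuous_of_le Measure.restrict_le_self)).ae_le
      (Measure.rnDeriv_lt_top τ volume)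
  filter_upwards [h1, ae_mem_band] with x hx1 hx2
  rw [realDensity, ENNReal.ofReal_div_of_pos (freeDensity_pos hx2), ENNReal.ofReal_toReal hx1.ne]

/-- Monotone convergence along `κ = exp(-n)`. Finiteness of the limit is what excludes zeros of the
density on a set of positive measure. -/
theorem DominatesGeomMean.lintegral_neg_log_le {τ : Measure ℝ} [IsFiniteMeasure τ] {c : ℝ}
    (h : DominatesGeomMean τ c) (hc : 0 < c) :
    ∫⁻ x, (-ENNReal.log (ENNReal.ofReal (realDensity τ x))).toENNReal ∂freeMeasure ≤
      ENNReal.ofReal (∫ x, Real.log (max 1 (realDensity τ x)) ∂freeMeasure - Real.log c) := by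
  set ρ := realDensity τ with hρ
  have hρm : Measurable ρ := measurable_realDensity τ
  have hρ0 : ∀ x, 0 ≤ ρ x := realDensity_nonneg τ
  set F : ℕ → ℝ → ℝ≥0∞ := fun n x =>
    ENNReal.ofReal (-Real.log (max (Real.exp (-n)) (min 1 (ρ x)))) with hF
  have hκ1 : ∀ n : ℕ, Real.exp (-n) ≤ 1 := fun n => by simp
  have hFm : ∀ n, Measurable (F n) := fun n =>
    (Real.measurable_log.comp (measurable_const.max (measurable_const.min hρm))).neg.ennreal_ofReal
  have hmono : Monotone F := by
    intro m n hmn x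
    apply ENNReal.ofReal_le_ofReal
    apply neg_le_neg
    apply Real.log_le_log ((Real.exp_pos _).trans_le (le_max_left _ _))
    apply max_le_max_right
    apply Real.exp_le_exp.2
    have : (m : ℝ) ≤ n := by exact_mod_cast hmn
    linarith
  have hsup : ∀ x, (-ENNReal.log (ENNReal.ofReal (ρ x))).toENNReal ≤ ⨆ n, F n x := by
    intro x
    rcases (hρ0 x).eq_or_lt with h0 | h0
    · rw [eq_top_iff.2 (_ : (⊤ : ℝ≥0∞) ≤ ⨆ n, F n x)]
      · exact le_top
      -- Where `ρ = 0` the truncated value is exactly `n`, so the supremum is `∞ = -log 0`.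
      · rw [← ENNReal.iSup_natCast]
        apply iSup_mono
        intro n
        simp only [hF, ← h0]
        rw [min_eq_right zero_le_one, max_eq_left (Real.exp_pos _).le, Real.log_exp, neg_neg,
          ENNReal.ofReal_natCast]
    · rw [ENNReal.log_ofReal_of_pos h0]
      obtain ⟨n, hn⟩ := exists_nat_ge (-Real.log (ρ x))
      refine le_trans ?_ (le_iSup _ n)
      rw [← EReal.coe_neg, EReal.real_coe_toENNReal]
      apply ENNReal.ofReal_le_ofReal
      apply neg_le_neg
      apply Real.log_le_log ((Real.exp_pos _).trans_le (le_max_left _ _))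
      apply max_le _ (min_le_right _ _)
      rw [← Real.exp_log h0]
      apply Real.exp_le_exp.2
      linarith
  refine (lintegral_mono hsup).trans ?_
  rw [lintegral_iSup hFm hmono]
  apply iSup_le
  intro n
  have h1 := h.integral_neg_log_le hc (Real.exp_pos (-n)) (hκ1 n)
  have h2 : ∀ x, 0 ≤ -Real.log (max (Real.exp (-n)) (min 1 (ρ x))) := fun x => by
    have := Real.log_nonpos ((Real.exp_pos _).le.trans (le_max_left (Real.exp (-n)) (min 1 (ρ x))))
      (max_le (hκ1 n) (min_le_left _ _))
    linarith
  have i2 : Integrable (fun x => -Real.log (max (Real.exp (-n)) (min 1 (ρ x)))) freeMeasure := by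
    refine Integrable.of_bound (Real.measurable_log.comp
      (measurable_const.max (measurable_const.min hρm))).neg.aestronglyMeasurable n
      (Eventually.of_forall fun x => ?_)
    rw [Real.norm_eq_abs, abs_of_nonneg (h2 x)]
    have h3 := Real.log_le_log (Real.exp_pos _) (le_max_left (Real.exp (-n)) (min 1 (ρ x)))
    rw [Real.log_exp] at h3
    linarith
  simp only [hF]
  rw [← ofReal_integral_eq_lintegral_ofReal i2 (Eventually.of_forall h2)]
  exact ENNReal.ofReal_le_ofReal h1

/-- A measure dominating geometric means with constant `c` has relative entropy at least `log c`. -/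
theorem DominatesGeomMean.le_exp_erealIntegral {τ : Measure ℝ} [IsFiniteMeasure τ] {c : ℝ}
    (h : DominatesGeomMean τ c) (hc : 0 < c) :
    ENNReal.ofReal c ≤ EReal.exp (erealIntegral freeMeasure fun x =>
      ENNReal.log (τ.rnDeriv volume x / ENNReal.ofReal (freeDensity x))) := by
  set ρ := realDensity τ with hρ
  have hρm : Measurable ρ := measurable_realDensity τ
  have hρ0 : ∀ x, 0 ≤ ρ x := realDensity_nonneg τ
  set P : ℝ := ∫ x, Real.log (max 1 (ρ x)) ∂freeMeasure with hP
  have hlog0 : ∀ x, 0 ≤ Real.log (max 1 (ρ x)) := fun x => Real.log_nonneg (le_max_left _ _)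
  -- `log⁺ ρ ≤ ρ` is integrable, so the positive part of the entropy is finite and no `∞ - ∞`
  -- occurs.
  have i1 : Integrable (fun x => Real.log (max 1 (ρ x))) freeMeasure := by
    refine Integrable.mono' (integrable_realDensity τ)
      (Real.measurable_log.comp (measurable_const.max hρm)).aestronglyMeasurable
      (Eventually.of_forall fun x => ?_)
    rw [Real.norm_eq_abs, abs_of_nonneg (hlog0 x)]
    rcases le_total (ρ x) 1 with h2 | h2
    · rw [max_eq_left h2, Real.log_one]
      exact hρ0 x
    · rw [max_eq_right h2]
      have := Real.log_le_sub_one_of_pos (by linarith : 0 < ρ x)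
      linarith
  have hpos : ∫⁻ x, (ENNReal.log (τ.rnDeriv volume x /
      ENNReal.ofReal (freeDensity x))).toENNReal ∂freeMeasure = ENNReal.ofReal P := by
    rw [hP, ofReal_integral_eq_lintegral_ofReal i1 (Eventually.of_forall hlog0)]
    apply lintegral_congr_ae
    filter_upwards [ae_relDensity_eq τ] with x hx
    rw [hx]
    rcases le_or_gt (ρ x) 1 with h2 | h2
    · rw [max_eq_left h2, Real.log_one, ENNReal.ofReal_zero, EReal.toENNReal_of_nonpos]
      rw [ENNReal.log_le_zero_iff]
      exact ENNReal.ofReal_le_one.2 h2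
    · rw [max_eq_right h2.le, ENNReal.log_ofReal_of_pos (by linarith), EReal.real_coe_toENNReal]
  have hneg : ∫⁻ x, (-ENNReal.log (τ.rnDeriv volume x /
      ENNReal.ofReal (freeDensity x))).toENNReal ∂freeMeasure ≤
      ENNReal.ofReal (P - Real.log c) := by
    refine le_trans (le_of_eq ?_) (h.lintegral_neg_log_le hc)
    apply lintegral_congr_ae
    filter_upwards [ae_relDensity_eq τ] with x hx
    rw [hx]
  have hPc : 0 ≤ P - Real.log c := by
    have h1 := h.integral_neg_log_le hc one_pos le_rfl
    have h2 : ∀ x, max 1 (min 1 (realDensity τ x)) = 1 := fun x => max_eq_left (min_le_left _ _)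
    simpa [h2] using h1
  have hP0 : 0 ≤ P := integral_nonneg hlog0
  have h1 : (Real.log c : EReal) ≤ erealIntegral freeMeasure fun x =>
      ENNReal.log (τ.rnDeriv volume x / ENNReal.ofReal (freeDensity x)) := by
    unfold erealIntegral
    rw [hpos]
    refine le_trans (le_of_eq ?_) (EReal.sub_le_sub le_rfl
        (EReal.coe_ennreal_le_coe_ennreal_iff.2 hneg))
    rw [EReal.coe_ennreal_ofReal, EReal.coe_ennreal_ofReal, max_eq_left hP0, max_eq_left hPc,
      ← EReal.coe_sub]
    congr 1
    ring
  have h2 := EReal.exp_monotone h1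
  rwa [EReal.exp_coe, Real.exp_log hc] at h2

/-- A measure dominating geometric means has a positive density almost everywhere on the band. -/
theorem DominatesGeomMean.rnDeriv_ne_zero {τ : Measure ℝ} [IsFiniteMeasure τ] {c : ℝ}
    (h : DominatesGeomMean τ c) (hc : 0 < c) :
    ∀ᵐ x ∂(volume : Measure ℝ), x ∈ Set.Ioo (-(2 * Real.sqrt 2)) (2 * Real.sqrt 2) →
      τ.rnDeriv volume x ≠ 0 := by
  have hfin := ne_top_of_le_ne_top ENNReal.ofReal_ne_top (h.lintegral_neg_log_le hc)
  have hm : Measurable fun x => (-ENNReal.log (ENNReal.ofReal (realDensity τ x))).toENNReal := by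
    have := measurable_realDensity τ
    fun_prop
  have h1 := ae_lt_top hm hfin
  rw [freeMeasure, ae_withDensity_iff measurable_freeDensity.ennreal_ofReal] at h1
  filter_upwards [h1] with x hx hb h0
  have h2 := hx (by
    rw [Ne, ENNReal.ofReal_eq_zero, not_le]
    exact freeDensity_pos hb)
  simp [realDensity, h0] at h2

end Entropy

/-! ### Green functions of Schrödinger operators on graphs -/

section GreenFunction

variable {T : Type*} (G : SimpleGraph T) [G.LocallyFinite]
  (hG : ∃ d : ℕ, ∀ x, G.degree x ≤ d) (V : T → ℝ) (hV : ∃ C : ℝ, ∀ x, |V x| ≤ C)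

theorem schrodinger_single_apply [DecidableEq T] [DecidableRel G.Adj] (x y : T) :
    (schrodinger G hG V hV (lp.single 2 y (1 : ℂ))) x =
      (if G.Adj x y then 1 else 0) + if x = y then (V x : ℂ) else 0 := by
  rw [schrodinger_apply]
  congr 1
  · simp only [lp.single_apply, Pi.single_apply, Finset.sum_ite_eq',
      SimpleGraph.mem_neighborFinset]
  · by_cases h : x = y
    · subst h
      simp [lp.single_apply]
    · simp [lp.single_apply, h]

theorem inner_single_one [DecidableEq T] (x : T) (u : lp (fun _ : T => ℂ) 2) :
    ⟪lp.single 2 x (1 : ℂ), u⟫_ℂ = u x := by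
  rw [lp.inner_single_left]
  simp

theorem isProbabilityMeasure_spectralMeasure_single [DecidableEq T]
    {H : lp (fun _ : T => ℂ) 2 →L[ℂ] lp (fun _ : T => ℂ) 2} (hH : IsSelfAdjoint H) (x : T) :
    IsProbabilityMeasure (spectralMeasure H (lp.single 2 x (1 : ℂ))) := by
  constructor
  have h := spectralMeasure_univ H hH (lp.single 2 x (1 : ℂ))
  rw [lp.norm_single (by norm_num), norm_one, one_pow] at h
  rw [← ENNReal.toReal_eq_one_iff]
  exact h

theorem integral_id_spectralMeasure_schrodinger [DecidableEq T] (x : T) :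
    ∫ t, t ∂(spectralMeasure (schrodinger G hG V hV) (lp.single 2 x (1 : ℂ))) = V x := by
  classical
  rw [integral_id_spectralMeasure _ (isSelfAdjoint_schrodinger G hG V hV), inner_single_one,
    schrodinger_single_apply]
  simp

/-- The second moment counts closed walks of length two: once out and back along each edge, and
twice through the potential. -/
theorem integral_sq_spectralMeasure_schrodinger [DecidableEq T] (x : T) :
    ∫ t, t ^ 2 ∂(spectralMeasure (schrodinger G hG V hV) (lp.single 2 x (1 : ℂ))) =
      G.degree x + V x ^ 2 := by
  classical
  rw [integral_pow_spectralMeasure _ (isSelfAdjoint_schrodinger G hG V hV), inner_single_one,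
    pow_two, mul_apply_eq_comp, schrodinger_apply]
  have h1 : ∑ y ∈ G.neighborFinset x, (schrodinger G hG V hV (lp.single 2 x (1 : ℂ))) y =
      ∑ y ∈ G.neighborFinset x, (1 : ℂ) := by
    refine Finset.sum_congr rfl fun y hy => ?_
    rw [SimpleGraph.mem_neighborFinset] at hy
    rw [schrodinger_single_apply, if_pos hy.symm, if_neg hy.ne', add_zero]
  rw [h1, schrodinger_single_apply]
  simp [← Complex.ofReal_mul, pow_two]

/-- A solution of the resolvent equation that is homogeneous on a branch is determined on the
branch by its value at the vertex to which the branch is attached. -/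
theorem apply_of_isBranch {T' : Type*} [DecidableEq T'] (G' : SimpleGraph T') [G'.LocallyFinite]
    (hG' : ∃ d : ℕ, ∀ x, G'.degree x ≤ d) (V' : T' → ℝ) (hV' : ∃ C : ℝ, ∀ x, |V' x| ≤ C)
    {i : T' → T} (hi : Function.Injective i) (r : T') (p : T) (hVV' : ∀ x, V (i x) = V' x)
    (hn : ∀ x (u : T → ℂ), ∑ y ∈ G.neighborFinset (i x), u y =
      ∑ y ∈ G'.neighborFinset x, u (i y) + if x = r then u p else 0)
    {z : ℂ} (hz : 0 < z.im) (u : lp (fun _ : T => ℂ) 2)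
    (hu : ∀ x, (schrodinger G hG V hV u) (i x) = z * u (i x)) :
    u (i r) = -u p *
      borelTransform (spectralMeasure (schrodinger G' hG' V' hV') (lp.single 2 r (1 : ℂ))) z := by
  have hmem : Memℓp (fun x => u (i x)) 2 := by
    rw [memℓp_two_iff]
    have h1 : ∑' x, ‖u x‖ₑ ^ 2 ≠ ∞ := (memℓp_two_iff _).1 (lp.memℓp u)
    exact ne_top_of_le_ne_top h1
      (ENNReal.tsum_comp_le_tsum_of_injective hi fun x => ‖u x‖ₑ ^ 2)
  set v : lp (fun _ : T' => ℂ) 2 := ⟨fun x => u (i x), hmem⟩ with hv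
  have hvx : ∀ x, v x = u (i x) := fun _ => rfl
  -- The only link of the branch to the rest of the graph is the edge from `r` to `p`; the
  -- restriction of `u` thus solves the resolvent equation of the branch with source `-u p` at `r`.
  have key : schrodinger G' hG' V' hV' v - z • v = (-u p) • lp.single 2 r (1 : ℂ) := by
    ext x
    have h1 := hu x
    rw [schrodinger_apply, hn, hVV'] at h1
    simp only [lp.coeFn_sub, Pi.sub_apply, lp.coeFn_smul, Pi.smul_apply, smul_eq_mul,
      schrodinger_apply, hvx, lp.single_apply, Pi.single_apply]
    split_ifs at h1 ⊢ <;> linear_combination h1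
  -- Without a source the solution vanishes, as `z` is not real; otherwise it is normalised to
  -- source `1`.
  by_cases hp : u p = 0
  · rw [hp, neg_zero, zero_smul, sub_eq_zero] at key
    have h0 := IsSelfAdjoint.eq_zero_of_map_eq_smul
      (isSelfAdjoint_schrodinger G' hG' V' hV') hz key
    rw [hp, neg_zero, zero_mul, ← hvx, h0]
    rfl
  · have h2 : schrodinger G' hG' V' hV' ((-u p)⁻¹ • v) - z • ((-u p)⁻¹ • v) =
        lp.single 2 r (1 : ℂ) := by
      rw [map_smul, smul_comm, ← smul_sub, key, smul_smul, inv_mul_cancel₀ (neg_ne_zero.2 hp),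
        one_smul]
    rw [← borelTransform_of_resolvent (isSelfAdjoint_schrodinger G' hG' V' hV') hz h2,
      inner_single_one]
    simp only [lp.coeFn_smul, Pi.smul_apply, smul_eq_mul, hvx]
    rw [mul_inv_cancel_left₀ (neg_ne_zero.2 hp)]

/-- Schrödinger operators with pointwise convergent and uniformly bounded potentials converge
strongly. -/
theorem tendsto_schrodinger (K : ℕ → T → ℝ) (hK : ∀ n, ∃ C : ℝ, ∀ x, |K n x| ≤ C) {C : ℝ}
    (hC : ∀ n x, |K n x| ≤ C) (hlim : ∀ x, Tendsto (fun n => K n x) atTop (𝓝 (V x)))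
    (u : lp (fun _ : T => ℂ) 2) :
    Tendsto (fun n => schrodinger G hG (K n) (hK n) u) atTop (𝓝 (schrodinger G hG V hV u)) := by
  rw [tendsto_iff_norm_sub_tendsto_zero]
  obtain ⟨B, hB⟩ := hV
  have hsq : ∀ n, ‖schrodinger G hG (K n) (hK n) u - schrodinger G hG V ⟨B, hB⟩ u‖ ^ 2 =
      ∑' x, ((K n x - V x) ^ 2 * ‖u x‖ ^ 2) := by
    intro n
    have h := lp.hasSum_norm (p := 2) (by norm_num)
      (schrodinger G hG (K n) (hK n) u - schrodinger G hG V ⟨B, hB⟩ u)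
    simp only [ENNReal.toReal_ofNat, Real.rpow_ofNat] at h
    rw [← h.tsum_eq]
    refine tsum_congr fun x => ?_
    have : (schrodinger G hG (K n) (hK n) u - schrodinger G hG V ⟨B, hB⟩ u) x =
        ((K n x - V x : ℝ) : ℂ) * u x := by
      simp only [lp.coeFn_sub, Pi.sub_apply, schrodinger_apply]
      push_cast
      ring
    rw [this, norm_mul, mul_pow, Complex.norm_real, Real.norm_eq_abs, sq_abs]
  have hsum : Summable fun x => ‖u x‖ ^ 2 := by
    have h := (lp.hasSum_norm (p := 2) (by norm_num) u).summable
    simpa only [ENNReal.toReal_ofNat, Real.rpow_ofNat] using h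
  have hlim2 : Tendsto (fun n => ∑' x, ((K n x - V x) ^ 2 * ‖u x‖ ^ 2)) atTop
      (𝓝 (∑' _ : T, (0 : ℝ))) := by
    apply tendsto_tsum_of_dominated_convergence (hsum.mul_left ((C + B) ^ 2))
    · intro x
      have := (((hlim x).sub_const (V x)).pow 2).mul_const (‖u x‖ ^ 2)
      simpa using this
    · refine Eventually.of_forall fun n x => ?_
      rw [Real.norm_of_nonneg (by positivity)]
      gcongr ?_ * _
      rw [← sq_abs]
      exact pow_le_pow_left₀ (abs_nonneg _) ((abs_sub _ _).trans (add_le_add (hC n x) (hB x))) 2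
  rw [tsum_zero] at hlim2
  simp only [← hsq] at hlim2
  have := hlim2.sqrt
  simpa [Real.sqrt_sq (norm_nonneg _)] using this

theorem tendsto_integral_spectralMeasure_schrodinger (K : ℕ → T → ℝ)
    (hK : ∀ n, ∃ C : ℝ, ∀ x, |K n x| ≤ C) {C : ℝ} (hC : ∀ n x, |K n x| ≤ C)
    (hlim : ∀ x, Tendsto (fun n => K n x) atTop (𝓝 (V x))) (ψ : lp (fun _ : T => ℂ) 2)
    {f : ℝ → ℝ} (hf : Continuous f) :
    Tendsto (fun n => ∫ x, f x ∂(spectralMeasure (schrodinger G hG (K n) (hK n)) ψ)) atTop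
      (𝓝 (∫ x, f x ∂(spectralMeasure (schrodinger G hG V hV) ψ))) := by
  have hstrong := tendsto_schrodinger G hG V hV K hK hC hlim
  -- Strong convergence already provides the uniform norm bound.
  obtain ⟨D, hD⟩ := banach_steinhaus (g := fun n => schrodinger G hG (K n) (hK n)) fun u => by
    obtain ⟨D, hD⟩ := (hstrong u).norm.bddAbove_range
    exact ⟨D, fun n => hD ⟨n, rfl⟩⟩
  exact tendsto_integral_spectralMeasure (isSelfAdjoint_schrodinger G hG V hV)
    (fun n => isSelfAdjoint_schrodinger G hG (K n) (hK n)) hD hstrong ψ hf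

end GreenFunction

/-! ### The recursion of the Green functions on the branch and on the Bethe lattice -/

section Recursion

/-- The restriction of a function on the rooted binary tree to the branch at the child `b` of the
root, which is again a rooted binary tree. -/
def child {α : Type*} (V : List (Fin 2) → α) (b : Fin 2) (w : List (Fin 2)) : α := V (w ++ [b])

theorem bounded_child {V : List (Fin 2) → ℝ} (hV : ∃ C : ℝ, ∀ x, |V x| ≤ C) (b : Fin 2) :
    ∃ C : ℝ, ∀ x, |child V b x| ≤ C :=
  hV.imp fun _ h _ => h _

/-- The most recent letter comes first, so the subtree at the child `b` consists of the words ending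
in `b`. Only its root `[b]` has a neighbour outside, namely the empty word. -/
theorem sum_branchNeighbors_append (b : Fin 2) (x : List (Fin 2)) (u : List (Fin 2) → ℂ) :
    ∑ y ∈ branchNeighbors (x ++ [b]), u y =
      ∑ y ∈ branchNeighbors x, u (y ++ [b]) + if x = [] then u [] else 0 := by
  cases x with
  | nil =>
    have h1 : branchNeighbors ([] ++ [b]) = {[0, b], [1, b], []} := rfl
    rw [h1, branchNeighbors, Finset.sum_insert (by simp), Finset.sum_insert (by simp),
      Finset.sum_singleton, Finset.sum_pair (by simp), if_pos rfl]
    simp only [List.cons_append, List.nil_append]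
    ring
  | cons a w =>
    have h1 : branchNeighbors (a :: w ++ [b]) =
      {0 :: a :: (w ++ [b]), 1 :: a :: (w ++ [b]), w ++ [b]} := rfl
    have h2 : ∀ v : List (Fin 2),
      (0 : Fin 2) :: a :: v ∉ ({1 :: a :: v, v} : Finset (List (Fin 2))) ∧
      (1 : Fin 2) :: a :: v ∉ ({v} : Finset (List (Fin 2))) := by
      intro v
      have h3 : ∀ c : Fin 2, c :: a :: v ≠ v := fun c h => by
        have := congrArg List.length h
        simp only [List.length_cons] at this
        omega
      simp [h3]
    rw [h1, branchNeighbors, Finset.sum_insert (h2 _).1,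
      Finset.sum_insert (h2 _).2, Finset.sum_singleton,
      Finset.sum_insert (h2 _).1, Finset.sum_insert (h2 _).2,
      Finset.sum_singleton, if_neg (by simp)]
    simp

variable (V : List (Fin 2) → ℝ) (hV : ∃ C : ℝ, ∀ x, |V x| ≤ C)

instance : IsProbabilityMeasure (rootMeasure V hV) :=
  isProbabilityMeasure_spectralMeasure_single (isSelfAdjoint_branchOperator V hV) []

theorem ae_abs_le_rootMeasure : ∀ᵐ x ∂(rootMeasure V hV), |x| ≤ ‖branchOperator V hV‖ :=
  ae_abs_le_norm _ _

theorem integral_id_rootMeasure : ∫ t, t ∂(rootMeasure V hV) = V [] :=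
  integral_id_spectralMeasure_schrodinger branch branch_degree_le V hV []

theorem integral_sq_rootMeasure : ∫ t, t ^ 2 ∂(rootMeasure V hV) = 2 + V [] ^ 2 := by
  have h := integral_sq_spectralMeasure_schrodinger branch branch_degree_le V hV []
  rw [SimpleGraph.degree, branch_neighborFinset] at h
  have h2 : (branchNeighbors []).card = 2 := by decide
  rw [h2] at h
  exact_mod_cast h

/-- The Green function of the branch with potential `V` at the root. -/
noncomputable def rootGreen (z : ℂ) : ℂ := borelTransform (rootMeasure V hV) z

/-- At the root the resolvent equation reads `(V(O) - z) u(O) + u([0]) + u([1]) = 1` with `u(O) =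
m`, and `u([b]) = -m m_b` by `apply_of_isBranch`. -/
theorem rootGreen_mul {z : ℂ} (hz : 0 < z.im) :
    rootGreen V hV z * ((V [] : ℂ) - z - rootGreen (child V 0) (bounded_child hV 0) z -
      rootGreen (child V 1) (bounded_child hV 1) z) = 1 := by
  obtain ⟨u, hu, hm⟩ := exists_resolvent (branchOperator V hV) (isSelfAdjoint_branchOperator V hV)
    (lp.single 2 [] (1 : ℂ)) hz
  rw [inner_single_one] at hm
  have hx : ∀ x, (branchOperator V hV u) x - z * u x = if x = [] then 1 else 0 := fun x => by
    have h1 : (lp.single 2 [] (1 : ℂ) : lp (fun _ : List (Fin 2) => ℂ) 2) x =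
        if x = [] then 1 else 0 := by
      rw [lp.single_apply, Pi.single_apply]
    rw [← h1, ← hu]
    rfl
  have hb : ∀ b : Fin 2, u [b] = -u [] * rootGreen (child V b) (bounded_child hV b) z := by
    intro b
    refine apply_of_isBranch branch branch_degree_le V hV branch branch_degree_le (child V b)
      (bounded_child hV b) (i := fun w => w ++ [b]) (List.append_left_injective [b]) [] []
      (fun _ => rfl) (fun x u => ?_) hz u (fun x => ?_)
    · rw [branch_neighborFinset, branch_neighborFinset, sum_branchNeighbors_append]
    · have h1 := hx (x ++ [b])
      rw [if_neg (by simp)] at h1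
      exact sub_eq_zero.1 h1
  have h0 := hx []
  rw [branchOperator, schrodinger_apply, branch_neighborFinset, branchNeighbors,
    Finset.sum_pair (by simp), hb, hb, if_pos rfl] at h0
  rw [show rootGreen V hV z = u [] from hm.symm]
  linear_combination h0

variable (W : Fin 2 × List (Fin 2) → ℝ) (hW : ∃ C : ℝ, ∀ x, |W x| ≤ C)

theorem sum_betheNeighbors_zero_append (b : Fin 2) (x : List (Fin 2))
    (u : Fin 2 × List (Fin 2) → ℂ) :
    ∑ y ∈ betheNeighbors (0, x ++ [b]), u y =
      ∑ y ∈ branchNeighbors x, u (0, y ++ [b]) + if x = [] then u (0, []) else 0 := by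
  rw [betheNeighbors]
  dsimp only
  rw [if_neg (by simp), Finset.union_empty,
    Finset.sum_image (fun _ _ _ _ h => (Prod.mk.inj h).2),
    sum_branchNeighbors_append b x fun w => u (0, w)]

theorem sum_betheNeighbors (j : Fin 2) (x : List (Fin 2)) (u : Fin 2 × List (Fin 2) → ℂ) :
    ∑ y ∈ betheNeighbors (j, x), u y =
      ∑ y ∈ branchNeighbors x, u (j, y) + if x = [] then u (j + 1, []) else 0 := by
  have hj : j ≠ j + 1 := by revert j; decide
  rw [betheNeighbors]
  dsimp only
  rw [Finset.sum_union, Finset.sum_image (fun _ _ _ _ h => (Prod.mk.inj h).2)]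
  · split_ifs <;> simp
  · split_ifs
    · simp [hj]
    · simp

/-- The spectral measure of `H` on the Bethe lattice at the vertex `O = (0, [])`. -/
noncomputable def betheMeasure : Measure ℝ :=
  spectralMeasure (betheOperator W hW) (lp.single 2 ((0 : Fin 2), ([] : List (Fin 2))) (1 : ℂ))

instance : IsProbabilityMeasure (betheMeasure W hW) :=
  isProbabilityMeasure_spectralMeasure_single (isSelfAdjoint_betheOperator W hW) _

theorem ae_abs_le_betheMeasure : ∀ᵐ x ∂(betheMeasure W hW), |x| ≤ ‖betheOperator W hW‖ :=
  ae_abs_le_norm _ _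

theorem integral_id_betheMeasure : ∫ t, t ∂(betheMeasure W hW) = W (0, []) :=
  integral_id_spectralMeasure_schrodinger bethe bethe_degree_le W hW (0, [])

theorem integral_sq_betheMeasure : ∫ t, t ^ 2 ∂(betheMeasure W hW) = 3 + W (0, []) ^ 2 := by
  have h := integral_sq_spectralMeasure_schrodinger bethe bethe_degree_le W hW (0, [])
  rw [bethe_degree] at h
  exact_mod_cast h

/-- The restriction of a potential on the Bethe lattice to one of the two branches. -/
def half (j : Fin 2) (w : List (Fin 2)) : ℝ := W (j, w)

theorem bounded_half {W : Fin 2 × List (Fin 2) → ℝ} (hW : ∃ C : ℝ, ∀ x, |W x| ≤ C) (j : Fin 2) :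
    ∃ C : ℝ, ∀ x, |half W j x| ≤ C :=
  hW.imp fun _ h _ => h _

/-- Three branches hang at `O`: the two child branches, and the whole other half of the lattice
across the central edge. -/
theorem borelTransform_betheMeasure_mul {z : ℂ} (hz : 0 < z.im) :
    borelTransform (betheMeasure W hW) z * ((W (0, []) : ℂ) - z -
      rootGreen (child (half W 0) 0) (bounded_child (bounded_half hW 0) 0) z -
      rootGreen (child (half W 0) 1) (bounded_child (bounded_half hW 0) 1) z -
      rootGreen (half W 1) (bounded_half hW 1) z) = 1 := by
  obtain ⟨u, hu, hm⟩ := exists_resolvent (betheOperator W hW) (isSelfAdjoint_betheOperator W hW)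
    (lp.single 2 ((0 : Fin 2), ([] : List (Fin 2))) (1 : ℂ)) hz
  rw [inner_single_one] at hm
  have hx : ∀ x, (betheOperator W hW u) x - z * u x = if x = (0, []) then 1 else 0 := fun x => by
    have h1 : (lp.single 2 (0, []) (1 : ℂ) : lp (fun _ : Fin 2 × List (Fin 2) => ℂ) 2) x =
        if x = (0, []) then 1 else 0 := by
      rw [lp.single_apply, Pi.single_apply]
    rw [← h1, ← hu]
    rfl
  have hb : ∀ b : Fin 2, u (0, [b]) = -u (0, []) *
      rootGreen (child (half W 0) b) (bounded_child (bounded_half hW 0) b) z := by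
    intro b
    refine apply_of_isBranch bethe bethe_degree_le W hW branch branch_degree_le
      (child (half W 0) b) (bounded_child (bounded_half hW 0) b) (i := fun w => (0, w ++ [b]))
      (fun v w h => List.append_left_injective [b] (Prod.mk.inj h).2) [] (0, [])
      (fun _ => rfl) (fun x u => ?_) hz u (fun x => ?_)
    · rw [branch_neighborFinset, bethe_neighborFinset, sum_betheNeighbors_zero_append]
    · have h1 := hx (0, x ++ [b])
      rw [if_neg (by simp)] at h1
      exact sub_eq_zero.1 h1
  have hc : u (1, []) = -u (0, []) * rootGreen (half W 1) (bounded_half hW 1) z := by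
    refine apply_of_isBranch bethe bethe_degree_le W hW branch branch_degree_le
      (half W 1) (bounded_half hW 1) (i := fun w => (1, w))
      (fun v w h => (Prod.mk.inj h).2) [] (0, [])
      (fun _ => rfl) (fun x u => ?_) hz u (fun x => ?_)
    · rw [branch_neighborFinset, bethe_neighborFinset, sum_betheNeighbors]
      rfl
    · have h1 := hx (1, x)
      rw [if_neg (by simp)] at h1
      exact sub_eq_zero.1 h1
  have h0 := hx (0, [])
  rw [betheOperator, schrodinger_apply, bethe_neighborFinset, sum_betheNeighbors, branchNeighbors,
    Finset.sum_pair (by simp), hb, hb, if_pos rfl, if_pos rfl,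
    show (0 : Fin 2) + 1 = 1 from rfl, hc] at h0
  rw [betheMeasure, ← hm]
  linear_combination h0

end Recursion

/-! ### Geometric means with respect to the semicircle law -/

section GeomMean

/-- The geometric mean with respect to the free spectral measure. -/
noncomputable def geomMean (f : ℝ → ℝ) : ℝ := Real.exp (∫ x, Real.log (f x) ∂freeMeasure)

theorem geomMean_pos (f : ℝ → ℝ) : 0 < geomMean f := Real.exp_pos _

theorem exp_integral_le_integral_exp {h : ℝ → ℝ} (h1 : Integrable h freeMeasure)
    (h2 : Integrable (fun x => Real.exp (h x)) freeMeasure) :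
    Real.exp (∫ x, h x ∂freeMeasure) ≤ ∫ x, Real.exp (h x) ∂freeMeasure :=
  convexOn_exp.map_integral_le Real.continuous_exp.continuousOn isClosed_univ
    (Eventually.of_forall fun _ => Set.mem_univ _) h1 h2

theorem geomMean_div_le_integral {f g : ℝ → ℝ} (hf : Continuous f) (hg : Continuous g)
    (hf0 : ∀ x, 0 < f x) (hg0 : ∀ x, 0 < g x) :
    geomMean f / geomMean g ≤ ∫ x, f x / g x ∂freeMeasure := by
  have cf : Continuous fun x => Real.log (f x) := hf.log fun x => (hf0 x).ne'
  have cg : Continuous fun x => Real.log (g x) := hg.log fun x => (hg0 x).ne'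
  rw [geomMean, geomMean, ← Real.exp_sub,
    ← integral_sub (integrable_freeMeasure cf) (integrable_freeMeasure cg)]
  refine (exp_integral_le_integral_exp (integrable_freeMeasure (cf.sub cg))
    (integrable_freeMeasure (Real.continuous_exp.comp (cf.sub cg)))).trans_eq ?_
  refine integral_congr_ae (Eventually.of_forall fun x => ?_)
  simp only
  rw [Pi.sub_apply, Real.exp_sub, Real.exp_log (hf0 x), Real.exp_log (hg0 x)]

/-- The geometric mean is superadditive. -/
theorem geomMean_add_le {f g : ℝ → ℝ} (hf : Continuous f) (hg : Continuous g)
    (hf0 : ∀ x, 0 < f x) (hg0 : ∀ x, 0 < g x) :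
    geomMean f + geomMean g ≤ geomMean (fun x => f x + g x) := by
  have h0 : ∀ x, 0 < f x + g x := fun x => add_pos (hf0 x) (hg0 x)
  have hfg : Continuous fun x => f x + g x := hf.add hg
  have h1 := geomMean_div_le_integral hf hfg hf0 h0
  have h2 := geomMean_div_le_integral hg hfg hg0 h0
  have i1 : Integrable (fun x => f x / (f x + g x)) freeMeasure :=
    integrable_freeMeasure (hf.div hfg fun x => (h0 x).ne')
  have i2 : Integrable (fun x => g x / (f x + g x)) freeMeasure :=
    integrable_freeMeasure (hg.div hfg fun x => (h0 x).ne')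
  -- The inequality between geometric and arithmetic mean is applied to the fractions `f/(f + g)`
  -- and `g/(f + g)`, which sum to `1`.
  have h3 : ∫ x, f x / (f x + g x) ∂freeMeasure + ∫ x, g x / (f x + g x) ∂freeMeasure = 1 := by
    rw [← integral_add i1 i2]
    have : ∀ x, f x / (f x + g x) + g x / (f x + g x) = 1 := fun x => by
      rw [← add_div, div_self (h0 x).ne']
    simp [this]
  have h4 := add_le_add h1 h2
  rw [h3, ← add_div] at h4
  exact (div_le_one (geomMean_pos _)).1 h4

end GeomMean

/-! ### The recursion for geometric means of `Im m` -/

section Iteration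

/-- The imaginary part of the Borel transform on the line at height `ε`. -/
noncomputable def imBorel (μ : Measure ℝ) (ε l : ℝ) : ℝ := (borelTransform μ ⟨l, ε⟩).im

theorem continuous_imBorel (μ : Measure ℝ) [IsProbabilityMeasure μ] {ε : ℝ} (hε : 0 < ε) :
    Continuous (imBorel μ ε) :=
  Complex.continuous_im.comp (continuous_borelTransform μ hε)

theorem imBorel_pos (μ : Measure ℝ) [IsProbabilityMeasure μ] {C : ℝ} (hC : ∀ᵐ x ∂μ, |x| ≤ C)
    {ε : ℝ} (hε : 0 < ε) (l : ℝ) : 0 < imBorel μ ε l := by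
  refine lt_of_lt_of_le ?_ (le_im_borelTransform μ hC (z := ⟨l, ε⟩) hε (le_refl |l|))
  have : (0 : ℝ) < ε := hε
  positivity

/-- Lower bound for the geometric mean of the imaginary part of a Borel transform. -/
theorem le_geomMean_imBorel (μ : Measure ℝ) [IsProbabilityMeasure μ] {C : ℝ}
    (hC : ∀ᵐ x ∂μ, |x| ≤ C) {ε : ℝ} (hε : 0 < ε) {g : ℝ → ℝ} (hg : Continuous g)
    (hg0 : ∀ l, 0 < g l) (h : ∀ l, ‖borelTransform μ ⟨l, ε⟩‖ ^ 2 * g l ≤ imBorel μ ε l) :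
    Real.exp (-(2 * ∫ x, x ^ 2 ∂μ - (∫ x, x ∂μ) ^ 2) / 4 - 2 * freePotential ε 0) * geomMean g ≤
      geomMean (imBorel μ ε) := by
  have hm0 : ∀ l, borelTransform μ ⟨l, ε⟩ ≠ 0 := fun l h0 => by
    have := imBorel_pos μ hC hε l
    rw [imBorel, h0] at this
    simp at this
  have c1 : Continuous fun l => Real.log ‖borelTransform μ ⟨l, ε⟩‖ :=
    (continuous_borelTransform μ hε).norm.log fun l => (norm_pos_iff.2 (hm0 l)).ne'
  have c2 : Continuous fun l => Real.log (g l) := hg.log fun l => (hg0 l).ne'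
  have c3 : Continuous fun l => Real.log (imBorel μ ε l) :=
    (continuous_imBorel μ hε).log fun l => (imBorel_pos μ hC hε l).ne'
  have h1 := integral_log_norm_borelTransform_ge μ hC hε
  rw [geomMean, geomMean, ← Real.exp_add]
  apply Real.exp_le_exp.2
  have h2 : ∫ l, (2 * Real.log ‖borelTransform μ ⟨l, ε⟩‖ + Real.log (g l)) ∂freeMeasure ≤
      ∫ l, Real.log (imBorel μ ε l) ∂freeMeasure := by
    apply integral_mono (integrable_freeMeasure ((c1.const_mul 2).add c2))
      (integrable_freeMeasure c3)
    intro l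
    have h3 : 0 < ‖borelTransform μ ⟨l, ε⟩‖ := norm_pos_iff.2 (hm0 l)
    have h4 := Real.log_le_log (mul_pos (pow_pos h3 2) (hg0 l)) (h l)
    rw [Real.log_mul (pow_pos h3 2).ne' (hg0 l).ne', Real.log_pow] at h4
    exact_mod_cast h4
  rw [integral_add (integrable_freeMeasure (c1.const_mul 2)) (integrable_freeMeasure c2),
    integral_const_mul] at h2
  linarith

/-- `Im (1/D) = -Im D/|D|²`. Applied to the Green function recursion it expresses `Im m` by `|m|²`
and the positive imaginary parts of the branches. -/
theorem im_eq_of_mul_eq_one {m D : ℂ} (h : m * D = 1) : m.im = ‖m‖ ^ 2 * (-D.im) := by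
  have hD : D ≠ 0 := right_ne_zero_of_mul_eq_one h
  rw [eq_inv_of_mul_eq_one_left h, Complex.inv_im, norm_inv, inv_pow, ← Complex.normSq_eq_norm_sq]
  ring

/-- The constant of the recursion at height `ε`, which tends to `1`. -/
noncomputable def recursionConst (ε : ℝ) : ℝ := 2 * Real.exp (-1 - 2 * freePotential ε 0)

theorem recursionConst_pos (ε : ℝ) : 0 < recursionConst ε := by
  have := Real.exp_pos (-1 - 2 * freePotential ε 0)
  rw [recursionConst]
  linarith

theorem tendsto_recursionConst : Tendsto recursionConst (𝓝[>] 0) (𝓝 1) := by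
  have h := ((Real.continuous_exp.tendsto _).comp
    ((tendsto_freePotential_zero.const_mul 2).const_sub (-1))).const_mul 2
  have h1 : 2 * Real.exp (-1 - 2 * (2⁻¹ * Real.log 2 - 2⁻¹)) = 1 := by
    have : (-1 - 2 * (2⁻¹ * Real.log 2 - 2⁻¹)) = -Real.log 2 := by ring
    rw [this, Real.exp_neg, Real.exp_log two_pos, mul_inv_cancel₀ two_ne_zero]
  rw [h1] at h
  exact h

variable (V : List (Fin 2) → ℝ) (hV : ∃ C : ℝ, ∀ x, |V x| ≤ C)

/-- The term `ε` in `Im m = |m|² (ε + Im m₀ + Im m₁)` is dropped. The moments `V(O)` and `2 + V(O)²`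
turn the exponent of `le_geomMean_imBorel` into `-1 - V(O)²/4 - 2U(0)`, and superadditivity
separates the two children. Writing the factor as `recursionConst ε / 2` exhibits the average over a
coin toss. -/
theorem geomMean_rootMeasure_ge {ε : ℝ} (hε : 0 < ε) :
    recursionConst ε * (Real.exp (-V [] ^ 2 / 4) *
      (geomMean (imBorel (rootMeasure (child V 0) (bounded_child hV 0)) ε) +
        geomMean (imBorel (rootMeasure (child V 1) (bounded_child hV 1)) ε)) / 2) ≤
      geomMean (imBorel (rootMeasure V hV) ε) := by
  set m0 := imBorel (rootMeasure (child V 0) (bounded_child hV 0)) ε with hm0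
  set m1 := imBorel (rootMeasure (child V 1) (bounded_child hV 1)) ε with hm1
  have c0 : Continuous m0 := continuous_imBorel _ hε
  have c1 : Continuous m1 := continuous_imBorel _ hε
  have c01 : Continuous fun l => m0 l + m1 l := c0.add c1
  have p0 : ∀ l, 0 < m0 l := imBorel_pos _ (ae_abs_le_rootMeasure _ _) hε
  have p1 : ∀ l, 0 < m1 l := imBorel_pos _ (ae_abs_le_rootMeasure _ _) hε
  have h1 := le_geomMean_imBorel (rootMeasure V hV) (ae_abs_le_rootMeasure V hV) hε c01
    (fun l => add_pos (p0 l) (p1 l)) fun l => by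
      have h := im_eq_of_mul_eq_one (rootGreen_mul V hV (z := ⟨l, ε⟩) hε)
      rw [rootGreen] at h
      rw [imBorel, h]
      gcongr
      simp only [Complex.sub_im, Complex.ofReal_im, hm0, hm1, imBorel, rootGreen]
      linarith
  rw [integral_sq_rootMeasure, integral_id_rootMeasure] at h1
  refine le_trans (le_of_eq ?_) ((mul_le_mul_of_nonneg_left (geomMean_add_le c0 c1 p0 p1)
    (Real.exp_pos _).le).trans h1)
  rw [recursionConst]
  have : -(2 * (2 + V [] ^ 2) - V [] ^ 2) / 4 - 2 * freePotential ε 0 =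
    (-1 - 2 * freePotential ε 0) + -V [] ^ 2 / 4 := by ring
  rw [this, Real.exp_add]
  ring

/-- The mean of `exp(-¼ ∑ V²(xₙ))` over the first `N` vertices of the random path. -/
noncomputable def pathMean : ℕ → (List (Fin 2) → ℝ) → ℝ
  | 0, _ => 1
  | N + 1, V => Real.exp (-V [] ^ 2 / 4) * (pathMean N (child V 0) + pathMean N (child V 1)) / 2

theorem pathMean_pos (N : ℕ) (V : List (Fin 2) → ℝ) : 0 < pathMean N V := by
  induction N generalizing V with
  | zero => exact one_pos
  | succ N ih =>
    have := add_pos (ih (child V 0)) (ih (child V 1))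
    rw [pathMean]
    positivity

theorem bounded_zero : ∃ C : ℝ, ∀ x : List (Fin 2), |(0 : List (Fin 2) → ℝ) x| ≤ C :=
  ⟨0, fun _ => by simp⟩

/-- Induction on the depth of the potential: passing to a child lowers the depth by one and
`pathMean` satisfies the same recursion. After `N` levels the potential is zero and the free Green
function remains. -/
theorem pathMean_mul_le_geomMean {ε : ℝ} (hε : 0 < ε) (N : ℕ)
    (hN : ∀ w, N ≤ w.length → V w = 0) :
    recursionConst ε ^ N * pathMean N V * geomMean (imBorel (rootMeasure 0 bounded_zero) ε) ≤
      geomMean (imBorel (rootMeasure V hV) ε) := by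
  induction N generalizing V with
  | zero =>
    obtain rfl : V = 0 := funext fun w => hN w (Nat.zero_le _)
    rw [pow_zero, pathMean, one_mul, one_mul]
  | succ N ih =>
    have hc : ∀ b w, N ≤ w.length → child V b w = 0 := fun b w hw => hN _ (by simpa using hw)
    refine le_trans (le_of_eq_of_le ?_ (mul_le_mul_of_nonneg_left
      (div_le_div_of_nonneg_right (mul_le_mul_of_nonneg_left
        (add_le_add (ih (child V 0) (bounded_child hV 0) (hc 0))
          (ih (child V 1) (bounded_child hV 1) (hc 1))) (Real.exp_pos (-V [] ^ 2 / 4)).le)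
        zero_le_two) (recursionConst_pos ε).le)) (geomMean_rootMeasure_ge V hV hε)
    rw [pathMean]
    ring

/-- One step at `O` and then the branch bound for both children. The positive contribution of the
other half is discarded, so nothing is required of `W` there; the second moment `3 + W²` in place of
`2 + W²` costs `exp(-1/2)`. -/
theorem pathMean_mul_le_geomMean_bethe (W : Fin 2 × List (Fin 2) → ℝ)
    (hW : ∃ C : ℝ, ∀ x, |W x| ≤ C) {ε : ℝ} (hε : 0 < ε) (N : ℕ)
    (hN : ∀ w, N + 1 ≤ w.length → W (0, w) = 0) :
    recursionConst ε ^ (N + 1) * (Real.exp (-2⁻¹) * pathMean (N + 1) (half W 0)) *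
      geomMean (imBorel (rootMeasure 0 bounded_zero) ε) ≤
      geomMean (imBorel (betheMeasure W hW) ε) := by
  set V := half W 0 with hVdef
  have hV : ∃ C : ℝ, ∀ x, |V x| ≤ C := bounded_half hW 0
  set m0 := imBorel (rootMeasure (child V 0) (bounded_child hV 0)) ε with hm0
  set m1 := imBorel (rootMeasure (child V 1) (bounded_child hV 1)) ε with hm1
  have c0 : Continuous m0 := continuous_imBorel _ hε
  have c1 : Continuous m1 := continuous_imBorel _ hε
  have c01 : Continuous fun l => m0 l + m1 l := c0.add c1
  have p0 : ∀ l, 0 < m0 l := imBorel_pos _ (ae_abs_le_rootMeasure _ _) hε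
  have p1 : ∀ l, 0 < m1 l := imBorel_pos _ (ae_abs_le_rootMeasure _ _) hε
  have p2 : ∀ l, 0 < imBorel (rootMeasure (half W 1) (bounded_half hW 1)) ε l :=
    imBorel_pos _ (ae_abs_le_rootMeasure _ _) hε
  have h1 := le_geomMean_imBorel (betheMeasure W hW) (ae_abs_le_betheMeasure W hW) hε c01
    (fun l => add_pos (p0 l) (p1 l)) fun l => by
      have h := im_eq_of_mul_eq_one (borelTransform_betheMeasure_mul W hW (z := ⟨l, ε⟩) hε)
      rw [imBorel, h]
      gcongr
      have := p2 l
      simp only [imBorel] at this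
      simp only [Complex.sub_im, Complex.ofReal_im, hm0, hm1, imBorel, rootGreen]
      linarith
  rw [integral_sq_betheMeasure, integral_id_betheMeasure] at h1
  have hc : ∀ b w, N ≤ w.length → child V b w = 0 := fun b w hw =>
    hN (w ++ [b]) (by simpa using hw)
  have h2 := add_le_add (pathMean_mul_le_geomMean (child V 0) (bounded_child hV 0) hε N (hc 0))
    (pathMean_mul_le_geomMean (child V 1) (bounded_child hV 1) hε N (hc 1))
  refine le_trans (le_of_eq_of_le ?_ (mul_le_mul_of_nonneg_left
    (h2.trans (geomMean_add_le c0 c1 p0 p1)) (Real.exp_pos _).le)) h1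
  have hV0 : W (0, []) = V [] := rfl
  have : -(2 * (3 + V [] ^ 2) - V [] ^ 2) / 4 - 2 * freePotential ε 0 =
    (-1 - 2 * freePotential ε 0) + (-2⁻¹ + -V [] ^ 2 / 4) := by ring
  rw [hV0, this, Real.exp_add, Real.exp_add, pathMean, pow_succ]
  nth_rewrite 2 [recursionConst]
  ring

end Iteration

/-! ### The free Green function -/

section FreeGreen

/-- With zero potential the child branches are copies of the branch and `m(-z - 2m) = 1`. For `m = a
+ ib` the real part reads `2b² + εb = 1 - l²/8 + 2(a + l/4)²`; dropping the last square gives `(4b +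
ε)² ≥ 8 - l² + ε²`. -/
theorem le_imBorel_free {ε : ℝ} (hε : 0 < ε) (l : ℝ) :
    (Real.sqrt (8 - l ^ 2 + ε ^ 2) - ε) / 4 ≤ imBorel (rootMeasure 0 bounded_zero) ε l := by
  have h := rootGreen_mul 0 bounded_zero (z := ⟨l, ε⟩) hε
  have h0 : ∀ b, rootGreen (child 0 b) (bounded_child bounded_zero b) ⟨l, ε⟩ =
    rootGreen 0 bounded_zero ⟨l, ε⟩ := fun _ => rfl
  rw [h0, h0, Pi.zero_apply, Complex.ofReal_zero] at h
  have hpos : 0 < imBorel (rootMeasure 0 bounded_zero) ε l :=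
    imBorel_pos _ (ae_abs_le_rootMeasure _ _) hε l
  rw [imBorel] at hpos ⊢
  change 0 < (rootGreen 0 bounded_zero ⟨l, ε⟩).im at hpos
  change _ ≤ (rootGreen 0 bounded_zero ⟨l, ε⟩).im
  generalize rootGreen 0 bounded_zero ⟨l, ε⟩ = m at h hpos
  have hre := congrArg Complex.re h
  simp only [Complex.mul_re, Complex.sub_re, Complex.sub_im, Complex.zero_re, Complex.zero_im,
    Complex.one_re] at hre
  have h2 : Real.sqrt (8 - l ^ 2 + ε ^ 2) ≤ 4 * m.im + ε := by
    apply Real.sqrt_le_iff.2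
    refine ⟨by linarith, ?_⟩
    nlinarith [sq_nonneg (4 * m.re + l)]
  linarith

theorem integrable_freeMeasure_of_integrableOn {g : ℝ → ℝ}
    (hg : IntegrableOn (fun x => freeDensity x * g x)
      (Set.Ioo (-(2 * Real.sqrt 2)) (2 * Real.sqrt 2)) volume) : Integrable g freeMeasure := by
  have h : freeMeasure = volume.withDensity
      (fun x => (((freeDensity x).toNNReal : NNReal) : ℝ≥0∞)) := rfl
  rw [h, integrable_withDensity_iff_integrable_smul measurable_freeDensity.real_toNNReal]
  have h1 : (fun x => (freeDensity x).toNNReal • g x) = fun x => freeDensity x * g x := by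
    funext x
    rw [NNReal.smul_def, Real.coe_toNNReal _ (freeDensity_nonneg x), smul_eq_mul]
  rw [h1]
  refine (integrableOn_iff_integrable_of_support_subset fun x hx => ?_).1 hg
  by_contra h1
  apply hx
  simp only [freeDensity_eq_zero h1, zero_mul]

/-- Against Lebesgue measure the integrand is `t log t` at `t = freeDensity x`, which is bounded for
`0 < t ≤ 1`. -/
theorem integrable_log_freeDensity :
    Integrable (fun x => Real.log (freeDensity x)) freeMeasure := by
  apply integrable_freeMeasure_of_integrableOn
  refine Measure.integrableOn_of_bounded (M := 1) (by simp) (measurable_freeDensity.mul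
    (Real.measurable_log.comp measurable_freeDensity)).aestronglyMeasurable ?_
  filter_upwards [ae_restrict_mem measurableSet_Ioo] with x hx
  have := Real.abs_log_mul_self_lt (freeDensity x) (freeDensity_pos hx) (freeDensity_le_one x)
  rw [mul_comm]
  exact this.le

end FreeGreen

/-! ### Poisson integrals and the boundary values of `Im m` -/

section PoissonKernel

/-- The Poisson extension `∫ f(x + ε t) dt / (1 + t²)`, up to the factor `π`. -/
noncomputable def poissonIntegral (f : ℝ → ℝ) (ε x : ℝ) : ℝ := ∫ t, f (x + ε * t) * (1 + t ^ 2)⁻¹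

variable {f : ℝ → ℝ} {b : ℝ}

theorem norm_mul_inv_one_add_sq_le (hfb : ∀ x, |f x| ≤ b) (y t : ℝ) :
    ‖f y * (1 + t ^ 2)⁻¹‖ ≤ b * (1 + t ^ 2)⁻¹ := by
  rw [norm_mul, Real.norm_eq_abs, Real.norm_of_nonneg (by positivity)]
  exact mul_le_mul_of_nonneg_right (hfb y) (by positivity)

theorem continuous_poissonIntegral (hf : Continuous f) (hfb : ∀ x, |f x| ≤ b)
    (ε : ℝ) : Continuous (poissonIntegral f ε) := by
  refine continuous_of_dominated (bound := fun t => b * (1 + t ^ 2)⁻¹) (fun x => ?_)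
    (fun x => Eventually.of_forall fun t => norm_mul_inv_one_add_sq_le hfb _ t)
    (integrable_inv_one_add_sq.const_mul b) (Eventually.of_forall fun t => by fun_prop)
  exact ((hf.comp (by fun_prop)).mul (Continuous.inv₀ (by fun_prop)
    fun t => by positivity)).aestronglyMeasurable

theorem norm_poissonIntegral_le (hfb : ∀ x, |f x| ≤ b) (ε x : ℝ) : ‖poissonIntegral f ε x‖ ≤ b *
    Real.pi := by
  rw [← integral_univ_inv_one_add_sq, ← integral_const_mul]
  exact norm_integral_le_of_norm_le (integrable_inv_one_add_sq.const_mul b)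
    (Eventually.of_forall fun t => norm_mul_inv_one_add_sq_le hfb _ t)

theorem tendsto_poissonIntegral (hf : Continuous f) (hfb : ∀ x, |f x| ≤ b)
    (x : ℝ) :
    Tendsto (fun ε => poissonIntegral f ε x) (𝓝[>] 0) (𝓝 (f x * Real.pi)) := by
  rw [← integral_univ_inv_one_add_sq, ← integral_const_mul]
  refine tendsto_integral_filter_of_dominated_convergence (fun t => b * (1 + t ^ 2)⁻¹)
    (Eventually.of_forall fun ε => ?_)
    (Eventually.of_forall fun ε => Eventually.of_forall fun t =>
      norm_mul_inv_one_add_sq_le hfb _ t)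
    (integrable_inv_one_add_sq.const_mul b) (Eventually.of_forall fun t => ?_)
  · exact ((hf.comp (by fun_prop)).mul (Continuous.inv₀ (by fun_prop)
      fun t => by positivity)).aestronglyMeasurable
  · have h : Continuous fun ε : ℝ => f (x + ε * t) * (1 + t ^ 2)⁻¹ := by fun_prop
    have h2 := (h.tendsto 0).mono_left (nhdsWithin_le_nhds (s := Set.Ioi (0 : ℝ)))
    simpa using h2

theorem tendsto_integral_poissonIntegral (hf : Continuous f) (hfb : ∀ x, |f x| ≤ b)
    (μ : Measure ℝ) [IsFiniteMeasure μ] :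
    Tendsto (fun ε => ∫ x, poissonIntegral f ε x ∂μ) (𝓝[>] 0) (𝓝 (∫ x, f x * Real.pi ∂μ)) :=
  tendsto_integral_filter_of_dominated_convergence (fun _ => b * Real.pi)
    (Eventually.of_forall fun ε => (continuous_poissonIntegral hf hfb ε).aestronglyMeasurable)
    (Eventually.of_forall fun ε => Eventually.of_forall fun x => norm_poissonIntegral_le hfb ε x)
    (integrable_const _) (Eventually.of_forall fun x => tendsto_poissonIntegral hf hfb x)

theorem poisson_kernel_eq {ε : ℝ} (hε : 0 < ε) (x l : ℝ) :
    ε / ((x - l) ^ 2 + ε ^ 2) = ε⁻¹ * (1 + ((l - x) / ε) ^ 2)⁻¹ := by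
  have : (x - l) ^ 2 + ε ^ 2 ≠ 0 := by positivity
  have : ε ^ 2 + (l - x) ^ 2 ≠ 0 := by positivity
  field_simp
  ring

theorem integrable_poisson_kernel {ε : ℝ} (hε : 0 < ε) (x : ℝ) :
    Integrable fun l : ℝ => ε / ((x - l) ^ 2 + ε ^ 2) := by
  simp only [poisson_kernel_eq hε]
  exact ((integrable_inv_one_add_sq.comp_div hε.ne').comp_sub_right x).const_mul _

theorem integral_mul_poisson_kernel {ε : ℝ} (hε : 0 < ε) (x : ℝ) :
    ∫ l, f l * (ε / ((x - l) ^ 2 + ε ^ 2)) = poissonIntegral f ε x := by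
  have h : ∀ l, f l * (ε / ((x - l) ^ 2 + ε ^ 2)) =
      ε⁻¹ * (fun t => f (x + ε * t) * (1 + t ^ 2)⁻¹) ((l - x) / ε) := fun l => by
    simp only
    rw [poisson_kernel_eq hε, mul_div_cancel₀ _ hε.ne', add_sub_cancel]
    ring
  simp only [h]
  rw [integral_const_mul, integral_sub_right_eq_self (fun l => (fun t =>
    f (x + ε * t) * (1 + t ^ 2)⁻¹) (l / ε)) x,
    Measure.integral_comp_div (fun t => f (x + ε * t) * (1 + t ^ 2)⁻¹) ε, abs_of_pos hε,
    smul_eq_mul, inv_mul_cancel_left₀ hε.ne', poissonIntegral]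

/-- By Fubini, smoothing the measure by the Poisson kernel amounts to smoothing `f`. Restricting to
the band only decreases the integral because `f` is nonnegative. -/
theorem integral_mul_imBorel_le (hf : Continuous f) (hfb : ∀ x, |f x| ≤ b)
    (μ : Measure ℝ) [IsProbabilityMeasure μ] (hf0 : ∀ x, 0 ≤ f x)
    {ε : ℝ} (hε : 0 < ε) :
    ∫ l in Set.Ioo (-(2 * Real.sqrt 2)) (2 * Real.sqrt 2), f l * imBorel μ ε l ≤
      ∫ x, poissonIntegral f ε x ∂μ := by
  set B : Set ℝ := Set.Ioo (-(2 * Real.sqrt 2)) (2 * Real.sqrt 2)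
  have h1 : ∀ l, f l * imBorel μ ε l = ∫ x, f l * (ε / ((x - l) ^ 2 + ε ^ 2)) ∂μ := fun l => by
    rw [imBorel, im_borelTransform μ (z := ⟨l, ε⟩) hε, integral_const_mul]
  simp only [h1]
  have hpos : ∀ x l : ℝ, 0 < (x - l) ^ 2 + ε ^ 2 := fun x l => by positivity
  have hint : Integrable (Function.uncurry fun l x => f l * (ε / ((x - l) ^ 2 + ε ^ 2)))
      ((volume.restrict B).prod μ) := by
    refine Integrable.of_bound (C := b * (ε / ε ^ 2)) ?_ (Eventually.of_forall fun p => ?_)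
    · apply Continuous.aestronglyMeasurable
      exact (hf.comp continuous_fst).mul (Continuous.div (by fun_prop) (by fun_prop)
        fun p => (hpos _ _).ne')
    · have h2 := hpos p.2 p.1
      rw [Function.uncurry_def, norm_mul, Real.norm_eq_abs, Real.norm_of_nonneg (by positivity)]
      gcongr
      · exact (abs_nonneg _).trans (hfb p.1)
      · exact hfb p.1
      · nlinarith [sq_nonneg (p.2 - p.1)]
  rw [integral_integral_swap hint]
  apply integral_mono hint.integral_prod_right
  · exact Integrable.of_bound (continuous_poissonIntegral hf hfb ε).aestronglyMeasurable _
      (Eventually.of_forall (norm_poissonIntegral_le hfb ε))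
  · intro x
    simp only
    rw [← integral_mul_poisson_kernel hε]
    apply setIntegral_le_integral
    · exact (integrable_poisson_kernel hε x).bdd_mul hf.aestronglyMeasurable
        (Eventually.of_forall hfb)
    · exact Eventually.of_forall fun l => mul_nonneg (hf0 l) (div_nonneg hε.le (hpos x l).le)

end PoissonKernel

/-! ### The free geometric mean as the height tends to zero -/

section FreeLimit

/-- Lower bound for the imaginary part of the free Green function at height `ε`. -/
noncomputable def freeImBound (ε l : ℝ) : ℝ := (Real.sqrt (8 - l ^ 2 + ε ^ 2) - ε) / 4

theorem pi_mul_freeDensity (l : ℝ) : Real.pi * freeDensity l = Real.sqrt (8 - l ^ 2) / 4 := by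
  rw [freeDensity]
  field_simp

theorem integrable_log_pi_mul_freeDensity :
    Integrable (fun l => Real.log (Real.pi * freeDensity l)) freeMeasure := by
  refine ((integrable_const (Real.log Real.pi)).add integrable_log_freeDensity).congr ?_
  filter_upwards [ae_mem_band] with l hl
  rw [Real.log_mul Real.pi_pos.ne' (freeDensity_pos hl).ne', Pi.add_apply]

/-- With `p = π · freeDensity l ≤ 1` one has `8 - l² = 16p²`, and `freeImBound ε l` lies between
`p²/2` and `p`. This is an integrable bound uniform in `ε ≤ 1`. -/
theorem abs_log_freeImBound_le {ε l : ℝ} (hε : 0 < ε) (hε1 : ε ≤ 1)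
    (hl : l ∈ Set.Ioo (-(2 * Real.sqrt 2)) (2 * Real.sqrt 2)) :
    |Real.log (freeImBound ε l)| ≤ 2 * |Real.log (Real.pi * freeDensity l)| + Real.log 2 := by
  have hp0 : 0 < Real.pi * freeDensity l := mul_pos Real.pi_pos (freeDensity_pos hl)
  have hsq : 8 - l ^ 2 = 16 * (Real.pi * freeDensity l) ^ 2 := by
    rw [pi_mul_freeDensity, div_pow, Real.sq_sqrt (by linarith [mem_band_iff.1 hl])]
    ring
  rw [freeImBound, hsq]
  have hp1 : Real.pi * freeDensity l ≤ 1 := by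
    nlinarith [sq_nonneg l]
  generalize Real.pi * freeDensity l = p at hp0 hp1
  have h1 : p ^ 2 / 2 ≤ (Real.sqrt (16 * p ^ 2 + ε ^ 2) - ε) / 4 := by
    have : 2 * p ^ 2 + ε ≤ Real.sqrt (16 * p ^ 2 + ε ^ 2) := by
      apply Real.le_sqrt_of_sq_le
      have : p ^ 2 ≤ 1 := pow_le_one₀ hp0.le hp1
      nlinarith [mul_nonneg (sq_nonneg p) (sub_nonneg.2 this),
        mul_nonneg (sq_nonneg p) (sub_nonneg.2 hε1)]
    linarith
  have h2 : (Real.sqrt (16 * p ^ 2 + ε ^ 2) - ε) / 4 ≤ p := by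
    have : Real.sqrt (16 * p ^ 2 + ε ^ 2) ≤ 4 * p + ε := by
      apply Real.sqrt_le_iff.2
      constructor
      · positivity
      · nlinarith [mul_pos hp0 hε]
    linarith
  have h3 : 0 < p ^ 2 / 2 := by positivity
  have h4 := Real.log_le_log h3 h1
  have h5 := Real.log_le_log (h3.trans_le h1) h2
  rw [Real.log_div (by positivity) two_ne_zero, Real.log_pow] at h4
  push_cast at h4
  have h6 := Real.log_pos one_lt_two
  rw [abs_le]
  constructor
  · have := neg_abs_le (Real.log p)
    linarith
  · have := le_abs_self (Real.log p)
    have := abs_nonneg (Real.log p)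
    linarith

theorem integrable_log_freeImBound {ε : ℝ} (hε : 0 < ε) (hε1 : ε ≤ 1) :
    Integrable (fun l => Real.log (freeImBound ε l)) freeMeasure := by
  refine Integrable.mono' ((integrable_log_pi_mul_freeDensity.abs.const_mul 2).add
    (integrable_const (Real.log 2))) ?_ ?_
  · apply Measurable.aestronglyMeasurable
    unfold freeImBound
    fun_prop
  · filter_upwards [ae_mem_band] with l hl
    exact abs_log_freeImBound_le hε hε1 hl

theorem tendsto_integral_log_freeImBound :
    Tendsto (fun ε => ∫ l, Real.log (freeImBound ε l) ∂freeMeasure) (𝓝[>] 0)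
      (𝓝 (∫ l, Real.log (Real.pi * freeDensity l) ∂freeMeasure)) := by
  have hev : ∀ᶠ ε : ℝ in 𝓝[>] 0, 0 < ε ∧ ε ≤ 1 := by
    filter_upwards [Ioc_mem_nhdsGT zero_lt_one] with ε hε using hε
  refine tendsto_integral_filter_of_dominated_convergence
    (fun l => 2 * |Real.log (Real.pi * freeDensity l)| + Real.log 2) ?_ ?_
    ((integrable_log_pi_mul_freeDensity.abs.const_mul 2).add (integrable_const (Real.log 2))) ?_
  · filter_upwards [hev] with ε hε
    exact (integrable_log_freeImBound hε.1 hε.2).aestronglyMeasurable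
  · filter_upwards [hev] with ε hε
    filter_upwards [ae_mem_band] with l hl
    exact abs_log_freeImBound_le hε.1 hε.2 hl
  · filter_upwards [ae_mem_band] with l hl
    have hp0 : 0 < Real.pi * freeDensity l := mul_pos Real.pi_pos (freeDensity_pos hl)
    have hc : Continuous fun ε : ℝ => freeImBound ε l := by
      unfold freeImBound
      fun_prop
    have h0 : freeImBound 0 l = Real.pi * freeDensity l := by
      rw [freeImBound, pi_mul_freeDensity]
      simp
    have h1 := (hc.tendsto 0).mono_left (nhdsWithin_le_nhds (s := Set.Ioi (0 : ℝ)))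
    rw [h0] at h1
    exact h1.log hp0.ne'

theorem exp_integral_log_freeImBound_le {ε : ℝ} (hε : 0 < ε) (hε1 : ε ≤ 1) :
    Real.exp (∫ l, Real.log (freeImBound ε l) ∂freeMeasure) ≤
      geomMean (imBorel (rootMeasure 0 bounded_zero) ε) := by
  apply Real.exp_le_exp.2
  have hpos := imBorel_pos (rootMeasure 0 bounded_zero) (ae_abs_le_rootMeasure _ _) hε
  apply integral_mono_ae (integrable_log_freeImBound hε hε1) (integrable_freeMeasure
    ((continuous_imBorel _ hε).log fun l => (hpos l).ne'))
  filter_upwards [ae_mem_band] with l hl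
  apply Real.log_le_log _ (le_imBorel_free hε l)
  have h1 := mem_band_iff.1 hl
  have : ε < Real.sqrt (8 - l ^ 2 + ε ^ 2) := by
    apply Real.lt_sqrt_of_sq_lt
    linarith
  linarith

end FreeLimit

/-! ### From bounds at height `ε` to the spectral measure -/

section BoundaryValues

variable (μ : Measure ℝ) [IsProbabilityMeasure μ]

/-- Jensen's inequality for the geometric mean of the imaginary part of the Borel transform. -/
theorem geomMean_mul_le_integral_poissonIntegral {C : ℝ} (hC : ∀ᵐ x ∂μ, |x| ≤ C) {f : ℝ → ℝ}
    (hf : Continuous f) (hf0 : ∀ x, 0 < f x) {b : ℝ} (hfb : ∀ x, |f x| ≤ b) {ε : ℝ}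
    (hε : 0 < ε) :
    geomMean f * geomMean (imBorel μ ε) *
      Real.exp (-∫ l, Real.log (Real.pi * freeDensity l) ∂freeMeasure) ≤
      Real.pi⁻¹ * ∫ x, poissonIntegral f ε x ∂μ := by
  have hpos := imBorel_pos μ hC hε
  have hmc := continuous_imBorel μ hε
  have i1 : Integrable (fun l => Real.log (f l)) freeMeasure :=
    integrable_freeMeasure (hf.log fun l => (hf0 l).ne')
  have i2 : Integrable (fun l => Real.log (imBorel μ ε l)) freeMeasure :=
    integrable_freeMeasure (hmc.log fun l => (hpos l).ne')
  have i3 := integrable_log_pi_mul_freeDensity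
  -- Chosen so that `freeDensity · exp g = π⁻¹ f · Im m` on the band; Jensen for `g` then compares
  -- the geometric means with a Lebesgue integral.
  set g : ℝ → ℝ := fun l => Real.log (f l) + Real.log (imBorel μ ε l) -
    Real.log (Real.pi * freeDensity l) with hg
  have hgexp : ∀ l ∈ Set.Ioo (-(2 * Real.sqrt 2)) (2 * Real.sqrt 2),
      freeDensity l • Real.exp (g l) = Real.pi⁻¹ * (f l * imBorel μ ε l) := fun l hl => by
    have hd := freeDensity_pos hl
    simp only [hg]
    rw [Real.exp_sub, Real.exp_add, Real.exp_log (hf0 l), Real.exp_log (hpos l),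
      Real.exp_log (mul_pos Real.pi_pos hd), smul_eq_mul]
    field_simp
  have hi : Integrable g freeMeasure := (i1.add i2).sub i3
  have hexp : Integrable (fun l => Real.exp (g l)) freeMeasure := by
    apply integrable_freeMeasure_of_integrableOn
    have hci : IntegrableOn (fun l => Real.pi⁻¹ * (f l * imBorel μ ε l))
        (Set.Ioo (-(2 * Real.sqrt 2)) (2 * Real.sqrt 2)) volume :=
      ((continuous_const.mul (hf.mul hmc)).continuousOn.integrableOn_Icc).mono_set
        Set.Ioo_subset_Icc_self
    exact hci.congr_fun (fun l hl => (hgexp l hl).symm) measurableSet_Ioo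
  have h1 := exp_integral_le_integral_exp hi hexp
  rw [integral_freeMeasure_eq_setIntegral (fun l => Real.exp (g l)),
    setIntegral_congr_fun measurableSet_Ioo hgexp,
    integral_const_mul] at h1
  have h2 := mul_le_mul_of_nonneg_left
    (integral_mul_imBorel_le hf hfb μ (fun x => (hf0 x).le) hε) (inv_nonneg.2 Real.pi_pos.le)
  refine le_trans (le_of_eq ?_) (h1.trans h2)
  have h3 : ∫ l, g l ∂freeMeasure = ∫ l, Real.log (f l) ∂freeMeasure +
      ∫ l, Real.log (imBorel μ ε l) ∂freeMeasure -
      ∫ l, Real.log (Real.pi * freeDensity l) ∂freeMeasure := by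
    rw [← integral_add i1 i2]
    exact integral_sub (i1.add i2) i3
  rw [h3, sub_eq_add_neg, Real.exp_add, Real.exp_add, geomMean, geomMean]

/-- As `ε → 0` the power of `recursionConst` tends to `1`, the Poisson integrals tend to `π ∫ f dμ`,
and the lower bound for the free geometric mean tends to that of `π · freeDensity`, which cancels
the normalisation in Jensen's inequality. A fixed number `N` of recursion steps is essential. -/
theorem dominatesGeomMean_of_le_geomMean {C : ℝ} (hC : ∀ᵐ x ∂μ, |x| ≤ C) {c : ℝ} (hc : 0 ≤ c)
    (N : ℕ) (h : ∀ ε, 0 < ε → recursionConst ε ^ N * c *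
      geomMean (imBorel (rootMeasure 0 bounded_zero) ε) ≤ geomMean (imBorel μ ε)) :
    DominatesGeomMean μ c := by
  intro f hf a b ha hfab
  have hf0 : ∀ x, 0 < f x := fun x => ha.trans_le (hfab x).1
  have hfb : ∀ x, |f x| ≤ b := fun x => by
    rw [abs_of_pos (hf0 x)]
    exact (hfab x).2
  set L := ∫ l, Real.log (Real.pi * freeDensity l) ∂freeMeasure with hL
  have hev : ∀ᶠ ε : ℝ in 𝓝[>] 0, recursionConst ε ^ N * c *
      Real.exp (∫ l, Real.log (freeImBound ε l) ∂freeMeasure) * (geomMean f * Real.exp (-L)) ≤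
      Real.pi⁻¹ * ∫ x, poissonIntegral f ε x ∂μ := by
    filter_upwards [Ioc_mem_nhdsGT zero_lt_one] with ε hε
    refine le_trans ?_ (geomMean_mul_le_integral_poissonIntegral μ hC hf hf0 hfb hε.1)
    rw [mul_comm (geomMean f) (geomMean (imBorel μ ε)), mul_assoc (geomMean (imBorel μ ε))]
    refine mul_le_mul_of_nonneg_right (le_trans ?_ (h ε hε.1))
      (mul_nonneg (geomMean_pos f).le (Real.exp_pos _).le)
    exact mul_le_mul_of_nonneg_left (exp_integral_log_freeImBound_le hε.1 hε.2)
      (mul_nonneg (pow_nonneg (recursionConst_pos ε).le N) hc)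
  have hl := (((tendsto_recursionConst.pow N).mul_const c).mul
    ((Real.continuous_exp.tendsto _).comp tendsto_integral_log_freeImBound)).mul_const
    (geomMean f * Real.exp (-L))
  have hr := (tendsto_integral_poissonIntegral hf hfb μ).const_mul Real.pi⁻¹
  have h1 := le_of_tendsto_of_tendsto hl hr hev
  rw [integral_mul_const, one_pow, one_mul, ← hL] at h1
  have e1 : c * Real.exp L * (geomMean f * Real.exp (-L)) = c * geomMean f := by
    rw [Real.exp_neg]
    field_simp
  have e2 : Real.pi⁻¹ * ((∫ x, f x ∂μ) * Real.pi) = ∫ x, f x ∂μ := by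
    field_simp
  rw [e1, e2] at h1
  exact h1

end BoundaryValues

/-! ### Removal of the finite depth condition -/

section Truncation

/-- The potential that agrees with `V` up to depth `N` and vanishes beyond. -/
def truncate (N : ℕ) (V : List (Fin 2) → ℝ) (w : List (Fin 2)) : ℝ :=
  if w.length < N then V w else 0

theorem abs_truncate_le {N : ℕ} {V : List (Fin 2) → ℝ} {w : List (Fin 2)} :
    |truncate N V w| ≤ |V w| := by
  unfold truncate
  split_ifs <;> simp

theorem child_truncate_succ (N : ℕ) (V : List (Fin 2) → ℝ) (b : Fin 2) :
    child (truncate (N + 1) V) b = truncate N (child V b) := by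
  funext w
  simp [child, truncate]

theorem pathMean_truncate (N : ℕ) (V : List (Fin 2) → ℝ) :
    pathMean N (truncate N V) = pathMean N V := by
  induction N generalizing V with
  | zero => rfl
  | succ N ih =>
    have h0 : truncate (N + 1) V [] = V [] := by simp [truncate]
    rw [pathMean, pathMean, child_truncate_succ, child_truncate_succ, ih, ih, h0]

theorem tendsto_truncate {V : List (Fin 2) → ℝ} (w : List (Fin 2)) :
    Tendsto (fun N => truncate N V w) atTop (𝓝 (V w)) := by
  refine tendsto_const_nhds.congr' ?_
  filter_upwards [eventually_gt_atTop w.length] with N hN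
  rw [truncate, if_pos hN]

theorem DominatesGeomMean.mono {τ : Measure ℝ} {c d : ℝ} (h : DominatesGeomMean τ d)
    (hcd : c ≤ d) : DominatesGeomMean τ c := fun f hf a b ha hfab =>
  (mul_le_mul_of_nonneg_right hcd (Real.exp_pos _).le).trans (h f hf a b ha hfab)

/-- For each test function only the right-hand side depends on the measure, so the inequality is
closed under weak limits. It stands in for upper semicontinuity of the entropy. -/
theorem dominatesGeomMean_of_tendsto {τ : ℕ → Measure ℝ} {σ : Measure ℝ} {c : ℝ}
    (h : ∀ n, DominatesGeomMean (τ n) c) (hlim : ∀ f : ℝ → ℝ, Continuous f →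
      Tendsto (fun n => ∫ x, f x ∂(τ n)) atTop (𝓝 (∫ x, f x ∂σ))) : DominatesGeomMean σ c :=
  fun f hf a b ha hfab => ge_of_tendsto' (hlim f hf) fun n => h n f hf a b ha hfab

/-- Truncation at depth `N` leaves `pathMean N` unchanged, so every truncated measure satisfies the
inequality with the common constant `c`; the operators converge strongly as `N → ∞`. -/
theorem dominatesGeomMean_rootMeasure (V : List (Fin 2) → ℝ) (hV : ∃ C : ℝ, ∀ x, |V x| ≤ C)
    {c : ℝ} (hc : ∀ N, c ≤ pathMean N V) : DominatesGeomMean (rootMeasure V hV) c := by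
  obtain ⟨C, hC⟩ := hV
  have hb : ∀ N x, |truncate N V x| ≤ C := fun N x => abs_truncate_le.trans (hC x)
  refine dominatesGeomMean_of_tendsto (τ := fun N => rootMeasure (truncate N V) ⟨C, hb N⟩)
    (fun N => ?_) fun f hf => ?_
  · refine DominatesGeomMean.mono ?_ (hc N)
    refine dominatesGeomMean_of_le_geomMean _ (ae_abs_le_rootMeasure _ _) (pathMean_pos N V).le N
      fun ε hε => ?_
    rw [← pathMean_truncate]
    exact pathMean_mul_le_geomMean _ _ hε N fun w hw => if_neg (not_lt.2 hw)
  · exact tendsto_integral_spectralMeasure_schrodinger branch branch_degree_le V ⟨C, hC⟩ _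
      (fun N => ⟨C, hb N⟩) hb tendsto_truncate _ hf

theorem dominatesGeomMean_betheMeasure (W : Fin 2 × List (Fin 2) → ℝ)
    (hW : ∃ C : ℝ, ∀ x, |W x| ≤ C) {c : ℝ} (hc : ∀ N, c ≤ pathMean N (half W 0)) :
    DominatesGeomMean (betheMeasure W hW) (Real.exp (-2⁻¹) * c) := by
  obtain ⟨C, hC⟩ := hW
  -- Depth `N + 1` rather than `N`: one level is used up by the special step at `O`.
  set K : ℕ → Fin 2 × List (Fin 2) → ℝ := fun N p => truncate (N + 1) (half W p.1) p.2 with hK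
  have hb : ∀ N p, |K N p| ≤ C := fun N p => abs_truncate_le.trans (hC p)
  refine dominatesGeomMean_of_tendsto (τ := fun N => betheMeasure (K N) ⟨C, hb N⟩)
    (fun N => ?_) fun f hf => ?_
  · refine DominatesGeomMean.mono ?_ (mul_le_mul_of_nonneg_left (hc (N + 1)) (Real.exp_pos _).le)
    refine dominatesGeomMean_of_le_geomMean _ (ae_abs_le_betheMeasure _ _)
      (mul_pos (Real.exp_pos _) (pathMean_pos _ _)).le (N + 1) fun ε hε => ?_
    rw [← pathMean_truncate]
    exact pathMean_mul_le_geomMean_bethe (K N) _ hε N fun w hw => if_neg (not_lt.2 hw)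
  · exact tendsto_integral_spectralMeasure_schrodinger bethe bethe_degree_le W ⟨C, hC⟩ _
      (fun N => ⟨C, hb N⟩) hb (fun p => (tendsto_truncate p.2).comp (tendsto_add_atTop_nat 1)) _ hf

end Truncation

/-! ### Binary digits as fair coin tosses -/

section Coin

/-- The sequence that starts with `b` and continues with `ω`. -/
def prepend (b : Fin 2) (ω : ℕ → Fin 2) : ℕ → Fin 2
  | 0 => b
  | n + 1 => ω n

theorem measurable_prepend (b : Fin 2) : Measurable (prepend b) := by
  rw [measurable_pi_iff]
  rintro (_ | n)
  · exact measurable_const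
  · exact measurable_pi_apply n

/-- A measure on binary sequences whose first digit is a fair coin toss, independent of the
remaining digits, which have again the same law. -/
def IsSelfSimilar (ν : Measure (ℕ → Fin 2)) : Prop :=
  ∀ F : (ℕ → Fin 2) → ℝ≥0∞, Measurable F →
    ∫⁻ ω, F ω ∂ν = 2⁻¹ * (∫⁻ ω, F (prepend 0 ω) ∂ν + ∫⁻ ω, F (prepend 1 ω) ∂ν)

theorem uniform_apply (t : Set (Fin 2)) :
    (PMF.uniformOfFintype (Fin 2)).toMeasure t =
      2⁻¹ * (t.indicator 1 0 + t.indicator 1 1) := by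
  rw [PMF.toMeasure_apply_fintype, Fin.sum_univ_two]
  by_cases h0 : (0 : Fin 2) ∈ t <;> by_cases h1 : (1 : Fin 2) ∈ t <;> simp [h0, h1, mul_add]

theorem measurableSet_cylinder (N : ℕ) (t : ℕ → Set (Fin 2)) :
    MeasurableSet {ω : ℕ → Fin 2 | ∀ i < N, ω i ∈ t i} := by
  have : {ω : ℕ → Fin 2 | ∀ i < N, ω i ∈ t i} =
      ⋂ i ∈ Finset.range N, (fun ω : ℕ → Fin 2 => ω i) ⁻¹' t i := by
    ext ω
    simp
  rw [this]
  exact Finset.measurableSet_biInter _ fun i _ => measurable_pi_apply i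
      (Set.toFinite _).measurableSet

/-- Self-similarity peels off the first digit; the shifted cylinder is handled by induction, hence
for all families `t`. -/
theorem IsSelfSimilar.cylinder {ν : Measure (ℕ → Fin 2)} (h : IsSelfSimilar ν)
    (h1 : ν Set.univ = 1) (N : ℕ) (t : ℕ → Set (Fin 2)) :
    ν {ω | ∀ i < N, ω i ∈ t i} =
      ∏ i ∈ Finset.range N, (PMF.uniformOfFintype (Fin 2)).toMeasure (t i) := by
  classical
  induction N generalizing t with
  | zero => simpa using h1
  | succ N ih =>
    have hb : ∀ b ω, {ω : ℕ → Fin 2 | ∀ i < N + 1, ω i ∈ t i}.indicator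
        (1 : (ℕ → Fin 2) → ℝ≥0∞) (prepend b ω) = (t 0).indicator 1 b *
          {ω : ℕ → Fin 2 | ∀ i < N, ω i ∈ t (i + 1)}.indicator 1 ω := by
      intro b ω
      have : (∀ i < N + 1, prepend b ω i ∈ t i) ↔ b ∈ t 0 ∧ ∀ i < N, ω i ∈ t (i + 1) := by
        constructor
        · intro h
          exact ⟨h 0 (Nat.succ_pos N), fun i hi => h (i + 1) (Nat.succ_lt_succ hi)⟩
        · rintro ⟨h0, h1⟩ (_ | i) hi
          · exact h0
          · exact h1 i (Nat.lt_of_succ_lt_succ hi)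
      simp only [Set.indicator_apply, Set.mem_ofPred_eq, this, Pi.one_apply]
      by_cases h0 : b ∈ t 0 <;> simp [h0]
    rw [← lintegral_indicator_one (measurableSet_cylinder _ _),
      h _ (measurable_one.indicator (measurableSet_cylinder _ _))]
    simp only [hb]
    rw [lintegral_const_mul _ (measurable_one.indicator (measurableSet_cylinder _ _)),
      lintegral_const_mul _ (measurable_one.indicator (measurableSet_cylinder _ _)),
      lintegral_indicator_one (measurableSet_cylinder _ _), ih fun i => t (i + 1),
      Finset.prod_range_succ', uniform_apply (t 0)]
    ring

/-- A product measure is determined by finite boxes; a box over any finite index set is a cylinder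
over an initial segment with no condition at the other indices. -/
theorem IsSelfSimilar.eq_coin {ν : Measure (ℕ → Fin 2)} (h : IsSelfSimilar ν)
    (h1 : ν Set.univ = 1) : ν = coin := by
  classical
  apply Measure.eq_infinitePi
  intro s t _
  obtain ⟨N, hN⟩ := s.exists_nat_subset_range
  have h2 := h.cylinder h1 N fun i => if i ∈ s then t i else Set.univ
  have h3 : {ω : ℕ → Fin 2 | ∀ i < N, ω i ∈ (if i ∈ s then t i else Set.univ : Set (Fin 2))} =
      Set.pi s t := by
    ext ω
    simp only [Set.mem_ofPred_eq, Set.mem_pi, Finset.mem_coe]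
    constructor
    · intro h i hi
      have := h i (Finset.mem_range.1 (hN hi))
      rwa [if_pos hi] at this
    · intro h i _
      split_ifs with hi
      · exact h i hi
      · exact Set.mem_univ _
  rw [h3] at h2
  rw [h2, ← Finset.prod_subset hN]
  · exact Finset.prod_congr rfl fun i hi => by rw [if_pos hi]
  · intro i _ hi
    rw [if_neg hi, measure_univ]

theorem measurable_digits : Measurable fun t : ℝ => Real.digits t 2 := by
  rw [measurable_pi_iff]
  intro i
  exact (measurable_of_countable (Fin.ofNat 2)).comp
    (Nat.measurable_floor.comp (measurable_id.mul_const _))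

theorem digits_add_div_two (b : Fin 2) {y : ℝ} (hy : y ∈ Set.Ico (0 : ℝ) 1) :
    Real.digits ((y + (b : ℕ)) / 2) 2 = prepend b (Real.digits y 2) := by
  funext n
  cases n with
  | zero =>
    have h1 : (y + (b : ℕ)) / 2 * ((2 : ℕ) : ℝ) ^ (0 + 1) = y + (b : ℕ) := by
      push_cast
      ring
    rw [Real.digits, h1, Nat.floor_add_natCast hy.1, Nat.floor_eq_zero.2 hy.2, zero_add]
    simp [prepend]
  | succ n =>
    have h1 : (y + (b : ℕ)) / 2 * ((2 : ℕ) : ℝ) ^ (n + 1 + 1) =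
        y * ((2 : ℕ) : ℝ) ^ (n + 1) + ((b * 2 ^ (n + 1) : ℕ) : ℝ) := by
      push_cast
      ring
    rw [prepend, Real.digits, Real.digits, h1, Nat.floor_add_natCast (by
      have := hy.1
      positivity)]
    ext
    rw [Fin.val_ofNat, Fin.val_ofNat, pow_succ 2 n, ← mul_assoc, Nat.add_mul_mod_self_right]

theorem lintegral_Ico_div_two (b : Fin 2) (G : ℝ → ℝ≥0∞) :
    ∫⁻ t in Set.Ico (((b : ℕ) : ℝ) / 2) ((((b : ℕ) : ℝ) + 1) / 2), G t =
      2⁻¹ * ∫⁻ y in Set.Ico (0 : ℝ) 1, G ((y + (b : ℕ)) / 2) := by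
  have himg : (fun y : ℝ => (y + (b : ℕ)) / 2) '' Set.Ico (0 : ℝ) 1 =
      Set.Ico (((b : ℕ) : ℝ) / 2) ((((b : ℕ) : ℝ) + 1) / 2) := by
    ext t
    constructor
    · rintro ⟨y, hy, rfl⟩
      exact ⟨by linarith [hy.1], by linarith [hy.2]⟩
    · intro ht
      exact ⟨2 * t - (b : ℕ), ⟨by linarith [ht.1], by linarith [ht.2]⟩, by ring⟩
  rw [← himg, lintegral_image_eq_lintegral_abs_deriv_mul (f' := fun _ => 1 / 2) measurableSet_Ico
    (fun y _ => (((hasDerivAt_id' y).add_const _).div_const 2).hasDerivWithinAt)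
    (fun x _ y _ hxy => by
      have : (x + (b : ℕ)) / 2 = (y + (b : ℕ)) / 2 := hxy
      linarith)]
  have h2 : ENNReal.ofReal |1 / 2| = 2⁻¹ := by
    rw [abs_of_pos (by norm_num), one_div, ENNReal.ofReal_inv_of_pos two_pos, ENNReal.ofReal_ofNat]
  rw [h2, lintegral_const_mul' _ _ (by simp)]

/-- The maps `y ↦ (y + b)/2` send `[0, 1)` to its two halves, scale Lebesgue measure by `1/2` and
prepend the digit `b`. -/
theorem isSelfSimilar_map_digits :
    IsSelfSimilar ((volume.restrict (Set.Ico (0 : ℝ) 1)).map fun t => Real.digits t 2) := by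
  intro F hF
  have hP : ∀ b, Measurable fun ω => F (prepend b ω) := fun b => hF.comp (measurable_prepend b)
  rw [lintegral_map hF measurable_digits, lintegral_map (hP 0) measurable_digits,
    lintegral_map (hP 1) measurable_digits]
  have hb : ∀ b : Fin 2, ∫⁻ t in Set.Ico (((b : ℕ) : ℝ) / 2) ((((b : ℕ) : ℝ) + 1) / 2),
      F (Real.digits t 2) = 2⁻¹ * ∫⁻ y in Set.Ico (0 : ℝ) 1, F (prepend b (Real.digits y 2)) := by
    intro b
    rw [lintegral_Ico_div_two b fun t => F (Real.digits t 2)]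
    congr 1
    exact setLIntegral_congr_fun measurableSet_Ico fun y hy => by
      rw [digits_add_div_two b hy]
  have h0 := hb 0
  have h1 := hb 1
  simp only [Fin.val_zero, Fin.val_one, Nat.cast_zero, Nat.cast_one, zero_div, zero_add,
    one_add_one_eq_two, div_self (two_ne_zero : (2 : ℝ) ≠ 0)] at h0 h1
  rw [mul_add, ← h0, ← h1, ← lintegral_union measurableSet_Ico, Set.Ico_union_Ico_eq_Ico
    (by norm_num) (by norm_num)]
  rw [Set.disjoint_left]
  exact fun t h h' => not_lt.2 h'.1 h.2

/-- The binary digits of a uniformly distributed number are independent fair coin tosses. -/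
theorem map_digits_eq_coin :
    (volume.restrict (Set.Ico (0 : ℝ) 1)).map (fun t => Real.digits t 2) = coin := by
  apply isSelfSimilar_map_digits.eq_coin
  rw [Measure.map_apply measurable_digits MeasurableSet.univ]
  simp

theorem isSelfSimilar_coin : IsSelfSimilar coin :=
  map_digits_eq_coin ▸ isSelfSimilar_map_digits

/-- The digits are controlled on `[0, 1)`; the endpoint `1` is null, so its expansion does not
matter. -/
theorem lintegral_coin_eq {F : (ℕ → Fin 2) → ℝ≥0∞} (hF : Measurable F) :
    ∫⁻ ω, F ω ∂coin = ∫⁻ t in Set.Icc (0 : ℝ) 1, F (Real.digits t 2) := by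
  rw [← map_digits_eq_coin, lintegral_map hF measurable_digits,
    Measure.restrict_congr_set Ico_ae_eq_Icc]

end Coin

/-! ### The exponential functional of the random path -/

section PathFunctional

/-- The newest letter stands in front, so a case distinction on it replaces `f` by `f (b :: ·)`; the
induction is therefore over all `f`. -/
theorem measurable_apply_path (f : List (Fin 2) → ℝ) (n : ℕ) :
    Measurable fun ω => f (path ω n) := by
  induction n generalizing f with
  | zero => exact measurable_const (a := f [])
  | succ n ih =>
    have h : (fun ω => f (path ω (n + 1))) = fun ω =>
        if ω n = 0 then f (0 :: path ω n) else f (1 :: path ω n) := by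
      funext ω
      rw [path]
      rcases (by omega : ω n = 0 ∨ ω n = 1) with h | h <;> simp [h]
    rw [h]
    refine Measurable.ite ?_ (ih fun w => f (0 :: w)) (ih fun w => f (1 :: w))
    exact (measurable_pi_apply (X := fun _ : ℕ => Fin 2) n) (measurableSet_singleton (0 : Fin 2))

theorem measurable_pathSum (V : List (Fin 2) → ℝ) : Measurable (pathSum V) :=
  Measurable.tsum fun n =>
    (measurable_apply_path (fun w => V w ^ 2) n).ennreal_ofReal

theorem measurable_expNegQuarter : Measurable expNegQuarter :=
  EReal.measurable_exp.comp (measurable_coe_ennreal_ereal.comp (measurable_id.div_const 4)).neg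

theorem path_prepend_succ (b : Fin 2) (ω : ℕ → Fin 2) (n : ℕ) :
    path (prepend b ω) (n + 1) = path ω n ++ [b] := by
  induction n with
  | zero => rfl
  | succ n ih => rw [path, ih, path, prepend, List.cons_append]

theorem pathSum_prepend (V : List (Fin 2) → ℝ) (b : Fin 2) (ω : ℕ → Fin 2) :
    pathSum V (prepend b ω) = ENNReal.ofReal (V [] ^ 2) + pathSum (child V b) ω := by
  rw [pathSum, tsum_eq_zero_add' ENNReal.summable]
  simp only [path_prepend_succ]
  rfl

theorem expNegQuarter_ofReal_add {a : ℝ} (ha : 0 ≤ a) (s : ℝ≥0∞) :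
    expNegQuarter (ENNReal.ofReal a + s) = ENNReal.ofReal (Real.exp (-a / 4)) * expNegQuarter s :=
      by
  have h4 : ENNReal.ofReal a / 4 = ENNReal.ofReal (a / 4) := by
    rw [ENNReal.ofReal_div_of_pos (by norm_num), ENNReal.ofReal_ofNat]
  rw [expNegQuarter, expNegQuarter, ENNReal.add_div, h4, EReal.coe_ennreal_add,
    EReal.coe_ennreal_ofReal, max_eq_left (by positivity), EReal.neg_add
      (Or.inl (EReal.coe_ne_bot _))
    (Or.inl (EReal.coe_ne_top _)), sub_eq_add_neg, EReal.exp_add, ← EReal.coe_neg, EReal.exp_coe,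
    neg_div]

theorem expNegQuarter_le_one (s : ℝ≥0∞) : expNegQuarter s ≤ 1 := by
  rw [expNegQuarter, EReal.exp_le_one_iff, EReal.neg_le, neg_zero]
  exact EReal.coe_ennreal_nonneg _

instance : IsProbabilityMeasure coin := by
  unfold coin
  infer_instance

theorem lintegral_expNegQuarter_pathSum_eq (V : List (Fin 2) → ℝ) :
    ∫⁻ ω, expNegQuarter (pathSum V ω) ∂coin = ENNReal.ofReal (Real.exp (-V [] ^ 2 / 4)) *
      (∫⁻ ω, expNegQuarter (pathSum (child V 0) ω) ∂coin +
        ∫⁻ ω, expNegQuarter (pathSum (child V 1) ω) ∂coin) / 2 := by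
  have hm : ∀ V : List (Fin 2) → ℝ, Measurable fun ω => expNegQuarter (pathSum V ω) := fun V =>
    measurable_expNegQuarter.comp (measurable_pathSum V)
  rw [isSelfSimilar_coin _ (hm V)]
  simp only [pathSum_prepend, expNegQuarter_ofReal_add (sq_nonneg (V []))]
  rw [lintegral_const_mul _ (hm _), lintegral_const_mul _ (hm _), ENNReal.div_eq_inv_mul]
  ring_nf

/-- The expectation satisfies the recursion of `pathMean`, and after `N` steps the remaining
functional is bounded by `1`. -/
theorem lintegral_expNegQuarter_pathSum_le (V : List (Fin 2) → ℝ) (N : ℕ) :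
    ∫⁻ ω, expNegQuarter (pathSum V ω) ∂coin ≤ ENNReal.ofReal (pathMean N V) := by
  induction N generalizing V with
  | zero =>
    rw [pathMean, ENNReal.ofReal_one]
    refine (lintegral_mono fun ω => expNegQuarter_le_one _).trans ?_
    simp
  | succ N ih =>
    rw [lintegral_expNegQuarter_pathSum_eq, pathMean, ENNReal.ofReal_div_of_pos two_pos,
      ENNReal.ofReal_mul (Real.exp_pos _).le,
      ENNReal.ofReal_add (pathMean_pos _ _).le (pathMean_pos _ _).le, ENNReal.ofReal_ofNat]
    gcongr <;> exact ih _

end PathFunctional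

end BetheLattice

/-! ### The theorem -/

open BetheLattice

theorem theorem5p8 (V : List (Fin 2) → ℝ) (hV : ∃ C : ℝ, ∀ x, |V x| ≤ C) :
    (∫⁻ ω, BetheLattice.expNegQuarter (BetheLattice.pathSum V ω) ∂BetheLattice.coin
      ≤ EReal.exp (BetheLattice.entropy V hV)) ∧
    (∫⁻ ω, BetheLattice.expNegQuarter (BetheLattice.pathSum V ω) ∂BetheLattice.coin
      = ∫⁻ t in Set.Icc (0 : ℝ) 1, BetheLattice.expNegQuarter (BetheLattice.phi V t)) ∧
    (0 < ∫⁻ t in Set.Icc (0 : ℝ) 1, BetheLattice.expNegQuarter (BetheLattice.phi V t) →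
      Set.Icc (-(2 * Real.sqrt 2)) (2 * Real.sqrt 2) ⊆
        BetheLattice.acSpectrum (BetheLattice.branchOperator V hV)
          (BetheLattice.isSelfAdjoint_branchOperator V hV) ∧
      ∀ (W : Fin 2 × List (Fin 2) → ℝ) (hW : ∃ C : ℝ, ∀ x, |W x| ≤ C),
        (∀ x, W (0, x) = V x) →
        Set.Icc (-(2 * Real.sqrt 2)) (2 * Real.sqrt 2) ⊆
          BetheLattice.acSpectrum (BetheLattice.betheOperator W hW)
            (BetheLattice.isSelfAdjoint_betheOperator W hW)) := by
  have heq : ∫⁻ ω, expNegQuarter (pathSum V ω) ∂coin =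
      ∫⁻ t in Set.Icc (0 : ℝ) 1, expNegQuarter (phi V t) :=
    lintegral_coin_eq (measurable_expNegQuarter.comp (measurable_pathSum V))
  have hle := lintegral_expNegQuarter_pathSum_le V
  set I := ∫⁻ ω, expNegQuarter (pathSum V ω) ∂coin with hI
  have hfin : I ≠ ∞ := ne_top_of_le_ne_top ENNReal.ofReal_ne_top (hle 0)
  -- The expectation over infinite paths bounds all finite path means from below, so it serves as
  -- the constant for every truncation.
  have hc : ∀ N, I.toReal ≤ pathMean N V := fun N =>
    ENNReal.toReal_le_of_le_ofReal (pathMean_pos N V).le (hle N)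
  have hband : -(2 * Real.sqrt 2) < 2 * Real.sqrt 2 := by
    have : 0 < Real.sqrt 2 := by positivity
    linarith
  have hdom := dominatesGeomMean_rootMeasure V hV hc
  refine ⟨?_, heq, fun hpos => ?_⟩
  -- The entropy bound needs a positive constant; for `I = 0` the claim is trivial.
  · rcases eq_or_ne I 0 with h0 | h0
    · rw [h0]
      exact zero_le
    · have h1 := hdom.le_exp_erealIntegral (ENNReal.toReal_pos h0 hfin)
      rwa [ENNReal.ofReal_toReal hfin] at h1
  · rw [← heq] at hpos
    have hpos' : 0 < I.toReal := ENNReal.toReal_pos hpos.ne' hfin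
    refine ⟨Icc_subset_acSpectrum _ _ _ hband (hdom.rnDeriv_ne_zero hpos'), fun W hW hWV => ?_⟩
    obtain rfl : V = half W 0 := funext fun x => (hWV x).symm
    exact Icc_subset_acSpectrum _ _ _ hband
        ((dominatesGeomMean_betheMeasure W hW hc).rnDeriv_ne_zero
      (mul_pos (Real.exp_pos _) hpos'))
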